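/- **Setting.** Consider $x_{t+1}=Ax_t+Bu^a_t+w_t$ with $x_0=\bar x\in\mathbb R^d$, $A\in\mathbb R^{d\times d}$, $B\in\mathbb R^{d\times m}$. The dropouts $(\nu_t)$ are i.i.d. $\{0,1\}$-valued with $\mathbb E\nu_t=p\in(0,1]$; the noise $(w_t)$ is i.i.d., of mean zero, symmetric about the origin, with $\mathbb E\|w_t\|^4<\infty$, and independent of $(\nu_t)$. Assume that $A$ is Lyapunov stable (its eigenvalues lie in the closed unit disc, those on the unit circle have equal algebraic and geometric multiplicities) and that $(A,B)$ is stabilizable. Then there is a linear change of coordinates $T$ with $TAT^{-1}=\mathrm{blkdiag}(A_o,A_s)$, $A_o\in\mathbb R^{d_o\times d_o}$ orthogonal and $A_s$ Schur stable, and for every such $T$ there is $k\ge1$ for which $R_k=(A_o^{k-1}B_o,\dots,A_oB_o,B_o)$ has rank $d_o$; here $x^o$ and $B_o$ denote the first $d_o$ rows of $Tx$ and $TB$. Fix such a $T$, an integer $\kappa\ge1$ with $\mathrm{rank}\,R_\kappa=d_o$ (for instance the reachability index), a horizon $N\ge\kappa$, the recalculation interval $N_r=\kappa$, symmetric matrices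 $Q,Q_f\succeq0$, $R\succ0$, numbers $U_{\max}>0$, $\mu\ge0$, and $r,\varepsilon,\zeta>0$ with $\zeta\sqrt{d_o}\,\sigma_1(R_\kappa^+)<U_{\max}$, where $\sigma_1(R_\kappa^+)$ is the largest singular value of the pseudoinverse. Let $\mathfrak e_1,\dots,\mathfrak e_{N-1}:\mathbb R^d\to\mathbb R^d$ be measurable and odd with $\|\mathfrak e_i\|_\infty\le\varphi_{\max}$. For a sequence $s$ write $s_{t:k}$ for the stacked vector of $s_t,\dots,s_{t+k-1}$. **Policies and protocol TP1.** A decision is $z=(\boldsymbol\eta,\boldsymbol\Theta,\boldsymbol\Lambda)$ with $\boldsymbol\eta\in\mathbb R^{mN}$ and $\boldsymbol\Theta\in\mathbb R^{mN\times d(N-1)}$, $\boldsymbol\Lambda\in\mathbb R^{mN\times(N-1)}$ strictly lower block triangular. The applied control is $$u^a_{t:N}=\mathcal S\bigl(\boldsymbol\eta+\boldsymbol\Theta\,\mathfrak e(w_{t:N-1})+\boldsymbol\Lambda\nu_{t:N-1}\bigr),\qquad \mathcal S=\mathrm{blkdiag}(\nu_tI_m,\dots,\nu_{t+\kappa-1}I_m,I_{m(N-\kappa)}),$$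 where $\mathfrak e(w_{t:N-1})$ stacks $\mathfrak e_{i+1}(w_{t+i})$, $0\le i\le N-2$. **Optimal control problem at $t\in\{0,\kappa,2\kappa,\dots\}$, given $x_t=x$.** Minimize over $z$ $$\mathbb E_{x}\Bigl[\sum_{k=0}^{N-1}\bigl(\langle x_{t+k},Qx_{t+k}\rangle+\langle u^a_{t+k},Ru^a_{t+k}\rangle\bigr)+\langle x_{t+N},Q_fx_{t+N}\rangle\Bigr]+\mu\,\varrho(z),$$ where $\varrho(z)$ is the sum over the $N$ block rows of $(\boldsymbol\eta\ \boldsymbol\Theta\ \boldsymbol\Lambda)$ of the largest absolute value of an entry, subject to: * (C) $\|u^a_{t+k}\|_\infty\le U_{\max}$ for $0\le k<N$, for all values in $\{0,1\}$ of the dropouts and all values of norm $\|\mathfrak e\|_\infty\le\varphi_{\max}$ of the saturated noise; * (D) for $j=1,\dots,d_o$, with $v=(A_o^\kappa)^\top R_\kappa\bigl[\boldsymbol\eta_{1:\kappa m}+p\,\boldsymbol\Lambda_{1:\kappa m}\mathbb 1_{N-1}\bigr]$: $v^{(j)}\le-\zeta$ whenever $(x^o)^{(j)}\ge r+\varepsilon$,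 and $v^{(j)}\ge\zeta$ whenever $(x^o)^{(j)}\le-r-\varepsilon$. **Theorem.** (i) For every $t=0,\kappa,2\kappa,\dots$ and every $x\in\mathbb R^d$ this problem is convex and feasible. Its feasible set is the set of decisions that satisfy (D) and $$\Bigl|\boldsymbol\eta^{(i)}+\tfrac12\boldsymbol\Lambda^{(i,:)}\mathbb 1\Bigr|+\tfrac12\|\boldsymbol\Lambda^{(i,:)}\|_1+\|\boldsymbol\Theta^{(i,:)}\|_1\varphi_{\max}\le U_{\max},\qquad i=1,\dots,mN,$$ and on it the cost is integrable and the objective equals $$\langle\Xi,\mathcal L\Xi\rangle+\langle\mathcal M\mathcal Ax,\Xi\rangle+\langle\mathcal Ax,\mathcal Q\mathcal Ax\rangle+2\,\mathrm{tr}(\boldsymbol\Theta^\top\mu_{\mathcal S}^\top\mathcal B^\top\mathcal Q\mathcal D\Sigma'_{\mathfrak e})+\mathrm{tr}(\mathcal D^\top\mathcal Q\mathcal D\Sigma_w)+\mathrm{tr}(\boldsymbol\Theta^\top\Sigma_{\mathcal S}\boldsymbol\Theta\Sigma_{\mathfrak e})+\mu\varrho(z).$$ Here $\mathcal A,\mathcal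 B,\mathcal D$ are the matrices with $x_{t:N+1}=\mathcal Ax_t+\mathcal Bu^a_{t:N}+\mathcal Dw_{t:N}$; $\mathcal Q=\mathrm{blkdiag}(Q,\dots,Q,Q_f)$, $\mathcal R=\mathrm{blkdiag}(R,\dots,R)$, $\alpha=\mathcal B^\top\mathcal Q\mathcal B+\mathcal R$; $\mathfrak C_\ell=\binom{0}{I_{m(N-\ell)}}\in\mathbb R^{mN\times m(N-\ell)}$; $\Xi$ stacks $\boldsymbol\eta,\mathfrak C_1^\top\boldsymbol\Lambda^{(:,1)},\dots,\mathfrak C_{N-1}^\top\boldsymbol\Lambda^{(:,N-1)}$; $\mathcal S_\ell=\nu_{t+\ell-1}\mathcal S$; $\mu_{\mathcal S}=\mathbb E\mathcal S$, $\Sigma_{\mathcal S}=\mathbb E[\mathcal S^\top\alpha\mathcal S]$, $\Sigma'_{\mathfrak e}=\mathbb E[w_{t:N}\mathfrak e(w_{t:N-1})^\top]$, $\Sigma_w=\mathbb E[w_{t:N}w_{t:N}^\top]$, $\Sigma_{\mathfrak e}=\mathbb E[\mathfrak e(w_{t:N-1})\mathfrak e(w_{t:N-1})^\top]$; and $$\mathcal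 L=\begin{pmatrix}\Sigma_{\mathcal S}&\bigl(\mathbb E[\mathcal S^\top\alpha\mathcal S_\ell]\mathfrak C_\ell\bigr)_\ell\\ \bigl(\mathbb E[\mathcal S^\top\alpha\mathcal S_\ell]\mathfrak C_\ell\bigr)_\ell^\top&\bigl(\mathfrak C_n^\top\mathbb E[\mathcal S_n^\top\alpha\mathcal S_\ell]\mathfrak C_\ell\bigr)_{n,\ell}\end{pmatrix},\qquad \mathcal M=2\bigl(\mathcal Q\mathcal B\mu_{\mathcal S}\ \ (\mathcal Q\mathcal B\,\mathbb E[\mathcal S_\ell]\mathfrak C_\ell)_\ell\bigr)^\top .$$ The minimization of this expression over this set is a convex quadratic program, after adding finitely many slack variables for the absolute values and maxima. (ii) There are Borel maps $\pi_n$ such that $\pi_n(x)$ is a minimizer of the problem at time $n\kappa$ for every $x$. For every such sequence and every initial condition $\bar x\in\mathbb R^d$, let the decision $\pi_n(x_{n\kappa})$ be computed at each time $n\kappa$ and applied under TP1 for $\kappa$ steps. Then $\|u^a_t\|_\infty\le U_{\max}$ for all $t$, and the closed loop is mean-square bounded: $\sup_{t\ge0}\mathbb E\|x_t\|^2<\infty$.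 -/

import Mathlib

open MeasureTheory ProbabilityTheory Matrix

noncomputable section

namespace NetMPC

/-! ### Matrices: stability, stabilizability, orthogonal/Schur decomposition -/

/-- The characteristic polynomial of a real square matrix, over the complex numbers. -/
def complexCharpoly {n : Type*} [Fintype n] [DecidableEq n] (A : Matrix n n ℝ) : Polynomial ℂ :=
  (A.map (algebraMap ℝ ℂ)).charpoly

/-- All eigenvalues lie in the open unit disc. -/
def SchurStable {n : Type*} [Fintype n] [DecidableEq n] (A : Matrix n n ℝ) : Prop :=
  ∀ z : ℂ, (complexCharpoly A).IsRoot z → ‖z‖ < 1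

/-- All eigenvalues lie in the closed unit disc, and those on the unit circle have equal algebraic
and geometric multiplicities. -/
def LyapunovStable {n : Type*} [Fintype n] [DecidableEq n] (A : Matrix n n ℝ) : Prop :=
  ∀ z : ℂ, (complexCharpoly A).IsRoot z → ‖z‖ ≤ 1 ∧
    (‖z‖ = 1 → (complexCharpoly A).rootMultiplicity z =
      Module.finrank ℂ (Module.End.eigenspace (Matrix.toLin' (A.map (algebraMap ℝ ℂ))) z))

/-- `(A, B)` is stabilizable: some linear state feedback makes `A + B K` Schur stable. -/
def Stabilizable {n m : Type*} [Fintype n] [DecidableEq n] [Fintype m]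
    (A : Matrix n n ℝ) (B : Matrix n m ℝ) : Prop :=
  ∃ K : Matrix m n ℝ, SchurStable (A + B * K)

/-- A linear change of coordinates `T` that brings `A` to the form `blkdiag(Ao, As)`, with `Ao`
orthogonal and `As` Schur stable. -/
structure OrthSchurDecomp {d : ℕ} (A : Matrix (Fin d) (Fin d) ℝ) (dO dS : ℕ) where
  T : Matrix (Fin dO ⊕ Fin dS) (Fin d) ℝ
  Tinv : Matrix (Fin d) (Fin dO ⊕ Fin dS) ℝ
  Ao : Matrix (Fin dO) (Fin dO) ℝ
  As : Matrix (Fin dS) (Fin dS) ℝ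
  mul_inv : T * Tinv = 1
  inv_mul : Tinv * T = 1
  conj : T * A * Tinv = Matrix.fromBlocks Ao 0 0 As
  orthogonal : Ao ∈ Matrix.orthogonalGroup (Fin dO) ℝ
  schur : SchurStable As

/-- The orthogonal component `x^o` of a state. -/
def OrthSchurDecomp.orthState {d dO dS : ℕ} {A : Matrix (Fin d) (Fin d) ℝ}
    (D : OrthSchurDecomp A dO dS) (x : Fin d → ℝ) : Fin dO → ℝ :=
  fun j => (D.T *ᵥ x) (Sum.inl j)

/-- The orthogonal block `B_o` of the control matrix. -/
def OrthSchurDecomp.Bo {d dO dS m : ℕ} {A : Matrix (Fin d) (Fin d) ℝ}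
    (D : OrthSchurDecomp A dO dS) (B : Matrix (Fin d) (Fin m) ℝ) : Matrix (Fin dO) (Fin m) ℝ :=
  (D.T * B).toRows₁

/-- The reachability matrix `R_κ = (A^(κ-1) B, A^(κ-2) B, …, B)`. -/
def reachMatrix {n m : ℕ} (A : Matrix (Fin n) (Fin n) ℝ) (B : Matrix (Fin n) (Fin m) ℝ) (κ : ℕ) :
    Matrix (Fin n) (Fin κ × Fin m) ℝ :=
  Matrix.of fun i q => (A ^ (κ - 1 - (q.1 : ℕ)) * B) i q.2

/-- The Moore–Penrose pseudoinverse of a matrix of full row rank. -/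
def rowPinv {n q : Type*} [Fintype n] [DecidableEq n] [Fintype q] (M : Matrix n q ℝ) :
    Matrix q n ℝ :=
  Mᵀ * (M * Mᵀ)⁻¹

/-- The largest singular value. -/
def sigmaMax {n q : Type*} [Fintype n] [DecidableEq n] [Fintype q] (M : Matrix q n ℝ) : ℝ :=
  (Matrix.toEuclideanLin M).singularValues 0

/-! ### Problem data -/

/-- The data: plant matrices, weights, control bound, sparsity weight (`reg`, written `μ` in
print), horizon `N`, recalculation interval `κ`, and the saturation functions of the policy with
their bound. -/
structure Problem (d m N κ : ℕ) where
  A : Matrix (Fin d) (Fin d) ℝ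
  B : Matrix (Fin d) (Fin m) ℝ
  Q : Matrix (Fin d) (Fin d) ℝ
  Qf : Matrix (Fin d) (Fin d) ℝ
  R : Matrix (Fin m) (Fin m) ℝ
  Umax : ℝ
  reg : ℝ
  sat : Fin (N - 1) → (Fin d → ℝ) → (Fin d → ℝ)
  satBound : ℝ
  one_le_κ : 1 ≤ κ
  κ_le_N : κ ≤ N
  posSemidef_Q : Q.PosSemidef
  posSemidef_Qf : Qf.PosSemidef
  posDef_R : R.PosDef
  Umax_pos : 0 < Umax
  reg_nonneg : 0 ≤ reg
  satBound_nonneg : 0 ≤ satBound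
  sat_measurable : ∀ i, Measurable (sat i)
  sat_odd : ∀ i v, sat i (-v) = - sat i v
  sat_le : ∀ i v, ‖sat i v‖ ≤ satBound

/-- Standing assumptions on the dropouts `ν` and the process noise `w`. -/
structure IsDisturbance {Ω : Type*} [MeasurableSpace Ω] (P : Measure Ω) {d : ℕ} (p : ℝ)
    (ν : ℕ → Ω → ℝ) (w : ℕ → Ω → Fin d → ℝ) : Prop where
  p_pos : 0 < p
  p_le_one : p ≤ 1
  ν_measurable : ∀ t, Measurable (ν t)
  ν_bernoulli : ∀ t ω, ν t ω = 0 ∨ ν t ω = 1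
  ν_mean : ∀ t, ∫ ω, ν t ω ∂P = p
  ν_indep : iIndepFun ν P
  w_measurable : ∀ t, Measurable (w t)
  w_indep : iIndepFun w P
  w_ident : ∀ t, IdentDistrib (w t) (w 0) P P
  w_mean : ∀ t, ∫ ω, w t ω ∂P = 0
  w_symm : ∀ t, IdentDistrib (fun ω => - w t ω) (w t) P P
  w_fourth : ∀ t, Integrable (fun ω => ‖w t ω‖ ^ 4) P
  indep : IndepFun (fun ω t => ν t ω) (fun ω t => w t ω) P

/-! ### Policies and the sequential transmission protocol

A stacked vector with `N` blocks of size `m` is a function on `Fin N × Fin m`. Below `ν` and `w`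
are realizations of the dropouts and of the noise, counted from the start of the horizon. -/

/-- The decision variable `(η, Θ, Λ)`. -/
abbrev Decision (d m N : ℕ) : Type :=
  (Fin N × Fin m → ℝ) × Matrix (Fin N × Fin m) (Fin (N - 1) × Fin d) ℝ ×
    Matrix (Fin N × Fin m) (Fin (N - 1)) ℝ

/-- `Θ` and `Λ` are strictly lower block triangular: block row `k` uses only the blocks `i < k`. -/
def Causal {d m N : ℕ} (z : Decision d m N) : Prop :=
  (∀ (k : Fin N) (a : Fin m) (i : Fin (N - 1)) (b : Fin d), (k : ℕ) ≤ (i : ℕ) → z.2.1 (k, a) (i, b) = 0) ∧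
    (∀ (k : Fin N) (a : Fin m) (i : Fin (N - 1)), (k : ℕ) ≤ (i : ℕ) → z.2.2 (k, a) i = 0)

/-- The saturated noise `𝔢(w_{t:N-1})`. -/
def Problem.satStack {d m N κ : ℕ} (S : Problem d m N κ) (w : ℕ → Fin d → ℝ) :
    Fin (N - 1) × Fin d → ℝ :=
  fun q => S.sat q.1 (w q.1) q.2

/-- The stacked dropouts `ν_{t:N-1}`. -/
def dropStack (N : ℕ) (ν : ℕ → ℝ) : Fin (N - 1) → ℝ := fun i => ν i

/-- The stacked noise `w_{t:N}`. -/
def noiseStack {d : ℕ} (N : ℕ) (w : ℕ → Fin d → ℝ) : Fin N × Fin d → ℝ := fun q => w q.1 q.2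

/-- The computed controls `u_{t:N} = η + Θ e + Λ ν_{t:N-1}`. -/
def computed {d m N : ℕ} (z : Decision d m N) (e : Fin (N - 1) × Fin d → ℝ) (ν : ℕ → ℝ) :
    Fin N × Fin m → ℝ :=
  z.1 + z.2.1 *ᵥ e + z.2.2 *ᵥ dropStack N ν

/-- The matrix `𝒮 = blkdiag(ν_t I, …, ν_{t+κ-1} I, I)` of the sequential protocol. -/
def maskS (m N κ : ℕ) (ν : ℕ → ℝ) : Matrix (Fin N × Fin m) (Fin N × Fin m) ℝ :=
  Matrix.diagonal fun q => if (q.1 : ℕ) < κ then ν q.1 else 1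

/-- The controls `u^a_{t:N} = 𝒮 (η + Θ e + Λ ν_{t:N-1})` applied to the plant. -/
def applied {d m N : ℕ} (κ : ℕ) (z : Decision d m N) (e : Fin (N - 1) × Fin d → ℝ) (ν : ℕ → ℝ) :
    Fin N × Fin m → ℝ :=
  maskS m N κ ν *ᵥ computed z e ν

/-- The `k`-th block of a stacked control vector. -/
def block {m N : ℕ} (u : Fin N × Fin m → ℝ) (k : ℕ) : Fin m → ℝ :=
  fun a => if h : k < N then u (⟨k, h⟩, a) else 0

/-! ### The optimal control problem -/

/-- The states predicted from `x` under the stacked control `u` and the noise `w`. -/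
def Problem.predicted {d m N κ : ℕ} (S : Problem d m N κ) (x : Fin d → ℝ) (u : Fin N × Fin m → ℝ)
    (w : ℕ → Fin d → ℝ) : ℕ → Fin d → ℝ
  | 0 => x
  | k + 1 => S.A *ᵥ S.predicted x u w k + S.B *ᵥ block u k + w k

/-- The quadratic cost over one horizon. -/
def Problem.cost {d m N κ : ℕ} (S : Problem d m N κ) (x : Fin d → ℝ) (u : Fin N × Fin m → ℝ)
    (w : ℕ → Fin d → ℝ) : ℝ :=
  ∑ k ∈ Finset.range N, (S.predicted x u w k ⬝ᵥ S.Q *ᵥ S.predicted x u w k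
      + block u k ⬝ᵥ S.R *ᵥ block u k)
    + S.predicted x u w N ⬝ᵥ S.Qf *ᵥ S.predicted x u w N

/-- The matrix `F = (η Θ Λ)`. -/
def matF {d m N : ℕ} (z : Decision d m N) :
    Matrix (Fin N × Fin m) (Unit ⊕ (Fin (N - 1) × Fin d) ⊕ Fin (N - 1)) ℝ :=
  Matrix.fromCols (Matrix.of fun q _ => z.1 q) (Matrix.fromCols z.2.1 z.2.2)

/-- The regularization term: the sum over the `N` block rows of `F` of the largest absolute value
of an entry (the norm on a finite product is the sup norm). -/
def sparsity {d m N : ℕ} (z : Decision d m N) : ℝ :=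
  ∑ k : Fin N, ‖(fun q : Fin m × (Unit ⊕ (Fin (N - 1) × Fin d) ⊕ Fin (N - 1)) =>
    matF z (k, q.1) q.2)‖

/-- The cost from time `t` on, starting in the state `x`, under the decision `z`. -/
def Problem.randomCost {d m N κ : ℕ} (S : Problem d m N κ) {Ω : Type*} (ν : ℕ → Ω → ℝ)
    (w : ℕ → Ω → Fin d → ℝ) (t : ℕ) (x : Fin d → ℝ) (z : Decision d m N) (ω : Ω) : ℝ :=
  S.cost x (applied κ z (S.satStack fun k => w (t + k) ω) (fun k => ν (t + k) ω))
    (fun k => w (t + k) ω)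

/-- The objective of the optimal control problem at time `t`, given `x_t = x`. -/
def Problem.ocpObjective {d m N κ : ℕ} (S : Problem d m N κ) {Ω : Type*} [MeasurableSpace Ω]
    (P : Measure Ω) (ν : ℕ → Ω → ℝ) (w : ℕ → Ω → Fin d → ℝ) (t : ℕ) (x : Fin d → ℝ)
    (z : Decision d m N) : ℝ :=
  ∫ ω, S.randomCost ν w t x z ω ∂P + S.reg * sparsity z

/-- The hard control constraint: `‖u^a‖_∞ ≤ Umax` in each block, for all values in `{0,1}` of the
dropouts and all saturated noise values of norm at most `satBound`. -/
def Problem.ControlAdmissible {d m N κ : ℕ} (S : Problem d m N κ) (z : Decision d m N) : Prop :=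
  ∀ (e : Fin (N - 1) × Fin d → ℝ) (ν : ℕ → ℝ), ‖e‖ ≤ S.satBound → (∀ k, ν k = 0 ∨ ν k = 1) →
    ∀ k < N, ‖block (applied κ z e ν) k‖ ≤ S.Umax

/-- The vector `(A_o^κ)ᵀ R_κ [η_{1:κm} + p Λ_{1:κm} 𝟙]` of the stability constraints. -/
def Problem.drift {d m N κ : ℕ} (S : Problem d m N κ) {dO dS : ℕ} (D : OrthSchurDecomp S.A dO dS)
    (p : ℝ) (z : Decision d m N) : Fin dO → ℝ :=
  (D.Ao ^ κ)ᵀ *ᵥ (reachMatrix D.Ao (D.Bo S.B) κ *ᵥ fun q : Fin κ × Fin m =>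
    (z.1 + p • (z.2.2 *ᵥ fun _ => (1 : ℝ))) (Fin.castLE S.κ_le_N q.1, q.2))

/-- The stability (drift) constraints in the state `x`, with parameters `r, ε, ζ`. -/
def Problem.DriftConstraints {d m N κ : ℕ} (S : Problem d m N κ) {dO dS : ℕ}
    (D : OrthSchurDecomp S.A dO dS) (p r ε ζ : ℝ) (x : Fin d → ℝ) (z : Decision d m N) : Prop :=
  ∀ j : Fin dO, (r + ε ≤ D.orthState x j → S.drift D p z j ≤ -ζ) ∧
    (D.orthState x j ≤ -r - ε → ζ ≤ S.drift D p z j)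

/-- The feasible set of the optimal control problem with the stability constraints. -/
def Problem.ocpFeasible {d m N κ : ℕ} (S : Problem d m N κ) {dO dS : ℕ}
    (D : OrthSchurDecomp S.A dO dS) (p r ε ζ : ℝ) (x : Fin d → ℝ) : Set (Decision d m N) :=
  {z | Causal z ∧ S.ControlAdmissible z ∧ S.DriftConstraints D p r ε ζ x z}

/-! ### The quadratic program -/

/-- The feasible set of the program, with the explicit form of the control constraint. -/
def Problem.qpFeasible {d m N κ : ℕ} (S : Problem d m N κ) {dO dS : ℕ}
    (D : OrthSchurDecomp S.A dO dS) (p r ε ζ : ℝ) (x : Fin d → ℝ) : Set (Decision d m N) :=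
  {z | Causal z ∧
    (∀ i, |z.1 i + 1 / 2 * ∑ l, z.2.2 i l| + 1 / 2 * ∑ l, |z.2.2 i l|
      + (∑ c, |z.2.1 i c|) * S.satBound ≤ S.Umax) ∧
    S.DriftConstraints D p r ε ζ x z}

/-- Entrywise expectation of a random matrix. -/
def expect {Ω : Type*} [MeasurableSpace Ω] (P : Measure Ω) {a b : Type*} (M : Ω → Matrix a b ℝ) :
    Matrix a b ℝ :=
  Matrix.of fun i j => ∫ ω, M ω i j ∂P

/-- `𝒜`: block row `k` is `A^k`. -/
def Problem.stackA {d m N κ : ℕ} (S : Problem d m N κ) :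
    Matrix (Fin (N + 1) × Fin d) (Fin d) ℝ :=
  Matrix.of fun q j => (S.A ^ (q.1 : ℕ)) q.2 j

/-- `ℬ`: the block `(k, l)` is `A^(k-1-l) B` for `l < k`, and zero otherwise. -/
def Problem.stackB {d m N κ : ℕ} (S : Problem d m N κ) :
    Matrix (Fin (N + 1) × Fin d) (Fin N × Fin m) ℝ :=
  Matrix.of fun q c =>
    if (c.1 : ℕ) < (q.1 : ℕ) then (S.A ^ ((q.1 : ℕ) - 1 - (c.1 : ℕ)) * S.B) q.2 c.2 else 0

/-- `𝒟`: the block `(k, l)` is `A^(k-1-l)` for `l < k`, and zero otherwise. -/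
def Problem.stackD {d m N κ : ℕ} (S : Problem d m N κ) :
    Matrix (Fin (N + 1) × Fin d) (Fin N × Fin d) ℝ :=
  Matrix.of fun q c =>
    if (c.1 : ℕ) < (q.1 : ℕ) then (S.A ^ ((q.1 : ℕ) - 1 - (c.1 : ℕ))) q.2 c.2 else 0

/-- `𝒬 = blkdiag(Q, …, Q, Qf)`. -/
def Problem.stackQ {d m N κ : ℕ} (S : Problem d m N κ) :
    Matrix (Fin (N + 1) × Fin d) (Fin (N + 1) × Fin d) ℝ :=
  Matrix.of fun q c =>
    if q.1 = c.1 then (if (q.1 : ℕ) < N then S.Q q.2 c.2 else S.Qf q.2 c.2) else 0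

/-- `ℛ = blkdiag(R, …, R)`. -/
def Problem.stackR {d m N κ : ℕ} (S : Problem d m N κ) :
    Matrix (Fin N × Fin m) (Fin N × Fin m) ℝ :=
  Matrix.of fun q c => if q.1 = c.1 then S.R q.2 c.2 else 0

/-- `α = ℬᵀ 𝒬 ℬ + ℛ`. -/
def Problem.alpha {d m N κ : ℕ} (S : Problem d m N κ) :
    Matrix (Fin N × Fin m) (Fin N × Fin m) ℝ :=
  S.stackBᵀ * S.stackQ * S.stackB + S.stackR

/-- Index of the stacked vector of those entries of the columns of `Λ` that lie below the block
diagonal: column `l` (counted from `0`) has `N - 1 - l` such blocks. -/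
abbrev LamIdx (m N : ℕ) : Type := (l : Fin (N - 1)) × (Fin (N - 1 - (l : ℕ)) × Fin m)

/-- The selection matrix `ℭ` of column `l`: a zero matrix with `l + 1` block rows above an identity
matrix. -/
def selC (m N : ℕ) (l : Fin (N - 1)) :
    Matrix (Fin N × Fin m) (Fin (N - 1 - (l : ℕ)) × Fin m) ℝ :=
  Matrix.of fun q c => if (q.1 : ℕ) = (l : ℕ) + 1 + (c.1 : ℕ) ∧ q.2 = c.2 then 1 else 0

/-- `Ξ = (η, Λ̃)`, where `Λ̃` stacks the vectors `ℭᵀ Λ^{(:,l)}`. -/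
def xiVec {d m N : ℕ} (z : Decision d m N) : (Fin N × Fin m) ⊕ LamIdx m N → ℝ :=
  Sum.elim z.1 fun s => ((selC m N s.1)ᵀ *ᵥ fun q => z.2.2 q s.1) s.2

section Moments

variable {Ω : Type*} [MeasurableSpace Ω] (P : Measure Ω) {d m N κ : ℕ} (S : Problem d m N κ)
  (ν : ℕ → Ω → ℝ) (w : ℕ → Ω → Fin d → ℝ) (t : ℕ)

/-- `𝒮` at time `t`. -/
def randS (m N κ : ℕ) (ν : ℕ → Ω → ℝ) (t : ℕ) (ω : Ω) :
    Matrix (Fin N × Fin m) (Fin N × Fin m) ℝ :=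
  maskS m N κ fun k => ν (t + k) ω

/-- `𝒮` multiplied by the dropout variable that goes with column `l` of `Λ`. -/
def randSl (m N κ : ℕ) (ν : ℕ → Ω → ℝ) (t : ℕ) (l : Fin (N - 1)) (ω : Ω) :
    Matrix (Fin N × Fin m) (Fin N × Fin m) ℝ :=
  ν (t + l) ω • randS m N κ ν t ω

/-- `E[𝒮]`. -/
def muS (m N κ : ℕ) : Matrix (Fin N × Fin m) (Fin N × Fin m) ℝ :=
  expect P fun ω => randS m N κ ν t ω

/-- `E[𝒮ᵀ α 𝒮]`. -/
def Problem.sigmaS : Matrix (Fin N × Fin m) (Fin N × Fin m) ℝ :=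
  expect P fun ω => (randS m N κ ν t ω)ᵀ * S.alpha * randS m N κ ν t ω

/-- The matrix with block columns `E[𝒮ᵀ α 𝒮_l] ℭ_l`. -/
def Problem.sigmaSSl : Matrix (Fin N × Fin m) (LamIdx m N) ℝ :=
  Matrix.of fun q s =>
    ((expect P fun ω => (randS m N κ ν t ω)ᵀ * S.alpha * randSl m N κ ν t s.1 ω)
      * selC m N s.1) q s.2

/-- The matrix with blocks `ℭ_nᵀ E[𝒮_nᵀ α 𝒮_l] ℭ_l`. -/
def Problem.sigmaSnl : Matrix (LamIdx m N) (LamIdx m N) ℝ :=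
  Matrix.of fun s s' =>
    ((selC m N s.1)ᵀ
      * (expect P fun ω => (randSl m N κ ν t s.1 ω)ᵀ * S.alpha * randSl m N κ ν t s'.1 ω)
      * selC m N s'.1) s.2 s'.2

/-- The matrix with block columns `E[𝒮_l] ℭ_l`. -/
def muSl (m N κ : ℕ) : Matrix (Fin N × Fin m) (LamIdx m N) ℝ :=
  Matrix.of fun q s => ((expect P fun ω => randSl m N κ ν t s.1 ω) * selC m N s.1) q s.2

/-- The matrix `ℒ`, with `𝒮` in place of `𝒢`. -/
def Problem.matL : Matrix ((Fin N × Fin m) ⊕ LamIdx m N) ((Fin N × Fin m) ⊕ LamIdx m N) ℝ :=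
  Matrix.fromBlocks (S.sigmaS P ν t) (S.sigmaSSl P ν t) (S.sigmaSSl P ν t)ᵀ (S.sigmaSnl P ν t)

/-- The matrix `ℳ`, with `𝒮` in place of `𝒢`. -/
def Problem.matM : Matrix ((Fin N × Fin m) ⊕ LamIdx m N) (Fin (N + 1) × Fin d) ℝ :=
  (2 : ℝ) • (Matrix.fromCols (S.stackQ * S.stackB * muS P ν t m N κ)
    (S.stackQ * S.stackB * muSl P ν t m N κ))ᵀ

/-- `E[w wᵀ]`. -/
def sigmaW (N : ℕ) : Matrix (Fin N × Fin d) (Fin N × Fin d) ℝ :=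
  expect P fun ω => Matrix.vecMulVec (noiseStack N fun k => w (t + k) ω)
    (noiseStack N fun k => w (t + k) ω)

/-- `E[𝔢(w) 𝔢(w)ᵀ]`. -/
def Problem.sigmaE : Matrix (Fin (N - 1) × Fin d) (Fin (N - 1) × Fin d) ℝ :=
  expect P fun ω => Matrix.vecMulVec (S.satStack fun k => w (t + k) ω)
    (S.satStack fun k => w (t + k) ω)

/-- `E[w 𝔢(w)ᵀ]`. -/
def Problem.sigmaWE : Matrix (Fin N × Fin d) (Fin (N - 1) × Fin d) ℝ :=
  expect P fun ω => Matrix.vecMulVec (noiseStack N fun k => w (t + k) ω)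
    (S.satStack fun k => w (t + k) ω)

/-- The objective of the quadratic program at time `t`, given `x_t = x`. -/
def Problem.qpObjective (x : Fin d → ℝ) (z : Decision d m N) : ℝ :=
  xiVec z ⬝ᵥ S.matL P ν t *ᵥ xiVec z
    + (S.matM P ν t *ᵥ (S.stackA *ᵥ x)) ⬝ᵥ xiVec z
    + (S.stackA *ᵥ x) ⬝ᵥ S.stackQ *ᵥ (S.stackA *ᵥ x)
    + 2 * Matrix.trace (z.2.1ᵀ * (muS P ν t m N κ)ᵀ * S.stackBᵀ * S.stackQ * S.stackD
        * S.sigmaWE P w t)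
    + Matrix.trace (S.stackDᵀ * S.stackQ * S.stackD * sigmaW P w t N)
    + Matrix.trace (z.2.1ᵀ * S.sigmaS P ν t * z.2.1 * S.sigmaE P w t)
    + S.reg * sparsity z

end Moments

/-- Minimizing `J` over `F` is, after adding finitely many slack variables `s`, a convex quadratic
program: there are a positive semidefinite quadratic form `q`, a linear form `c`, a constant `c₀`
and finitely many affine inequalities `a i y ≤ b i` in `y = (z, s)` such that `F` is the projection
of the polyhedron they define, and `J z` is the minimum over the slack variables of
`q y + c y + c₀`. -/
def IsConvexQP {V : Type*} [AddCommGroup V] [Module ℝ V] (F : Set V) (J : V → ℝ) : Prop :=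
  ∃ (k l : ℕ) (q : QuadraticForm ℝ (V × (Fin k → ℝ))) (c : (V × (Fin k → ℝ)) →ₗ[ℝ] ℝ) (c₀ : ℝ)
    (a : Fin l → (V × (Fin k → ℝ)) →ₗ[ℝ] ℝ) (b : Fin l → ℝ),
    (∀ y, 0 ≤ q y) ∧
    (∀ z, z ∈ F ↔ ∃ s, ∀ i, a i (z, s) ≤ b i) ∧
    ∀ z ∈ F, IsLeast {v | ∃ s, (∀ i, a i (z, s) ≤ b i) ∧ v = q (z, s) + c (z, s) + c₀} (J z)

/-! ### The receding-horizon closed loop -/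

/-- Borel measurability of a decision rule, entry by entry. -/
def MeasurableRule {d m N : ℕ} (π : (Fin d → ℝ) → Decision d m N) : Prop :=
  (∀ i, Measurable fun x => (π x).1 i) ∧ (∀ i j, Measurable fun x => (π x).2.1 i j) ∧
    (∀ i j, Measurable fun x => (π x).2.2 i j)

/-- `π n` is a Borel rule that picks, in every state, a minimizer of the optimal control problem
with stability constraints at time `n κ`. -/
def Problem.IsOptimalPolicy {d m N κ : ℕ} (S : Problem d m N κ) {Ω : Type*} [MeasurableSpace Ω]
    (P : Measure Ω) (ν : ℕ → Ω → ℝ) (w : ℕ → Ω → Fin d → ℝ) {dO dS : ℕ}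
    (D : OrthSchurDecomp S.A dO dS) (p r ε ζ : ℝ) (π : ℕ → (Fin d → ℝ) → Decision d m N) : Prop :=
  ∀ n, MeasurableRule (π n) ∧ ∀ x, π n x ∈ S.ocpFeasible D p r ε ζ x ∧
    ∀ z ∈ S.ocpFeasible D p r ε ζ x,
      S.ocpObjective P ν w (n * κ) x (π n x) ≤ S.ocpObjective P ν w (n * κ) x z

/-- The control applied at time `t`, where `y` is the state measured at the latest recalculation
time `(t / κ) κ`. -/
def Problem.loopControl {d m N κ : ℕ} (S : Problem d m N κ) {Ω : Type*} (ν : ℕ → Ω → ℝ)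
    (w : ℕ → Ω → Fin d → ℝ) (π : ℕ → (Fin d → ℝ) → Decision d m N) (t : ℕ) (y : Fin d → ℝ)
    (ω : Ω) : Fin m → ℝ :=
  block (applied κ (π (t / κ) y) (S.satStack fun k => w (t / κ * κ + k) ω)
    (fun k => ν (t / κ * κ + k) ω)) (t % κ)

/-- The closed loop started in `x₀`: the pair of the state `x_t` and of the state measured at the
latest recalculation time up to `t`. -/
def Problem.loop {d m N κ : ℕ} (S : Problem d m N κ) {Ω : Type*} (ν : ℕ → Ω → ℝ)
    (w : ℕ → Ω → Fin d → ℝ) (π : ℕ → (Fin d → ℝ) → Decision d m N) (x₀ : Fin d → ℝ) (ω : Ω) :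
    ℕ → (Fin d → ℝ) × (Fin d → ℝ)
  | 0 => (x₀, x₀)
  | t + 1 =>
    let s := S.loop ν w π x₀ ω t
    let x := S.A *ᵥ s.1 + S.B *ᵥ S.loopControl ν w π t s.2 ω + w t ω
    (x, if κ ∣ t + 1 then x else s.2)

/-- `sup_t E ‖x_t‖² < ∞`, with the Euclidean norm. -/
def MeanSquareBounded {Ω : Type*} [MeasurableSpace Ω] (P : Measure Ω) {d : ℕ}
    (x : ℕ → Ω → Fin d → ℝ) : Prop :=
  ∃ C : ℝ, ∀ t, Integrable (fun ω => x t ω ⬝ᵥ x t ω) P ∧ ∫ ω, x t ω ⬝ᵥ x t ω ∂P ≤ C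

end NetMPC

end

open NetMPC

/-! The decomposition is spectral. Over the complex numbers the space splits into the generalized
eigenspaces of modulus one and those of modulus less than one. Both sums are invariant under
conjugation, hence come from real subspaces. Equal multiplicities make `A` diagonal with unimodular
entries on the first sum, so `A` preserves the norm of the coordinates in an eigenbasis; a real
basis orthonormal for this norm gives the orthogonal block (`exists_orthSchurDecomp`). Reachability
is a duality argument: a row vector annihilated by every `Ao ^ k * Bo` lifts to a row on which `A +
B * K` acts like `Ao`. Its iterates tend to zero and keep their norm, so it vanishes
(`OrthSchurDecomp.eq_zero_of_lift`).

For (i), the explicit control constraint is the worst case of each row over dropouts and saturated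
noise (`controlAdmissible_iff`), and the pseudoinverse of the reachability matrix gives a feasible
open-loop decision. The applied control is a function of the dropouts plus a term linear in the
saturated noise (`applied_eq`). Independence factors the expectations, symmetry kills the terms
linear in the noise, and the closed form remains. Its quadratic part is a mean of values of the form
`α`, hence nonnegative, and the maxima in the regularizer are handled by slack variables.

For the existence of Borel optimal rules, the state changes the feasible set only through a finite
pattern of active drift constraints. For each pattern the set is a fixed polyhedron, compact up to
an irrelevant `Θ`, and the minimizer with the least sum of squares is a Borel function of the state
(`exists_measurable_argmin`).

For the bound, let `V` be the Euclidean norm of the orthogonal part at the times `n κ`. As `Ao` is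
an isometry, `V²` changes by twice the inner product of `Ao ^ κ x^o` with the accumulated input,
plus the squared norm of that input. A control block `ν_k (η + Θ e + Λ ν)_k` has mean `p (η + p Λ
𝟙)_k`, so the inner product has mean `p ⟨x^o, drift⟩`, at most `-p ζ V` plus a constant by (D).
Outside a large ball `V` thus decreases on average by a fixed amount, with increments that have
bounded fourth moments. During an excursion from the ball `(V + δ k)⁴`, with `k` the age of the
excursion, then has the supermartingale property (`lintegral_fourth_le_of_drift`), so age `k`
contributes at most a constant times `(δ k)⁻²` to the mean of `V²`, which is summable
(`exists_lintegral_sq_le_of_drift`). Between recalculations the orthogonal part grows by at most the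
inputs of one window. The Schur stable part is a convolution of a summable kernel with inputs
bounded in mean square. This argument applies to every measurable feasible rule. -/

namespace NetMPC

set_option linter.unusedSectionVars false

/-! ### Powers of Schur stable and of orthogonal matrices -/

section SchurPowers

attribute [local instance] Matrix.linftyOpNormedRing Matrix.linftyOpNormedAlgebra

/-- By Gelfand's formula the operator norm of the `k`-th power, and with it every entry, is
eventually at most `ρ ^ k` for some `ρ < 1` above the spectral radius. -/
theorem SchurStable.summable_pow {n : Type*} [Fintype n] [DecidableEq n] {A : Matrix n n ℝ}
    (hA : SchurStable A) (i j : n) : Summable fun k : ℕ => |(A ^ k) i j| := by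
  set M : Matrix n n ℂ := A.map (algebraMap ℝ ℂ) with hM
  have : Nonempty n := ⟨i⟩
  have : CompleteSpace (Matrix n n ℂ) := FiniteDimensional.complete ℂ _
  have hr : spectralRadius ℂ M < (1 : NNReal) := by
    refine spectrum.spectralRadius_lt_of_forall_lt M fun k hk => ?_
    have := hA k (Matrix.mem_spectrum_iff_isRoot_charpoly.mp hk)
    exact_mod_cast this
  obtain ⟨ρ, hρ1, hρ2⟩ := ENNReal.lt_iff_exists_nnreal_btwn.mp hr
  have hρ2' : ρ < 1 := by exact_mod_cast hρ2
  have hev := (spectrum.pow_nnnorm_pow_one_div_tendsto_nhds_spectralRadius M).eventually_lt_const hρ1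
  have hbound : ∀ᶠ k : ℕ in Filter.atTop, ‖|(A ^ k) i j|‖ ≤ (ρ : ℝ) ^ k := by
    filter_upwards [hev, Filter.eventually_gt_atTop 0] with k hk hk0
    have h1 : ‖M ^ k‖₊ ≤ ρ ^ k := by
      have hk' : (0 : ℝ) < k := by exact_mod_cast hk0
      have h2 := ENNReal.rpow_le_rpow hk.le hk'.le
      rw [← ENNReal.rpow_mul, one_div, inv_mul_cancel₀ hk'.ne', ENNReal.rpow_one,
        ENNReal.rpow_natCast] at h2
      exact_mod_cast h2
    have h3 : ((A ^ k) i j : ℂ) = (M ^ k) i j := by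
      rw [hM, ← Matrix.map_pow]; rfl
    have h4 : ‖(M ^ k) i j‖₊ ≤ ‖M ^ k‖₊ := by
      rw [Matrix.linfty_opNNNorm_def]
      refine le_trans ?_ (Finset.le_sup (f := fun i => ∑ j, ‖(M ^ k) i j‖₊) (Finset.mem_univ i))
      exact Finset.single_le_sum (f := fun j => ‖(M ^ k) i j‖₊) (fun _ _ => zero_le)
        (Finset.mem_univ j)
    have h5 : ‖((A ^ k) i j : ℂ)‖ ≤ (ρ : ℝ) ^ k := by
      rw [h3]; exact_mod_cast h4.trans h1
    simpa using h5
  exact Summable.of_norm_bounded_eventually_nat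
    (summable_geometric_of_lt_one ρ.2 (by exact_mod_cast hρ2')) hbound

end SchurPowers

theorem SchurStable.tendsto_vecMul_pow {n : Type*} [Fintype n] [DecidableEq n] {A : Matrix n n ℝ}
    (hA : SchurStable A) (y : n → ℝ) :
    Filter.Tendsto (fun k : ℕ => y ᵥ* A ^ k) Filter.atTop (nhds 0) := by
  rw [tendsto_pi_nhds]
  intro j
  have h : ∀ i, Filter.Tendsto (fun k : ℕ => (A ^ k) i j) Filter.atTop (nhds 0) := fun i =>
    (tendsto_zero_iff_abs_tendsto_zero _).mpr (hA.summable_pow i j).tendsto_atTop_zero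
  simp only [Matrix.vecMul, dotProduct]
  simpa using tendsto_finsetSum Finset.univ fun i _ => (h i).const_mul (y i)

theorem rank_eq_of_vecMul_injective {n : ℕ} {q : Type*} [Fintype q] (M : Matrix (Fin n) q ℝ)
    (h : ∀ y : Fin n → ℝ, y ᵥ* M = 0 → y = 0) : M.rank = n := by
  classical
  rw [← Matrix.rank_transpose]
  have : Function.Injective (Mᵀ.mulVecLin) := by
    rw [← LinearMap.ker_eq_bot, LinearMap.ker_eq_bot']
    intro y hy
    exact h y (by simpa [Matrix.mulVec_transpose] using hy)
  rw [Matrix.rank, LinearMap.finrank_range_of_inj this]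
  simp

theorem dotProduct_self_vecMul_pow_orthogonal {n : ℕ} {O : Matrix (Fin n) (Fin n) ℝ}
    (hO : O ∈ Matrix.orthogonalGroup (Fin n) ℝ) (y : Fin n → ℝ) (k : ℕ) :
    (y ᵥ* O ^ k) ⬝ᵥ (y ᵥ* O ^ k) = y ⬝ᵥ y := by
  have h : O ^ k ∈ Matrix.orthogonalGroup (Fin n) ℝ := pow_mem hO k
  have h2 : O ^ k * (O ^ k)ᵀ = 1 := (Matrix.mem_orthogonalGroup_iff (Fin n) ℝ).mp h
  rw [← Matrix.mulVec_transpose (O ^ k) y, Matrix.dotProduct_mulVec, Matrix.mulVec_transpose,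
    Matrix.vecMul_vecMul, h2, Matrix.vecMul_one]

/-! ### Stabilizability makes the orthogonal block reachable -/

section Reach

variable {d m dO dS : ℕ} {A : Matrix (Fin d) (Fin d) ℝ}

/-- The row `(y, 0) T`. -/
def OrthSchurDecomp.lift (D : OrthSchurDecomp A dO dS) (y : Fin dO → ℝ) : Fin d → ℝ :=
  Sum.elim y 0 ᵥ* D.T

theorem OrthSchurDecomp.mul_eq (D : OrthSchurDecomp A dO dS) :
    D.T * A = Matrix.fromBlocks D.Ao 0 0 D.As * D.T := by
  rw [← D.conj, Matrix.mul_assoc _ _ D.T, D.inv_mul, Matrix.mul_one]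

theorem OrthSchurDecomp.lift_vecMul (D : OrthSchurDecomp A dO dS) (y : Fin dO → ℝ) :
    D.lift y ᵥ* A = D.lift (y ᵥ* D.Ao) := by
  rw [OrthSchurDecomp.lift, Matrix.vecMul_vecMul, D.mul_eq, ← Matrix.vecMul_vecMul,
    OrthSchurDecomp.lift, Matrix.vecMul_fromBlocks]
  congr 1
  ext i; rcases i with i | i <;> simp

theorem OrthSchurDecomp.lift_vecMul_input (D : OrthSchurDecomp A dO dS)
    (B : Matrix (Fin d) (Fin m) ℝ) (y : Fin dO → ℝ) :
    D.lift y ᵥ* B = y ᵥ* D.Bo B := by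
  rw [OrthSchurDecomp.lift, Matrix.vecMul_vecMul]
  ext j
  simp [Matrix.vecMul, dotProduct, OrthSchurDecomp.Bo, Matrix.toRows₁]

/-- Feedback is invisible along the lifted row, so `(A + B * K) ^ k` acts on it as `Ao ^ k`. The
first tends to zero, while the second preserves `y ⬝ᵥ y`. -/
theorem OrthSchurDecomp.eq_zero_of_lift (D : OrthSchurDecomp A dO dS)
    (B : Matrix (Fin d) (Fin m) ℝ) (hAB : Stabilizable A B) (y : Fin dO → ℝ)
    (hy : ∀ k : ℕ, y ᵥ* (D.Ao ^ k * D.Bo B) = 0) : y = 0 := by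
  obtain ⟨K, hK⟩ := hAB
  have h1 : ∀ k : ℕ, D.lift y ᵥ* (A + B * K) ^ k = D.lift (y ᵥ* D.Ao ^ k) := by
    intro k
    induction k with
    | zero => simp
    | succ k ih =>
      rw [pow_succ, ← Matrix.vecMul_vecMul, ih, Matrix.vecMul_add, ← Matrix.vecMul_vecMul,
        D.lift_vecMul, D.lift_vecMul_input, Matrix.vecMul_vecMul _ _ (D.Bo B), hy k,
        Matrix.zero_vecMul, add_zero, Matrix.vecMul_vecMul, pow_succ]
  have h2 := hK.tendsto_vecMul_pow (D.lift y)
  simp only [h1] at h2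
  have h3 : ∀ u : Fin dO → ℝ, u = fun i => (D.lift u ᵥ* D.Tinv) (Sum.inl i) := by
    intro u
    rw [OrthSchurDecomp.lift, Matrix.vecMul_vecMul, D.mul_inv, Matrix.vecMul_one]
    rfl
  have h4 : Filter.Tendsto (fun k : ℕ => y ᵥ* D.Ao ^ k) Filter.atTop (nhds 0) := by
    have hc : Continuous fun v : Fin d → ℝ => fun i : Fin dO => (v ᵥ* D.Tinv) (Sum.inl i) := by
      fun_prop
    have h := (hc.tendsto 0).comp h2
    have h0 : (fun i : Fin dO => ((0 : Fin d → ℝ) ᵥ* D.Tinv) (Sum.inl i)) = 0 := by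
      ext i; simp
    rw [h0] at h
    exact h.congr fun k => (h3 _).symm
  have h5 : Filter.Tendsto (fun k : ℕ => (y ᵥ* D.Ao ^ k) ⬝ᵥ (y ᵥ* D.Ao ^ k)) Filter.atTop
      (nhds 0) := by
    have hc : Continuous fun v : Fin dO → ℝ => v ⬝ᵥ v := by fun_prop
    simpa [Function.comp_def] using (hc.tendsto 0).comp h4
  simp only [dotProduct_self_vecMul_pow_orthogonal D.orthogonal] at h5
  exact dotProduct_self_eq_zero.mp (tendsto_nhds_unique tendsto_const_nhds h5)

/-- The common left kernels of `Ao ^ i * Bo`, `i < k`, decrease with `k` and become stationary. The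
stationary kernel is annihilated by all powers and is therefore zero. -/
theorem OrthSchurDecomp.exists_reach (D : OrthSchurDecomp A dO dS)
    (B : Matrix (Fin d) (Fin m) ℝ) (hAB : Stabilizable A B) :
    ∃ k : ℕ, 0 < k ∧ (reachMatrix D.Ao (D.Bo B) k).rank = dO := by
  let U : ℕ → Submodule ℝ (Fin dO → ℝ) := fun k =>
    ⨅ i : Fin k, LinearMap.ker (Matrix.vecMulLinear (D.Ao ^ (i : ℕ) * D.Bo B))
  have hmem : ∀ k y, y ∈ U k ↔ ∀ i < k, y ᵥ* (D.Ao ^ i * D.Bo B) = 0 := by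
    intro k y
    simp only [U, Submodule.mem_iInf, LinearMap.mem_ker, Matrix.vecMulLinear_apply]
    exact ⟨fun h i hi => h ⟨i, hi⟩, fun h i => h i i.2⟩
  let W : ℕ →o (Submodule ℝ (Fin dO → ℝ))ᵒᵈ :=
    { toFun := fun k => OrderDual.toDual (U k)
      monotone' := fun k l hkl => by
        change U l ≤ U k
        intro y hy
        rw [hmem] at hy ⊢
        exact fun i hi => hy i (hi.trans_le hkl) }
  obtain ⟨k, hk⟩ := IsArtinian.monotone_stabilizes W
  -- Stationarity holds from `k` on; `k + 1` also makes the number of steps positive.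
  refine ⟨k + 1, k.succ_pos, rank_eq_of_vecMul_injective _ fun y hy => ?_⟩
  have hyk : y ∈ U (k + 1) := by
    rw [hmem]
    intro i hi
    ext a
    -- The exponents decrease along the blocks, so block `k - i` of the matrix with `k + 1` blocks
    -- carries the power `i`.
    have := congrFun hy (⟨k - i, by omega⟩, a)
    have he : k - (k - i) = i := by omega
    simpa [reachMatrix, Matrix.vecMul, dotProduct, he] using this
  refine D.eq_zero_of_lift B hAB y fun i => ?_
  have hst : U (k + 1) = U (k + 1 + i) := by
    have h1 : U k = U (k + 1) := congrArg OrderDual.ofDual (hk (k + 1) (by omega))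
    have h2 : U k = U (k + 1 + i) := congrArg OrderDual.ofDual (hk (k + 1 + i) (by omega))
    exact h1.symm.trans h2
  rw [hst, hmem] at hyk
  exact hyk i (by omega)

end Reach

/-! ### Spectral splitting into an orthogonal and a Schur stable block -/

section Decomposition

open Module

/-- The sum of the generalized eigenspaces of the eigenvalues with a given property. -/
def spectralSum {V : Type*} [AddCommGroup V] [Module ℂ V] (f : End ℂ V) (p : ℂ → Prop) :
    Submodule ℂ V :=
  ⨆ μ : {μ : ℂ // p μ}, f.maxGenEigenspace μ

variable {V : Type*} [AddCommGroup V] [Module ℂ V] (f : End ℂ V)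

theorem maxGenEigenspace_le_spectralSum {p : ℂ → Prop} {μ : ℂ} (h : p μ) :
    f.maxGenEigenspace μ ≤ spectralSum f p :=
  le_iSup (fun μ : {μ : ℂ // p μ} => f.maxGenEigenspace μ) ⟨μ, h⟩

theorem map_mem_spectralSum {p : ℂ → Prop} {x : V} (hx : x ∈ spectralSum f p) :
    f x ∈ spectralSum f p := by
  refine Submodule.iSup_induction _ (motive := fun x => f x ∈ spectralSum f p) hx ?_ ?_ ?_
  · intro μ x hx
    exact maxGenEigenspace_le_spectralSum f μ.2
      (Module.End.mapsTo_maxGenEigenspace_of_comm (Commute.refl f) μ hx)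
  · simp
  · intro x y hx hy
    rw [map_add]; exact add_mem hx hy

/-- A conjugate-linear map that commutes with `f` carries the generalized eigenspace of `μ` into
that of the conjugate of `μ`. This brings the spectral sums down to real subspaces. -/
theorem conj_mem_spectralSum (σ : V →+ V) (hσ : ∀ (c : ℂ) x, σ (c • x) = (starRingEnd ℂ c) • σ x)
    (hf : ∀ x, f (σ x) = σ (f x)) {p : ℂ → Prop} (hp : ∀ μ, p μ → p (starRingEnd ℂ μ)) {x : V}
    (hx : x ∈ spectralSum f p) : σ x ∈ spectralSum f p := by
  refine Submodule.iSup_induction _ (motive := fun x => σ x ∈ spectralSum f p) hx ?_ ?_ ?_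
  · intro μ x hx
    refine maxGenEigenspace_le_spectralSum f (hp μ μ.2) ?_
    rw [End.mem_maxGenEigenspace] at hx ⊢
    obtain ⟨k, hk⟩ := hx
    refine ⟨k, ?_⟩
    have : ∀ (k : ℕ) x, ((f - starRingEnd ℂ (μ : ℂ) • (1 : End ℂ V)) ^ k) (σ x)
        = σ (((f - (μ : ℂ) • (1 : End ℂ V)) ^ k) x) := by
      intro k
      induction k with
      | zero => simp
      | succ k ih => intro x; simp [pow_succ, hf, ← hσ, ← map_sub, ih]
    rw [this, hk, map_zero]
  · simp
  · intro x y hx hy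
    rw [map_add]; exact add_mem hx hy

variable [FiniteDimensional ℂ V]

theorem isInternal_maxGenEigenspace : DirectSum.IsInternal f.maxGenEigenspace :=
  DirectSum.isInternal_submodule_of_iSupIndep_of_iSup_eq_top f.independent_maxGenEigenspace
    f.iSup_maxGenEigenspace_eq_top

/-- A basis of generalized eigenvectors. -/
noncomputable def genEigenbasis : Basis ((μ : ℂ) × Fin (finrank ℂ (f.maxGenEigenspace μ))) ℂ V :=
  (isInternal_maxGenEigenspace f).collectedBasis fun μ => finBasis ℂ (f.maxGenEigenspace μ)

theorem genEigenbasis_repr_eq_zero {p : ℂ → Prop} {x : V} (hx : x ∈ spectralSum f p)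
    {a : (μ : ℂ) × Fin (finrank ℂ (f.maxGenEigenspace μ))} (ha : ¬ p a.1) :
    (genEigenbasis f).repr x a = 0 := by
  refine Submodule.iSup_induction _ (motive := fun x => (genEigenbasis f).repr x a = 0) hx ?_ ?_ ?_
  · intro μ x hx
    obtain ⟨ν, a⟩ := a
    exact (isInternal_maxGenEigenspace f).collectedBasis_repr_of_mem_ne _
      (fun h => ha (by subst h; exact μ.2)) hx
  · simp
  · intro x y hx hy
    simp [hx, hy]

/-- Where generalized eigenvectors are eigenvectors, `f` is diagonal in the basis; for unimodular
eigenvalues it then preserves the moduli of the coordinates. -/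
theorem genEigenbasis_repr_map {p : ℂ → Prop}
    (hp : ∀ μ, p μ → f.maxGenEigenspace μ = f.eigenspace μ) {x : V} (hx : x ∈ spectralSum f p)
    (a : (μ : ℂ) × Fin (finrank ℂ (f.maxGenEigenspace μ))) :
    (genEigenbasis f).repr (f x) a = a.1 * (genEigenbasis f).repr x a := by
  refine Submodule.iSup_induction _ (motive := fun x => (genEigenbasis f).repr (f x) a
    = a.1 * (genEigenbasis f).repr x a) hx ?_ ?_ ?_
  · intro μ x hx
    have hx' : f x = (μ : ℂ) • x := by
      have := hx
      rw [hp μ μ.2, End.mem_eigenspace_iff] at this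
      exact this
    by_cases h : (μ : ℂ) = a.1
    · simp [hx', h]
    · have : (genEigenbasis f).repr x a = 0 := by
        obtain ⟨ν, a⟩ := a
        exact (isInternal_maxGenEigenspace f).collectedBasis_repr_of_mem_ne _ h hx
      simp [hx', this]
  · simp
  · intro x y hx hy
    simp [hx, hy, mul_add]

/-- In a basis of generalized eigenvectors, a vector in both sums has only zero coordinates. The
sums span because only eigenvalues have nonzero generalized eigenspaces. -/
theorem isCompl_spectralSum {p q : ℂ → Prop} (hpq : ∀ μ, p μ → ¬ q μ)
    (hf : ∀ μ, f.HasEigenvalue μ → p μ ∨ q μ) : IsCompl (spectralSum f p) (spectralSum f q) := by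
  constructor
  · rw [Submodule.disjoint_def]
    intro x hx hy
    refine (genEigenbasis f).ext_elem fun a => ?_
    rw [map_zero, Finsupp.zero_apply]
    by_cases h : p a.1
    · exact genEigenbasis_repr_eq_zero f hy (hpq _ h)
    · exact genEigenbasis_repr_eq_zero f hx h
  · rw [codisjoint_iff, ← top_le_iff, ← f.iSup_maxGenEigenspace_eq_top]
    refine iSup_le fun μ => ?_
    by_cases h : f.HasEigenvalue μ
    · rcases hf μ h with h | h
      · exact (maxGenEigenspace_le_spectralSum f h).trans le_sup_left
      · exact (maxGenEigenspace_le_spectralSum f h).trans le_sup_right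
    · have : f.maxGenEigenspace μ = ⊥ := by
        by_contra hne
        have h1 : f.HasUnifEigenvalue μ ⊤ := hne
        exact h (h1.lt zero_lt_one)
      rw [this]; exact bot_le

theorem transpose_mul_self_eq_one_of_dotProduct {n : ℕ} (O : Matrix (Fin n) (Fin n) ℝ)
    (h : ∀ x, (O *ᵥ x) ⬝ᵥ (O *ᵥ x) = x ⬝ᵥ x) : Oᵀ * O = 1 := by
  have h2 : ∀ x y, (O *ᵥ x) ⬝ᵥ (O *ᵥ y) = x ⬝ᵥ y := by
    intro x y
    have h1 := h (x + y)
    simp only [Matrix.mulVec_add, add_dotProduct, dotProduct_add, h] at h1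
    rw [dotProduct_comm (O *ᵥ y), dotProduct_comm y x] at h1
    linarith
  ext i j
  have h3 := h2 (Pi.single i 1) (Pi.single j 1)
  simp only [Matrix.mulVec_single_one] at h3
  rw [Matrix.mul_apply', Matrix.one_apply]
  refine h3.trans ?_
  simp [Pi.single_apply, eq_comm]

/-- A subspace with an injective linear map into a Euclidean space has a basis that turns the
pulled back norm into the Euclidean one. -/
theorem exists_basis_dotProduct {U : Type*} [AddCommGroup U] [Module ℝ U] {ι : Type*} [Fintype ι]
    (φ : U →ₗ[ℝ] EuclideanSpace ℝ ι) (hφ : Function.Injective φ) :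
    ∃ (n : ℕ) (b : Module.Basis (Fin n) ℝ U), ∀ x, b.equivFun x ⬝ᵥ b.equivFun x = ‖φ x‖ ^ 2 := by
  let e := LinearEquiv.ofInjective φ hφ
  let o := stdOrthonormalBasis ℝ (LinearMap.range φ)
  refine ⟨_, o.toBasis.map e.symm, fun x => ?_⟩
  have h1 : ‖φ x‖ = ‖o.repr (e x)‖ := by
    rw [LinearIsometryEquiv.norm_map]; rfl
  rw [h1, EuclideanSpace.real_norm_sq_eq]
  simp [dotProduct, sq]

/-- The complexification of a real vector. -/
def toComplex {n : Type*} : (n → ℝ) →ₗ[ℝ] (n → ℂ) where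
  toFun x i := x i
  map_add' x y := by ext; simp
  map_smul' c x := by ext; simp

theorem map_ofReal_mulVec_toComplex {n k : Type*} [Fintype n] (A : Matrix k n ℝ) (x : n → ℝ) :
    A.map (algebraMap ℝ ℂ) *ᵥ toComplex x = toComplex (A *ᵥ x) := by
  ext i
  simp [toComplex, Matrix.mulVec, dotProduct]

theorem exists_orthSchurDecomp {d : ℕ} (A : Matrix (Fin d) (Fin d) ℝ) (hA : LyapunovStable A) :
    ∃ dO dS : ℕ, Nonempty (OrthSchurDecomp A dO dS) := by
  set M : Matrix (Fin d) (Fin d) ℂ := A.map (algebraMap ℝ ℂ) with hM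
  set f : End ℂ (Fin d → ℂ) := Matrix.toLin' M with hf
  have hroot : ∀ μ, f.HasEigenvalue μ → (complexCharpoly A).IsRoot μ := by
    intro μ h
    rw [End.hasEigenvalue_iff_isRoot_charpoly, hf, Matrix.charpoly_toLin'] at h
    exact h
  set p : ℂ → Prop := fun μ => ‖μ‖ = 1 with hp
  set q : ℂ → Prop := fun μ => ‖μ‖ < 1 with hq
  have hc : IsCompl (spectralSum f p) (spectralSum f q) :=
    isCompl_spectralSum f (fun μ h h' => by simp only [hp, hq] at h h'; linarith) fun μ h =>
      (hA μ (hroot μ h)).1.eq_or_lt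
  -- The generalized eigenspace has the algebraic multiplicity as its dimension, so equal
  -- multiplicities leave no room for Jordan blocks on the unit circle.
  have heig : ∀ μ, p μ → f.maxGenEigenspace μ = f.eigenspace μ := by
    intro μ hμ
    symm
    refine Submodule.eq_of_le_of_finrank_eq End.eigenspace_le_maxGenEigenspace ?_
    by_cases h : f.HasEigenvalue μ
    · rw [LinearMap.finrank_maxGenEigenspace_eq, hf, Matrix.charpoly_toLin']
      exact ((hA μ (hroot μ h)).2 hμ).symm
    · have h1 : f.eigenspace μ = ⊥ := by
        by_contra hne
        exact h hne
      have h2 : f.maxGenEigenspace μ = ⊥ := by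
        by_contra hne
        have h1 : f.HasUnifEigenvalue μ ⊤ := hne
        exact h (h1.lt zero_lt_one)
      rw [h1, h2]
  -- the real subspaces
  let W : (ℂ → Prop) → Submodule ℝ (Fin d → ℝ) := fun p =>
    ((spectralSum f p).restrictScalars ℝ).comap toComplex
  have hW : ∀ p x, x ∈ W p ↔ toComplex x ∈ spectralSum f p := fun p x => Iff.rfl
  have hmap : ∀ p x, x ∈ W p → A *ᵥ x ∈ W p := by
    intro p x hx
    rw [hW] at hx ⊢
    rw [← map_ofReal_mulVec_toComplex]
    exact map_mem_spectralSum f hx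
  have htop : IsCompl (W p) (W q) := by
    constructor
    · rw [Submodule.disjoint_def]
      intro x hx hy
      have := (Submodule.disjoint_def.mp hc.disjoint) _ hx hy
      ext i
      simpa [toComplex] using congrFun this i
    · rw [codisjoint_iff, eq_top_iff]
      intro x _
      -- Complex conjugation fixes a real vector and preserves both spectral sums. By uniqueness of
      -- the splitting it fixes both components, which are therefore real.
      let σ : (Fin d → ℂ) →+ (Fin d → ℂ) :=
        { toFun := fun y i => starRingEnd ℂ (y i)
          map_zero' := by ext; simp
          map_add' := fun y z => by ext; simp }
      have hσ : ∀ (c : ℂ) x, σ (c • x) = (starRingEnd ℂ c) • σ x := by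
        intro c x; ext i; simp [σ]
      have hfσ : ∀ x, f (σ x) = σ (f x) := by
        intro x; ext i
        simp [σ, hf, hM, Matrix.mulVec, dotProduct]
      obtain ⟨e, he, g, hg, heg⟩ := Submodule.mem_sup.mp
        (show toComplex x ∈ spectralSum f p ⊔ spectralSum f q by
          rw [hc.sup_eq_top]; trivial)
      have hse := conj_mem_spectralSum f σ hσ hfσ (p := p) (fun μ h => by simpa [hp] using h) he
      have hsg := conj_mem_spectralSum f σ hσ hfσ (p := q) (fun μ h => by simpa [hq] using h) hg
      have hsum : σ e + σ g = e + g := by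
        rw [← map_add, heg]
        ext i; simp [σ, toComplex]
      have hee : σ e - e = 0 := by
        refine (Submodule.disjoint_def.mp hc.disjoint) _ (sub_mem hse he) ?_
        have : σ e - e = g - σ g := by
          rw [sub_eq_sub_iff_add_eq_add, hsum, add_comm]
        rw [this]; exact sub_mem hg hsg
      have hgg : σ g = g := by
        rw [sub_eq_zero.mp hee] at hsum
        exact add_left_cancel hsum
      have hre : ∀ y, σ y = y → toComplex (fun i => (y i).re) = y := by
        intro y hy
        ext i
        exact Complex.conj_eq_iff_re.mp (congrFun hy i)
      refine Submodule.mem_sup.mpr ⟨fun i => (e i).re, ?_, fun i => (g i).re, ?_, ?_⟩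
      · rw [hW, hre e (sub_eq_zero.mp hee)]; exact he
      · rw [hW, hre g hgg]; exact hg
      · ext i
        have := congrArg Complex.re (congrFun heg i)
        simpa [toComplex] using this
  -- the invariant Euclidean structure
  have : Finite ((μ : ℂ) × Fin (finrank ℂ (f.maxGenEigenspace μ))) :=
    Module.Finite.finite_basis (genEigenbasis f)
  have := Fintype.ofFinite ((μ : ℂ) × Fin (finrank ℂ (f.maxGenEigenspace μ)))
  let I := (μ : ℂ) × Fin (finrank ℂ (f.maxGenEigenspace μ))
  -- Real and imaginary parts of the eigenbasis coordinates. On `W p` the matrix `A` multiplies each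
  -- nonzero coordinate by a number of modulus one, so it is an isometry for the norm pulled back
  -- along `φ`.
  let φ : W p →ₗ[ℝ] EuclideanSpace ℝ (I ⊕ I) :=
    { toFun := fun x => WithLp.toLp 2 (Sum.elim
        (fun a => ((genEigenbasis f).repr (toComplex x.1) a).re)
        (fun a => ((genEigenbasis f).repr (toComplex x.1) a).im))
      map_add' := fun x y => by ext i; rcases i with i | i <;> simp
      map_smul' := fun c x => by
        have : toComplex (c • x.1) = (c : ℂ) • toComplex x.1 := by
          ext; simp [toComplex]
        ext i; rcases i with i | i <;>
          simp [this, -Complex.coe_smul] }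
  have hφnorm : ∀ x, ‖φ x‖ ^ 2 = ∑ a, ‖(genEigenbasis f).repr (toComplex x.1) a‖ ^ 2 := by
    intro x
    rw [EuclideanSpace.real_norm_sq_eq]
    simp only [φ, Complex.sq_norm, Complex.normSq_apply]
    simp [← Finset.sum_add_distrib, sq]
    rfl
  have hφ : Function.Injective φ := by
    rw [← LinearMap.ker_eq_bot, LinearMap.ker_eq_bot']
    intro x hx
    have h1 := hφnorm x
    rw [hx, norm_zero, zero_pow two_ne_zero, eq_comm,
      Finset.sum_eq_zero_iff_of_nonneg (fun _ _ => by positivity)] at h1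
    have h2 : toComplex x.1 = 0 := (genEigenbasis f).ext_elem fun a => by
      simpa using h1 a (Finset.mem_univ a)
    ext i
    simpa [toComplex] using congrFun h2 i
  obtain ⟨dO, bO, hbO⟩ := exists_basis_dotProduct φ hφ
  let bS := finBasis ℝ (W q)
  let b : Basis (Fin dO ⊕ Fin (finrank ℝ (W q))) ℝ (Fin d → ℝ) :=
    (bO.prod bS).map (Submodule.prodEquivOfIsCompl _ _ htop)
  have hbl : ∀ i, b (Sum.inl i) = (bO i : Fin d → ℝ) := fun i => by simp [b]
  have hbr : ∀ i, b (Sum.inr i) = (bS i : Fin d → ℝ) := fun i => by simp [b]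
  have hU : ∀ x : W p, b.equivFun x.1 = Sum.elim (bO.equivFun x) 0 := by
    intro x
    ext i; rcases i with i | i <;> simp [b]
  have hN : ∀ x : W q, b.equivFun x.1 = Sum.elim (0 : Fin dO → ℝ) (bS.equivFun x) := by
    intro x
    ext i; rcases i with i | i <;> simp [b]
  have hUsymm : ∀ y, b.equivFun.symm (Sum.elim y 0) = (bO.equivFun.symm y : Fin d → ℝ) := by
    intro y
    rw [LinearEquiv.symm_apply_eq, hU, LinearEquiv.apply_symm_apply]
  have hNsymm : ∀ y, b.equivFun.symm (Sum.elim (0 : Fin dO → ℝ) y)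
      = (bS.equivFun.symm y : Fin d → ℝ) := by
    intro y
    rw [LinearEquiv.symm_apply_eq, hN, LinearEquiv.apply_symm_apply]
  have hφA : ∀ x : W p, ‖φ ⟨A *ᵥ x.1, hmap p _ x.2⟩‖ ^ 2 = ‖φ x‖ ^ 2 := by
    intro x
    rw [hφnorm, hφnorm]
    refine Finset.sum_congr rfl fun a _ => ?_
    have h1 : toComplex (A *ᵥ x.1) = f (toComplex x.1) := (map_ofReal_mulVec_toComplex A x.1).symm
    simp only [h1]
    rw [genEigenbasis_repr_map f heig x.2, norm_mul]
    by_cases ha : p a.1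
    · rw [show ‖a.1‖ = 1 from ha, one_mul]
    · rw [genEigenbasis_repr_eq_zero f x.2 ha]; simp
  let T := LinearMap.toMatrix' b.equivFun.toLinearMap
  let Tinv := LinearMap.toMatrix' b.equivFun.symm.toLinearMap
  have hTmul : ∀ x, T *ᵥ x = b.equivFun x := fun x => LinearMap.toMatrix'_mulVec _ x
  have hTimul : ∀ c, Tinv *ᵥ c = b.equivFun.symm c := fun c => LinearMap.toMatrix'_mulVec _ c
  have hTT : T * Tinv = 1 := by
    refine Matrix.ext_of_mulVec_single fun i => ?_
    rw [← Matrix.mulVec_mulVec, hTmul, hTimul, LinearEquiv.apply_symm_apply, Matrix.one_mulVec]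
  have hTT' : Tinv * T = 1 := by
    refine Matrix.ext_of_mulVec_single fun i => ?_
    rw [← Matrix.mulVec_mulVec, hTmul, hTimul, LinearEquiv.symm_apply_apply, Matrix.one_mulVec]
  set C := T * A * Tinv with hC
  have hCmul : ∀ c, C *ᵥ c = b.equivFun (A *ᵥ b.equivFun.symm c) := by
    intro c
    rw [hC, ← Matrix.mulVec_mulVec, ← Matrix.mulVec_mulVec, hTmul, hTimul]
  have hCU : ∀ y, C *ᵥ Sum.elim y 0
      = Sum.elim (bO.equivFun ⟨A *ᵥ (bO.equivFun.symm y).1, hmap p _ (bO.equivFun.symm y).2⟩) 0 := by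
    intro y
    rw [hCmul, hUsymm, ← hU]
  have hCN : ∀ y, C *ᵥ Sum.elim (0 : Fin dO → ℝ) y = Sum.elim (0 : Fin dO → ℝ)
      (bS.equivFun ⟨A *ᵥ (bS.equivFun.symm y).1, hmap q _ (bS.equivFun.symm y).2⟩) := by
    intro y
    rw [hCmul, hNsymm, ← hN]
  have h12 : C.toBlocks₁₂ = 0 := by
    refine Matrix.ext_of_mulVec_single fun i => ?_
    ext j
    have h := congrFun (hCN (Pi.single i 1)) (Sum.inl j)
    rw [← Matrix.fromBlocks_toBlocks C, Matrix.fromBlocks_mulVec] at h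
    simp only [Sum.elim_comp_inl, Sum.elim_comp_inr, Matrix.mulVec_zero, zero_add,
      Sum.elim_inl, Matrix.mulVec_single_one, Pi.zero_apply] at h
    simpa using h
  have h21 : C.toBlocks₂₁ = 0 := by
    refine Matrix.ext_of_mulVec_single fun i => ?_
    ext j
    have h := congrFun (hCU (Pi.single i 1)) (Sum.inr j)
    rw [← Matrix.fromBlocks_toBlocks C, Matrix.fromBlocks_mulVec] at h
    simp only [Sum.elim_comp_inl, Sum.elim_comp_inr, Matrix.mulVec_zero, add_zero,
      Sum.elim_inr, Matrix.mulVec_single_one, Pi.zero_apply] at h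
    simpa using h
  have hblk : C = Matrix.fromBlocks C.toBlocks₁₁ 0 0 C.toBlocks₂₂ := by
    conv_lhs => rw [← Matrix.fromBlocks_toBlocks C, h12, h21]
  refine ⟨dO, _, ⟨⟨T, Tinv, C.toBlocks₁₁, C.toBlocks₂₂, hTT, hTT', hblk, ?_, ?_⟩⟩⟩
  · rw [Matrix.mem_orthogonalGroup_iff']
    refine transpose_mul_self_eq_one_of_dotProduct _ fun y => ?_
    have h : C.toBlocks₁₁ *ᵥ y
        = bO.equivFun ⟨A *ᵥ (bO.equivFun.symm y).1, hmap p _ (bO.equivFun.symm y).2⟩ := by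
      ext j
      have h := congrFun (hCU y) (Sum.inl j)
      rw [← Matrix.fromBlocks_toBlocks C, Matrix.fromBlocks_mulVec] at h
      simpa using h
    rw [h, hbO, hφA, ← hbO, LinearEquiv.apply_symm_apply]
  -- An eigenvector of the second block lifts to an eigenvector `y` of `A` in the complex span of `W
  -- q`. If its eigenvalue had modulus one, `y` would lie in both spectral sums and vanish; a larger
  -- modulus is excluded by Lyapunov stability.
  · intro z hz
    have hz' : Module.End.HasEigenvalue (Matrix.toLin' (C.toBlocks₂₂.map (algebraMap ℝ ℂ))) z := by
      rw [End.hasEigenvalue_iff_isRoot_charpoly, Matrix.charpoly_toLin']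
      exact hz
    obtain ⟨v, hv⟩ := hz'.exists_hasEigenvector
    have hv1 : C.toBlocks₂₂.map (algebraMap ℝ ℂ) *ᵥ v = z • v := by
      simpa using hv.apply_eq_smul
    set TC := T.map (algebraMap ℝ ℂ) with hTC
    set TiC := Tinv.map (algebraMap ℝ ℂ) with hTiC
    set y := TiC *ᵥ Sum.elim (0 : Fin dO → ℂ) v with hy
    have hTy : TC *ᵥ y = Sum.elim (0 : Fin dO → ℂ) v := by
      rw [hy, Matrix.mulVec_mulVec, hTC, hTiC, ← Matrix.map_mul, hTT,
        Matrix.map_one _ (map_zero _) (map_one _), Matrix.one_mulVec]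
    have hy0 : y ≠ 0 := by
      intro h
      rw [h, Matrix.mulVec_zero] at hTy
      refine hv.2 ?_
      ext j
      simpa using (congrFun hTy (Sum.inr j)).symm
    have hMy : f y = z • y := by
      have hAT : A * Tinv = Tinv * C := by
        rw [hC, ← Matrix.mul_assoc, ← Matrix.mul_assoc, hTT', Matrix.one_mul]
      have : M * TiC = TiC * C.map (algebraMap ℝ ℂ) := by
        rw [hM, hTiC, ← Matrix.map_mul, hAT, Matrix.map_mul]
      rw [hf, Matrix.toLin'_apply, hy, Matrix.mulVec_mulVec, this, ← Matrix.mulVec_mulVec,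
        ← Matrix.mulVec_smul, hblk, Matrix.fromBlocks_map, Matrix.fromBlocks_mulVec]
      congr 1
      ext i; rcases i with i | i
      · simp
      · simpa using congrFun hv1 i
    have hez : y ∈ f.eigenspace z := End.mem_eigenspace_iff.mpr hMy
    have hzev : f.HasEigenvalue z := End.hasEigenvalue_of_hasEigenvector ⟨hez, hy0⟩
    refine lt_of_le_of_ne (hA z (hroot z hzev)).1 fun hz1 => hy0 ?_
    refine (Submodule.disjoint_def.mp hc.disjoint) y
      (maxGenEigenspace_le_spectralSum f (p := p) hz1 (End.eigenspace_le_maxGenEigenspace hez)) ?_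
    have hysum : y = ∑ j, v j • toComplex (bS j : Fin d → ℝ) := by
      ext i
      have hcol : ∀ j, Tinv i (Sum.inr j) = (bS j : Fin d → ℝ) i := by
        intro j
        have h := congrFun (hNsymm (Pi.single j 1)) i
        rw [← hTimul, Basis.equivFun_symm_apply] at h
        simpa [Matrix.mulVec, dotProduct, Pi.single_apply] using h
      simp [hy, Matrix.mulVec, dotProduct, hTiC, hcol, toComplex, mul_comm]
    rw [hysum]
    exact sum_mem fun j _ => Submodule.smul_mem _ _ (bS j).2

end Decomposition

/-! ### The largest singular value and the pseudoinverse -/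

section SingularValue

/-- The largest singular value bounds the operator norm. -/
theorem norm_le_singularValues_zero_mul {E F : Type*} [NormedAddCommGroup E] [InnerProductSpace ℝ E]
    [FiniteDimensional ℝ E] [NormedAddCommGroup F] [InnerProductSpace ℝ F] [FiniteDimensional ℝ F]
    (T : E →ₗ[ℝ] F) (x : E) : ‖T x‖ ≤ T.singularValues 0 * ‖x‖ := by
  have hs := T.isSymmetric_adjoint_comp_self
  set b := hs.eigenvectorBasis rfl with hb
  have h1 : ‖T x‖ ^ 2 = ∑ i : Fin (Module.finrank ℝ E), T.singularValues i ^ 2 * (b.repr x i) ^ 2 := by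
    have h2 : ‖T x‖ ^ 2 = inner ℝ x ((LinearMap.adjoint T ∘ₗ T) x) := by
      rw [LinearMap.comp_apply, LinearMap.adjoint_inner_right, real_inner_self_eq_norm_sq]
    rw [h2, ← b.repr.inner_map_map, PiLp.inner_apply]
    refine Finset.sum_congr rfl fun i _ => ?_
    rw [hb, hs.eigenvectorBasis_apply_self_apply rfl, T.sq_singularValues_fin rfl]
    simp [sq]; ring
  have h3 : ‖x‖ ^ 2 = ∑ i, (b.repr x i) ^ 2 := by
    rw [← b.repr.norm_map, EuclideanSpace.real_norm_sq_eq]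
  refine le_of_sq_le_sq ?_ (mul_nonneg (T.singularValues_nonneg 0) (norm_nonneg x))
  rw [mul_pow, h1, h3, Finset.mul_sum]
  refine Finset.sum_le_sum fun i _ => mul_le_mul_of_nonneg_right ?_ (sq_nonneg _)
  exact pow_le_pow_left₀ (T.singularValues_nonneg _) (T.singularValues_antitone (Nat.zero_le _)) 2

theorem abs_mulVec_le_sigmaMax {n q : Type*} [Fintype n] [DecidableEq n] [Fintype q]
    (M : Matrix q n ℝ) (y : n → ℝ) (i : q) : |(M *ᵥ y) i| ≤ sigmaMax M * √(y ⬝ᵥ y) := by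
  have h := norm_le_singularValues_zero_mul (Matrix.toEuclideanLin M) (WithLp.toLp 2 y)
  have h1 : ‖WithLp.toLp 2 y‖ = √(y ⬝ᵥ y) := by
    rw [EuclideanSpace.norm_eq]
    simp [dotProduct, sq]
  rw [h1] at h
  refine le_trans ?_ h
  exact PiLp.norm_apply_le (Matrix.toEuclideanLin M (WithLp.toLp 2 y)) i

end SingularValue

theorem mul_rowPinv {n : ℕ} {q : Type*} [Fintype q] (M : Matrix (Fin n) q ℝ) (h : M.rank = n) :
    M * rowPinv M = 1 := by
  have h1 : (M * Mᵀ).rank = n := by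
    rw [Matrix.rank_self_mul_transpose, h]
  have h2 : IsUnit (M * Mᵀ) := by
    rw [← Matrix.mulVec_surjective_iff_isUnit]
    have h3 : LinearMap.range (M * Mᵀ).mulVecLin = ⊤ :=
      Submodule.eq_top_of_finrank_eq (h1.trans (by simp))
    exact LinearMap.range_eq_top.mp h3
  rw [rowPinv, ← Matrix.mul_assoc, Matrix.mul_nonsing_inv _ ((Matrix.isUnit_iff_isUnit_det _).mp h2)]

/-! ### Rows -/

/-- A dropout is `1/2` plus a deviation of modulus `1/2`. The midpoint joins the constant term, and
the deviations cost half the `ℓ¹` norm of the row. -/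
theorem abs_row_le {J L : Type*} [Fintype J] [Fintype L] (c φ : ℝ) (l : L → ℝ) (θ : J → ℝ)
    (e : J → ℝ) (ν : L → ℝ) (he : ∀ j, |e j| ≤ φ) (hν : ∀ i, ν i = 0 ∨ ν i = 1) :
    |c + ∑ j, θ j * e j + ∑ i, l i * ν i|
      ≤ |c + 1 / 2 * ∑ i, l i| + 1 / 2 * ∑ i, |l i| + (∑ j, |θ j|) * φ := by
  have h1 : c + ∑ j, θ j * e j + ∑ i, l i * ν i
      = (c + 1 / 2 * ∑ i, l i) + ∑ i, l i * (ν i - 1 / 2) + ∑ j, θ j * e j := by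
    simp only [mul_sub, Finset.sum_sub_distrib, ← Finset.sum_mul]; ring
  rw [h1]
  refine (abs_add_three _ _ _).trans (add_le_add (add_le_add le_rfl ?_) ?_)
  · refine (Finset.abs_sum_le_sum_abs _ _).trans ?_
    rw [Finset.mul_sum]
    refine Finset.sum_le_sum fun i _ => ?_
    rcases hν i with h | h <;> rw [h, abs_mul] <;> norm_num [mul_comm, abs_of_pos]
  · refine (Finset.abs_sum_le_sum_abs _ _).trans ?_
    rw [Finset.sum_mul]
    refine Finset.sum_le_sum fun i _ => ?_
    rw [abs_mul]
    exact mul_le_mul_of_nonneg_left (he i) (abs_nonneg _)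

/-- The bound of `abs_row_le` is attained when every term has the sign `s` of the centred constant.
The dropout pattern is kept in explicit form because `controlAdmissible_iff` needs the value one
wherever the coefficient vanishes. -/
theorem le_abs_row {J L : Type*} [Fintype J] [Fintype L] (c φ : ℝ) (l : L → ℝ) (θ : J → ℝ)
    (hφ : 0 ≤ φ) : ∃ (e : J → ℝ) (s : ℝ), (∀ j, |e j| ≤ φ) ∧
    |c + 1 / 2 * ∑ i, l i| + 1 / 2 * ∑ i, |l i| + (∑ j, |θ j|) * φ
      ≤ |c + ∑ j, θ j * e j + ∑ i, l i * (if 0 ≤ s * l i then 1 else 0)| := by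
  set a := c + 1 / 2 * ∑ i, l i with ha
  obtain ⟨s, hs, hsa⟩ : ∃ s : ℝ, (s = 1 ∨ s = -1) ∧ s * a = |a| := by
    rcases le_total 0 a with h | h
    · exact ⟨1, Or.inl rfl, by rw [abs_of_nonneg h, one_mul]⟩
    · exact ⟨-1, Or.inr rfl, by rw [abs_of_nonpos h]; ring⟩
  have hss : s * s = 1 := by rcases hs with h | h <;> rw [h] <;> norm_num
  have habs : |s| = 1 := by rcases hs with h | h <;> rw [h] <;> norm_num
  refine ⟨fun j => s * (if 0 ≤ θ j then φ else -φ), s, fun j => ?_, ?_⟩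
  · rw [abs_mul, habs, one_mul]
    split_ifs
    · rw [abs_of_nonneg hφ]
    · rw [abs_neg, abs_of_nonneg hφ]
  have key : s * (c + ∑ j, θ j * (s * (if 0 ≤ θ j then φ else -φ))
      + ∑ i, l i * (if 0 ≤ s * l i then 1 else 0)) = |a| + 1 / 2 * ∑ i, |l i| + (∑ j, |θ j|) * φ := by
    have h1 : ∀ i, s * (l i * (if 0 ≤ s * l i then 1 else 0)) = 1 / 2 * |l i| + s * (1 / 2 * l i) := by
      intro i
      have h2 : |l i| = |s * l i| := by rw [abs_mul, habs, one_mul]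
      rw [h2]
      split_ifs with h
      · rw [abs_of_nonneg h]; ring
      · rw [abs_of_neg (not_le.mp h)]; ring
    have h3 : ∀ j, s * (θ j * (s * (if 0 ≤ θ j then φ else -φ))) = |θ j| * φ := by
      intro j
      split_ifs with h
      · rw [abs_of_nonneg h]; linear_combination θ j * φ * hss
      · rw [abs_of_neg (not_le.mp h)]; linear_combination (- θ j * φ) * hss
    rw [mul_add, mul_add, Finset.mul_sum, Finset.mul_sum]
    simp only [h1, h3, Finset.sum_add_distrib]
    rw [← hsa, ha, Finset.sum_mul]
    simp only [← Finset.mul_sum]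
    ring
  rw [← key]
  refine (le_abs_self _).trans ?_
  rw [abs_mul, habs, one_mul]

/-! ### The hard control constraint and feasibility -/

section Admissible

variable {d m N κ : ℕ} (S : Problem d m N κ)

theorem applied_apply (κ : ℕ) (z : Decision d m N) (e : Fin (N - 1) × Fin d → ℝ) (ν : ℕ → ℝ)
    (q : Fin N × Fin m) : applied κ z e ν q
      = (if (q.1 : ℕ) < κ then ν q.1 else 1) * computed z e ν q := by
  rw [applied, maskS, Matrix.mulVec_diagonal]

theorem computed_apply (z : Decision d m N) (e : Fin (N - 1) × Fin d → ℝ) (ν : ℕ → ℝ)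
    (q : Fin N × Fin m) : computed z e ν q
      = z.1 q + ∑ c, z.2.1 q c * e c + ∑ l, z.2.2 q l * ν l := rfl

theorem controlAdmissible_iff (z : Decision d m N) (hz : Causal z) : S.ControlAdmissible z ↔
    ∀ i, |z.1 i + 1 / 2 * ∑ l, z.2.2 i l| + 1 / 2 * ∑ l, |z.2.2 i l|
      + (∑ c, |z.2.1 i c|) * S.satBound ≤ S.Umax := by
  constructor
  · rintro h ⟨k, a⟩
    obtain ⟨e, s, he, hle⟩ := le_abs_row (z.1 (k, a)) S.satBound (z.2.2 (k, a)) (z.2.1 (k, a))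
      S.satBound_nonneg
    -- By causality row `(k, a)` of `Λ` vanishes in column `k`, so the extremal pattern has `ν k =
    -- 1`; for the last block the default value one serves. The mask therefore never erases the
    -- worst case of the row.
    let ν : ℕ → ℝ := fun n => if hn : n < N - 1 then
      (if 0 ≤ s * z.2.2 (k, a) ⟨n, hn⟩ then 1 else 0) else 1
    have hνk : ν k = 1 := by
      by_cases hn : (k : ℕ) < N - 1
      · simp [ν, hn, hz.2 k a ⟨k, hn⟩ le_rfl]
      · simp [ν, hn]
    have h1 := h e ν ((pi_norm_le_iff_of_nonneg S.satBound_nonneg).mpr he)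
      (fun n => by simp only [ν]; split_ifs <;> simp) k k.2
    have h2 := (norm_le_pi_norm (block (applied κ z e ν) k) a).trans h1
    refine hle.trans (le_trans (le_of_eq ?_) h2)
    rw [block, dif_pos k.2, applied_apply, computed_apply, Real.norm_eq_abs]
    simp [hνk, ν]
  · intro h e ν he hν k hk
    refine (pi_norm_le_iff_of_nonneg S.Umax_pos.le).mpr fun a => ?_
    rw [block, dif_pos hk, applied_apply, Real.norm_eq_abs, abs_mul]
    have h1 : |if k < κ then ν k else 1| ≤ 1 := by
      split_ifs
      · rcases hν k with h | h <;> rw [h] <;> norm_num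
      · norm_num
    refine (mul_le_of_le_one_left (abs_nonneg _) h1).trans (le_trans ?_ (h (⟨k, hk⟩, a)))
    rw [computed_apply]
    exact abs_row_le _ _ _ _ _ (fun l : Fin (N - 1) => ν l) (fun j => (norm_le_pi_norm e j).trans he)
      (fun i => hν i)

theorem ocpFeasible_eq_qpFeasible {dO dS : ℕ} (D : OrthSchurDecomp S.A dO dS) (p r ε ζ : ℝ)
    (x : Fin d → ℝ) : S.ocpFeasible D p r ε ζ x = S.qpFeasible D p r ε ζ x := by
  ext z
  exact and_congr_right fun hz => and_congr_left fun _ => controlAdmissible_iff S z hz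

/-- The open-loop input `R⁺ Ao ^ κ g` produces exactly the drift `g`, because `R R⁺ = 1` and `Ao ^
κ` is orthogonal. With entries `±ζ` the vector `g` has Euclidean norm `ζ √dO`, and the bound on `ζ`
keeps the input below `Umax`. -/
theorem ocpFeasible_nonempty {dO dS : ℕ} (D : OrthSchurDecomp S.A dO dS)
    (hrank : (reachMatrix D.Ao (D.Bo S.B) κ).rank = dO) {r ε ζ : ℝ} (hr : 0 < r) (hε : 0 < ε)
    (hζ : 0 < ζ)
    (hU : ζ * (√(dO : ℝ) * sigmaMax (rowPinv (reachMatrix D.Ao (D.Bo S.B) κ))) < S.Umax)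
    (p : ℝ) (x : Fin d → ℝ) : (S.ocpFeasible D p r ε ζ x).Nonempty := by
  set M := reachMatrix D.Ao (D.Bo S.B) κ with hM
  -- Each entry opposes the sign of the state; where neither drift constraint is active the choice
  -- is immaterial.
  let g : Fin dO → ℝ := fun j => if 0 ≤ D.orthState x j then -ζ else ζ
  have hgg : g ⬝ᵥ g = ζ ^ 2 * dO := by
    have : ∀ j, g j * g j = ζ ^ 2 := fun j => by simp only [g]; split_ifs <;> ring
    simp [dotProduct, this, mul_comm]
  have hO : D.Ao ^ κ ∈ Matrix.orthogonalGroup (Fin dO) ℝ := pow_mem D.orthogonal κ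
  have hO1 : (D.Ao ^ κ)ᵀ * D.Ao ^ κ = 1 := (Matrix.mem_orthogonalGroup_iff' (Fin dO) ℝ).mp hO
  let y := (D.Ao ^ κ) *ᵥ g
  have hyy : y ⬝ᵥ y = ζ ^ 2 * dO := by
    rw [← hgg, Matrix.dotProduct_mulVec, ← Matrix.mulVec_transpose, Matrix.mulVec_mulVec, hO1,
      Matrix.one_mulVec]
  let u := rowPinv M *ᵥ y
  have hu : ∀ q, |u q| ≤ S.Umax := by
    intro q
    refine (abs_mulVec_le_sigmaMax _ y q).trans (le_trans (le_of_eq ?_) hU.le)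
    rw [hyy, Real.sqrt_mul (sq_nonneg _), Real.sqrt_sq hζ.le]
    ring
  let z : Decision d m N := (fun q => if h : (q.1 : ℕ) < κ then u (⟨q.1, h⟩, q.2) else 0, 0, 0)
  have hz1 : ∀ q, z.1 q = if h : (q.1 : ℕ) < κ then u (⟨q.1, h⟩, q.2) else 0 := fun _ => rfl
  have hz2 : z.2.1 = 0 := rfl
  have hz3 : z.2.2 = 0 := rfl
  have hdrift : S.drift D p z = g := by
    have h1 : (fun q : Fin κ × Fin m => (z.1 + p • (z.2.2 *ᵥ fun _ => (1 : ℝ)))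
        (Fin.castLE S.κ_le_N q.1, q.2)) = u := by
      ext q
      simp [hz3, hz1]
    rw [Problem.drift, h1, Matrix.mulVec_mulVec _ M, mul_rowPinv M hrank, Matrix.one_mulVec,
      Matrix.mulVec_mulVec, hO1, Matrix.one_mulVec]
  have hc : Causal z := ⟨fun _ _ _ _ _ => by simp [hz2], fun _ _ _ _ => by simp [hz3]⟩
  refine ⟨z, hc, (controlAdmissible_iff S z hc).mpr fun i => ?_, fun j => ?_⟩
  · simp only [hz2, hz3, Matrix.zero_apply, Finset.sum_const_zero, abs_zero, mul_zero, add_zero,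
      zero_mul, hz1]
    split_ifs
    · exact hu _
    · simpa using S.Umax_pos.le
  · rw [hdrift]
    constructor
    · intro h
      have : 0 ≤ D.orthState x j := by linarith
      simp [g, this]
    · intro h
      have : ¬ 0 ≤ D.orthState x j := by linarith
      simp [g, this]

end Admissible

/-! ### Polyhedra and convex quadratic programs -/

section Polyhedron

variable {V : Type*} [AddCommGroup V] [Module ℝ V]

/-- The solution sets of finitely many affine inequalities. -/
def IsPolyhedron (F : Set V) : Prop :=
  ∃ (ι : Type) (_ : Finite ι) (a : ι → V →ₗ[ℝ] ℝ) (b : ι → ℝ), F = {z | ∀ i, a i z ≤ b i}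

theorem IsPolyhedron.halfSpace (a : V →ₗ[ℝ] ℝ) (b : ℝ) : IsPolyhedron {z | a z ≤ b} :=
  ⟨Unit, inferInstance, fun _ => a, fun _ => b, by ext; simp⟩

theorem IsPolyhedron.setOf_forall {ι : Type} [Finite ι] {p : ι → V → Prop}
    (h : ∀ i, IsPolyhedron {z | p i z}) : IsPolyhedron {z | ∀ i, p i z} := by
  choose κ hκ a b hab using h
  refine ⟨Σ i, κ i, inferInstance, fun s => a s.1 s.2, fun s => b s.1 s.2, ?_⟩
  have h' : ∀ i z, p i z ↔ ∀ j, a i j z ≤ b i j := fun i z => Set.ext_iff.mp (hab i) z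
  ext z
  simp [h', Sigma.forall]

theorem IsPolyhedron.and {p q : V → Prop} (hp : IsPolyhedron {z | p z})
    (hq : IsPolyhedron {z | q z}) : IsPolyhedron {z | p z ∧ q z} := by
  have : {z | p z ∧ q z} = {z | ∀ b : Bool, (if b then p z else q z)} := by
    ext z; simp [and_comm]
  rw [this]
  exact IsPolyhedron.setOf_forall fun b => by cases b <;> simpa

theorem IsPolyhedron.univ : IsPolyhedron {_z : V | True} :=
  ⟨Empty, inferInstance, fun _ => 0, fun _ => 0, by ext; simp⟩

theorem IsPolyhedron.imp (P : Prop) {p : V → Prop} (hp : IsPolyhedron {z | p z}) :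
    IsPolyhedron {z | P → p z} := by
  by_cases h : P
  · simpa [h] using hp
  · simpa [h] using IsPolyhedron.univ (V := V)

theorem IsPolyhedron.halfSpace_ge (a : V →ₗ[ℝ] ℝ) (b : ℝ) : IsPolyhedron {z | b ≤ a z} := by
  have := IsPolyhedron.halfSpace (-a) (-b)
  simpa using this

theorem IsPolyhedron.hyperplane (a : V →ₗ[ℝ] ℝ) (b : ℝ) : IsPolyhedron {z | a z = b} := by
  simp only [le_antisymm_iff]
  exact (IsPolyhedron.halfSpace a b).and (IsPolyhedron.halfSpace_ge a b)

theorem sum_abs_le_iff_forall_sign {ι : Type*} [Fintype ι] (v : ι → ℝ) (b : ℝ) :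
    ∑ i, |v i| ≤ b ↔ ∀ s : ι → Bool, ∑ i, (if s i then v i else - v i) ≤ b := by
  constructor
  · intro h s
    refine le_trans (Finset.sum_le_sum fun i _ => ?_) h
    split_ifs
    · exact le_abs_self _
    · exact neg_le_abs _
  · intro h
    refine le_trans (Finset.sum_le_sum fun i _ => ?_) (h fun i => decide (0 ≤ v i))
    by_cases h0 : 0 ≤ v i
    · simp [h0, abs_of_nonneg]
    · simp [h0, abs_of_neg (not_le.mp h0)]

/-- There is one half-space for each choice of signs, so no slack variables are needed here. -/
theorem IsPolyhedron.sum_abs_le {ι : Type} [Fintype ι] (a : ι → V →ₗ[ℝ] ℝ) (b : ℝ) :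
    IsPolyhedron {z | ∑ i, |a i z| ≤ b} := by
  simp only [sum_abs_le_iff_forall_sign]
  refine IsPolyhedron.setOf_forall fun s => ?_
  have := IsPolyhedron.halfSpace (∑ i, (if s i then a i else - a i)) b
  convert! this using 4 with z
  rw [LinearMap.sum_apply]
  refine Finset.sum_congr rfl fun i _ => ?_
  split_ifs <;> rfl

theorem IsPolyhedron.convex {F : Set V} (hF : IsPolyhedron F) : Convex ℝ F := by
  obtain ⟨ι, _, a, b, rfl⟩ := hF
  simp only [Set.ofPred_forall]
  exact convex_iInter fun i => convex_halfSpace_le (a i).isLinear (b i)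

theorem IsPolyhedron.isClosed [FiniteDimensional ℝ V] [TopologicalSpace V]
    [IsTopologicalAddGroup V] [ContinuousSMul ℝ V] [T2Space V] {F : Set V} (hF : IsPolyhedron F) :
    IsClosed F := by
  obtain ⟨ι, _, a, b, rfl⟩ := hF
  simp only [Set.ofPred_forall]
  exact isClosed_iInter fun i =>
    isClosed_le (a i).continuous_of_finiteDimensional continuous_const

/-- A convex quadratic function plus a nonnegative multiple of a sum of maxima of absolute values
of linear forms, over a polyhedron. -/
theorem IsPolyhedron.isConvexQP {F : Set V} (hF : IsPolyhedron F) (q : QuadraticForm ℝ V)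
    (hq : ∀ z, 0 ≤ q z) (c : V →ₗ[ℝ] ℝ) (c₀ : ℝ) {N : ℕ} {ι : Type} [Fintype ι]
    (g : Fin N → ι → V →ₗ[ℝ] ℝ) {ρ : ℝ} (hρ : 0 ≤ ρ) {J : V → ℝ}
    (hJ : ∀ z ∈ F, J z = q z + c z + c₀ + ρ * ∑ k, ‖fun j => g k j z‖) : IsConvexQP F J := by
  -- The second component dominates the norms, as in an epigraph. Its nonnegativity has to be
  -- imposed separately because `ι` may be empty.
  have hG : IsPolyhedron {y : V × (Fin N → ℝ) | y.1 ∈ F ∧ ∀ k : Fin N, 0 ≤ y.2 k ∧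
      ∀ j : ι, g k j y.1 ≤ y.2 k ∧ - g k j y.1 ≤ y.2 k} := by
    refine IsPolyhedron.and ?_ (IsPolyhedron.setOf_forall fun k => IsPolyhedron.and ?_
      (IsPolyhedron.setOf_forall fun j => IsPolyhedron.and ?_ ?_))
    · obtain ⟨ι, _, a, b, rfl⟩ := hF
      exact ⟨ι, inferInstance, fun i => a i ∘ₗ LinearMap.fst ℝ _ _, b, rfl⟩
    · exact IsPolyhedron.halfSpace_ge (LinearMap.proj k ∘ₗ LinearMap.snd ℝ V (Fin N → ℝ)) 0
    · convert! IsPolyhedron.halfSpace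
        ((g k j) ∘ₗ LinearMap.fst ℝ V (Fin N → ℝ) - LinearMap.proj k ∘ₗ LinearMap.snd ℝ V (Fin N → ℝ))
        0 using 3
      simp
    · convert! IsPolyhedron.halfSpace
        ((-g k j) ∘ₗ LinearMap.fst ℝ V (Fin N → ℝ) - LinearMap.proj k ∘ₗ LinearMap.snd ℝ V (Fin N → ℝ))
        0 using 3
      simp
  obtain ⟨κ, hκ, a, b, hab⟩ := hG
  have := Fintype.ofFinite κ
  let e := Fintype.equivFin κ
  have hiff : ∀ z (s : Fin N → ℝ), (∀ i, a (e.symm i) (z, s) ≤ b (e.symm i)) ↔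
      z ∈ F ∧ ∀ k, ‖fun j => g k j z‖ ≤ s k := by
    intro z s
    rw [e.symm.forall_congr_left]
    simp only [Equiv.symm_symm, Equiv.symm_apply_apply]
    refine (Set.ext_iff.mp hab (z, s)).symm.trans (and_congr_right fun _ => forall_congr' fun k => ?_)
    constructor
    · rintro ⟨h0, h⟩
      exact (pi_norm_le_iff_of_nonneg h0).mpr fun j => abs_le'.mpr (h j)
    · intro h
      have h0 := (norm_nonneg _).trans h
      exact ⟨h0, fun j => abs_le'.mp ((pi_norm_le_iff_of_nonneg h0).mp h j)⟩
  let l : V × (Fin N → ℝ) →ₗ[ℝ] ℝ :=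
    c ∘ₗ LinearMap.fst ℝ V (Fin N → ℝ) + ρ • ∑ k, LinearMap.proj k ∘ₗ LinearMap.snd ℝ V (Fin N → ℝ)
  have hl : ∀ z s, l (z, s) = c z + ρ * ∑ k, s k := by
    intro z s
    simp [l, LinearMap.sum_apply]
  refine ⟨N, Fintype.card κ, q.comp (LinearMap.fst ℝ V (Fin N → ℝ)),
    l, c₀,
    fun i => a (e.symm i), fun i => b (e.symm i), fun y => hq y.1, fun z => ?_, fun z hz => ?_⟩
  · simp only [hiff]
    exact ⟨fun h => ⟨_, h, fun k => le_rfl⟩, fun ⟨s, h, _⟩ => h⟩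
  · have hval : ∀ s : Fin N → ℝ, q.comp (LinearMap.fst ℝ V (Fin N → ℝ)) (z, s)
        + l (z, s) + c₀ = q z + c z + c₀ + ρ * ∑ k, s k := by
      intro s
      rw [hl, QuadraticMap.comp_apply, LinearMap.fst_apply]
      ring
    simp only [hiff, hval, hJ z hz]
    refine ⟨⟨_, ⟨hz, fun k => le_rfl⟩, rfl⟩, ?_⟩
    rintro v ⟨s, ⟨_, hs⟩, rfl⟩
    gcongr with k
    exact hs k

end Polyhedron

/-! ### The feasible set as a polyhedron, and the convex regularizer -/

section Feasible

variable {d m N κ : ℕ} (S : Problem d m N κ)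

theorem drift_add {dO dS : ℕ} (D : OrthSchurDecomp S.A dO dS) (p : ℝ) (z z' : Decision d m N) :
    S.drift D p (z + z') = S.drift D p z + S.drift D p z' := by
  rw [Problem.drift, Problem.drift, Problem.drift, ← Matrix.mulVec_add, ← Matrix.mulVec_add]
  congr 2
  ext q
  simp [Matrix.add_mulVec]
  ring

theorem drift_smul {dO dS : ℕ} (D : OrthSchurDecomp S.A dO dS) (p c : ℝ) (z : Decision d m N) :
    S.drift D p (c • z) = c • S.drift D p z := by
  rw [Problem.drift, Problem.drift, ← Matrix.mulVec_smul (D.Ao ^ κ)ᵀ,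
    ← Matrix.mulVec_smul (reachMatrix D.Ao (D.Bo S.B) κ)]
  congr 2
  funext q
  simp only [Prod.smul_fst, Prod.smul_snd, Matrix.smul_mulVec, Pi.add_apply, Pi.smul_apply,
    smul_eq_mul]
  ring

/-- The stability constraint vector as a linear map of the decision. -/
def Problem.driftLin {dO dS : ℕ} (D : OrthSchurDecomp S.A dO dS) (p : ℝ) :
    Decision d m N →ₗ[ℝ] (Fin dO → ℝ) where
  toFun := S.drift D p
  map_add' := drift_add S D p
  map_smul' := drift_smul S D p

/-- The feasible set for a given pattern of active stability constraints. -/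
def Problem.patternFeasible {dO dS : ℕ} (D : OrthSchurDecomp S.A dO dS) (p ζ : ℝ)
    (pos neg : Fin dO → Prop) : Set (Decision d m N) :=
  {z | Causal z ∧
    (∀ i, |z.1 i + 1 / 2 * ∑ l, z.2.2 i l| + 1 / 2 * ∑ l, |z.2.2 i l|
      + (∑ c, |z.2.1 i c|) * S.satBound ≤ S.Umax) ∧
    ∀ j, (pos j → S.drift D p z j ≤ -ζ) ∧ (neg j → ζ ≤ S.drift D p z j)}

theorem isPolyhedron_patternFeasible {dO dS : ℕ} (D : OrthSchurDecomp S.A dO dS) (p ζ : ℝ)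
    (pos neg : Fin dO → Prop) : IsPolyhedron (S.patternFeasible D p ζ pos neg) := by
  let η (i) : Decision d m N →ₗ[ℝ] ℝ := LinearMap.proj i ∘ₗ LinearMap.fst ℝ _ _
  let Θ (i c) : Decision d m N →ₗ[ℝ] ℝ :=
    Matrix.entryLinearMap ℝ ℝ i c ∘ₗ LinearMap.fst ℝ _ _ ∘ₗ LinearMap.snd ℝ _ _
  let Λ (i c) : Decision d m N →ₗ[ℝ] ℝ :=
    Matrix.entryLinearMap ℝ ℝ i c ∘ₗ LinearMap.snd ℝ _ _ ∘ₗ LinearMap.snd ℝ _ _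
  refine IsPolyhedron.and (IsPolyhedron.and ?_ ?_) (IsPolyhedron.and ?_ ?_)
  · exact IsPolyhedron.setOf_forall fun k => IsPolyhedron.setOf_forall fun a =>
      IsPolyhedron.setOf_forall fun i => IsPolyhedron.setOf_forall fun b => IsPolyhedron.imp _
        (IsPolyhedron.hyperplane (Θ (k, a) (i, b)) 0)
  · exact IsPolyhedron.setOf_forall fun k => IsPolyhedron.setOf_forall fun a =>
      IsPolyhedron.setOf_forall fun i => IsPolyhedron.imp _
        (IsPolyhedron.hyperplane (Λ (k, a) i) 0)
  · refine IsPolyhedron.setOf_forall fun i => ?_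
    -- With the nonnegative factors moved inside the absolute values, the whole row becomes a single
    -- `ℓ¹` constraint.
    have h := IsPolyhedron.sum_abs_le (ι := Unit ⊕ Fin (N - 1) ⊕ (Fin (N - 1) × Fin d))
      (Sum.elim (fun _ => η i + (1 / 2 : ℝ) • ∑ l, Λ i l) (Sum.elim (fun l => (1 / 2 : ℝ) • Λ i l)
        (fun c => S.satBound • Θ i c))) S.Umax
    convert! h using 4 with z
    simp [η, Θ, Λ, LinearMap.sum_apply, abs_mul, abs_of_nonneg S.satBound_nonneg, Finset.mul_sum,
      add_assoc, mul_comm]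
  · exact IsPolyhedron.setOf_forall fun j => IsPolyhedron.and
      (IsPolyhedron.imp _ (IsPolyhedron.halfSpace (LinearMap.proj j ∘ₗ S.driftLin D p) _))
      (IsPolyhedron.imp _ (IsPolyhedron.halfSpace_ge (LinearMap.proj j ∘ₗ S.driftLin D p) _))

/-- The state enters only through which drift constraints are active; this reduces the measurable
selection to finitely many fixed sets. -/
theorem qpFeasible_eq_patternFeasible {dO dS : ℕ} (D : OrthSchurDecomp S.A dO dS) (p r ε ζ : ℝ)
    (x : Fin d → ℝ) : S.qpFeasible D p r ε ζ x = S.patternFeasible D p ζ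
      (fun j => r + ε ≤ D.orthState x j) (fun j => D.orthState x j ≤ -r - ε) := rfl

/-- The entries of `F = (η Θ Λ)` as linear forms. -/
def matFLin (q : Fin N × Fin m) (c : Unit ⊕ (Fin (N - 1) × Fin d) ⊕ Fin (N - 1)) :
    Decision d m N →ₗ[ℝ] ℝ where
  toFun z := matF z q c
  map_add' z z' := by rcases c with c | c | c <;> simp [matF]
  map_smul' a z := by rcases c with c | c | c <;> simp [matF]

theorem sparsity_eq (z : Decision d m N) : sparsity z
    = ∑ k : Fin N, ‖(fun q : Fin m × (Unit ⊕ (Fin (N - 1) × Fin d) ⊕ Fin (N - 1)) =>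
      matFLin (k, q.1) q.2 z)‖ := rfl

theorem convexOn_sparsity : ConvexOn ℝ Set.univ (sparsity : Decision d m N → ℝ) := by
  have h : ∀ k : Fin N, ConvexOn ℝ Set.univ fun z : Decision d m N =>
      ‖(fun q : Fin m × (Unit ⊕ (Fin (N - 1) × Fin d) ⊕ Fin (N - 1)) =>
        matFLin (k, q.1) q.2 z)‖ := fun k => by
    let L : Decision d m N →ₗ[ℝ] (Fin m × (Unit ⊕ (Fin (N - 1) × Fin d) ⊕ Fin (N - 1)) → ℝ) :=
      LinearMap.pi fun q => matFLin (k, q.1) q.2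
    refine ⟨convex_univ, fun z _ z' _ a b ha hb _ => ?_⟩
    change ‖L (a • z + b • z')‖ ≤ a • ‖L z‖ + b • ‖L z'‖
    rw [map_add, map_smul, map_smul]
    refine (norm_add_le _ _).trans (le_of_eq ?_)
    rw [norm_smul, norm_smul, Real.norm_of_nonneg ha, Real.norm_of_nonneg hb]
    rfl
  have := Finset.sum_induction (fun k : Fin N => fun z : Decision d m N =>
      ‖(fun q : Fin m × (Unit ⊕ (Fin (N - 1) × Fin d) ⊕ Fin (N - 1)) => matFLin (k, q.1) q.2 z)‖)
    (ConvexOn ℝ Set.univ) (fun _ _ => ConvexOn.add) (convexOn_const 0 convex_univ)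
    (s := Finset.univ) (fun k _ => h k)
  convert! this using 1
  ext z
  simp [sparsity_eq]

end Feasible

/-! ### Stacked dynamics and the cost as a quadratic form -/

section Stacked

variable {d m N κ : ℕ} (S : Problem d m N κ)

/-- The induction step of the variation-of-constants formula, for the predicted states and later for
the Schur stable part of the closed loop. -/
theorem sum_pow_mulVec_succ {n : Type*} [Fintype n] [DecidableEq n] (A : Matrix n n ℝ)
    (f : ℕ → n → ℝ) (k : ℕ) : ∑ l ∈ Finset.range (k + 1), A ^ (k - l) *ᵥ f l
      = A *ᵥ (∑ l ∈ Finset.range k, A ^ (k - 1 - l) *ᵥ f l) + f k := by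
  rw [Finset.sum_range_succ, Nat.sub_self, pow_zero, Matrix.one_mulVec, Matrix.mulVec_sum]
  congr 1
  refine Finset.sum_congr rfl fun l hl => ?_
  rw [Matrix.mulVec_mulVec, ← pow_succ']
  congr 2
  have := Finset.mem_range.mp hl
  omega

theorem dotProduct_transpose_mulVec_eq {I J : Type*} [Fintype I] [Fintype J] (M : Matrix I J ℝ)
    (y : J → ℝ) (z : I → ℝ) : y ⬝ᵥ Mᵀ *ᵥ z = (M *ᵥ y) ⬝ᵥ z := by
  rw [Matrix.dotProduct_mulVec, Matrix.vecMul_transpose]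

theorem predicted_eq (x : Fin d → ℝ) (u : Fin N × Fin m → ℝ) (w : ℕ → Fin d → ℝ) (k : ℕ) :
    S.predicted x u w k = S.A ^ k *ᵥ x
      + ∑ l ∈ Finset.range k, S.A ^ (k - 1 - l) *ᵥ (S.B *ᵥ block u l + w l) := by
  induction k with
  | zero => simp [Problem.predicted]
  | succ k ih =>
    rw [Problem.predicted, ih, Nat.add_sub_cancel, sum_pow_mulVec_succ, Matrix.mulVec_add,
      Matrix.mulVec_mulVec, ← pow_succ', add_assoc, add_assoc]

theorem sum_fin_ite_lt {M : Type*} [AddCommMonoid M] {N k : ℕ} (hk : k ≤ N) (f : ℕ → M) :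
    ∑ l : Fin N, (if (l : ℕ) < k then f l else 0) = ∑ l ∈ Finset.range k, f l := by
  rw [Fin.sum_univ_eq_sum_range (fun l => if l < k then f l else 0) N, ← Finset.sum_filter]
  congr 1
  ext l
  simp only [Finset.mem_filter, Finset.mem_range]
  omega

theorem stackB_mulVec (u : Fin N × Fin m → ℝ) (k : Fin (N + 1)) (a : Fin d) :
    (S.stackB *ᵥ u) (k, a)
      = (∑ l ∈ Finset.range k, S.A ^ ((k : ℕ) - 1 - l) *ᵥ (S.B *ᵥ block u l)) a := by
  rw [← sum_fin_ite_lt (Nat.lt_succ_iff.mp k.2), Finset.sum_apply, Matrix.mulVec, dotProduct,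
    Fintype.sum_prod_type]
  refine Finset.sum_congr rfl fun l _ => ?_
  simp only [Problem.stackB, Matrix.of_apply]
  split_ifs with h
  · rw [Matrix.mulVec_mulVec, Matrix.mulVec, dotProduct]
    refine Finset.sum_congr rfl fun b _ => ?_
    simp [block]
  · simp

theorem stackD_mulVec (w : ℕ → Fin d → ℝ) (k : Fin (N + 1)) (a : Fin d) :
    (S.stackD *ᵥ noiseStack N w) (k, a)
      = (∑ l ∈ Finset.range k, S.A ^ ((k : ℕ) - 1 - l) *ᵥ w l) a := by
  rw [← sum_fin_ite_lt (Nat.lt_succ_iff.mp k.2), Finset.sum_apply, Matrix.mulVec, dotProduct,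
    Fintype.sum_prod_type]
  refine Finset.sum_congr rfl fun l _ => ?_
  simp only [Problem.stackD, Matrix.of_apply]
  split_ifs with h
  · rw [Matrix.mulVec, dotProduct]
    rfl
  · simp

/-- The stacked predicted states. -/
def Problem.stackState (x : Fin d → ℝ) (u : Fin N × Fin m → ℝ) (w : ℕ → Fin d → ℝ) :
    Fin (N + 1) × Fin d → ℝ :=
  S.stackA *ᵥ x + S.stackB *ᵥ u + S.stackD *ᵥ noiseStack N w

theorem stackState_apply (x : Fin d → ℝ) (u : Fin N × Fin m → ℝ) (w : ℕ → Fin d → ℝ)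
    (k : Fin (N + 1)) (a : Fin d) : S.stackState x u w (k, a) = S.predicted x u w k a := by
  rw [predicted_eq, Problem.stackState, Pi.add_apply, Pi.add_apply, stackB_mulVec, stackD_mulVec,
    add_assoc, ← Pi.add_apply, ← Finset.sum_add_distrib]
  simp only [← Matrix.mulVec_add]
  rfl

theorem stackQ_quadratic (X : Fin (N + 1) × Fin d → ℝ) : X ⬝ᵥ S.stackQ *ᵥ X
    = ∑ k ∈ Finset.range N, (fun a => if h : k < N + 1 then X (⟨k, h⟩, a) else 0) ⬝ᵥ
        S.Q *ᵥ (fun a => if h : k < N + 1 then X (⟨k, h⟩, a) else 0)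
      + (fun a => X (Fin.last N, a)) ⬝ᵥ S.Qf *ᵥ fun a => X (Fin.last N, a) := by
  have h1 : ∀ k a, (S.stackQ *ᵥ X) (k, a)
      = ((if (k : ℕ) < N then S.Q else S.Qf) *ᵥ fun b => X (k, b)) a := by
    intro k a
    simp only [Matrix.mulVec, dotProduct, Problem.stackQ, Matrix.of_apply, Fintype.sum_prod_type]
    rw [Finset.sum_eq_single k (fun l _ hl => by simp [hl.symm]) (by simp)]
    refine Finset.sum_congr rfl fun b _ => ?_
    split_ifs <;> simp_all
  rw [dotProduct, Fintype.sum_prod_type, Fin.sum_univ_castSucc]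
  simp only [h1]
  congr 1
  · rw [← Fin.sum_univ_eq_sum_range (fun k => (fun a => if h : k < N + 1 then X (⟨k, h⟩, a) else 0) ⬝ᵥ
        S.Q *ᵥ (fun a => if h : k < N + 1 then X (⟨k, h⟩, a) else 0)) N]
    refine Finset.sum_congr rfl fun k _ => ?_
    have hk : (k : ℕ) < N + 1 := k.2.trans (Nat.lt_succ_self N)
    simp only [Fin.val_castSucc, k.2, if_true, dotProduct]
    refine Finset.sum_congr rfl fun a _ => ?_
    simp only [hk, dif_pos]
    rfl
  · simp [dotProduct]

theorem stackR_quadratic (u : Fin N × Fin m → ℝ) : u ⬝ᵥ S.stackR *ᵥ u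
    = ∑ k ∈ Finset.range N, block u k ⬝ᵥ S.R *ᵥ block u k := by
  have h1 : ∀ k a, (S.stackR *ᵥ u) (k, a) = (S.R *ᵥ fun b => u (k, b)) a := by
    intro k a
    simp only [Matrix.mulVec, dotProduct, Problem.stackR, Matrix.of_apply, Fintype.sum_prod_type]
    rw [Finset.sum_eq_single k (fun l _ hl => by simp [hl.symm]) (by simp)]
    simp
  rw [dotProduct, Fintype.sum_prod_type]
  simp only [h1]
  rw [← Fin.sum_univ_eq_sum_range (fun k => block u k ⬝ᵥ S.R *ᵥ block u k) N]
  refine Finset.sum_congr rfl fun k _ => ?_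
  have : block u k = fun b => u (k, b) := by ext b; simp [block]
  rw [this]; rfl

theorem cost_eq (x : Fin d → ℝ) (u : Fin N × Fin m → ℝ) (w : ℕ → Fin d → ℝ) : S.cost x u w
    = S.stackState x u w ⬝ᵥ S.stackQ *ᵥ S.stackState x u w + u ⬝ᵥ S.stackR *ᵥ u := by
  rw [stackQ_quadratic, stackR_quadratic, Problem.cost, Finset.sum_add_distrib, add_right_comm]
  congr 2
  · refine Finset.sum_congr rfl fun k hk => ?_
    have hk : k < N + 1 := (Finset.mem_range.mp hk).trans (Nat.lt_succ_self N)
    simp only [hk, dif_pos, stackState_apply]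
  · simp only [stackState_apply]
    rfl

theorem stackQ_transpose : S.stackQᵀ = S.stackQ := by
  have hQ : ∀ a b, S.Q a b = S.Q b a := fun a b => by simpa using S.posSemidef_Q.1.apply b a
  have hQf : ∀ a b, S.Qf a b = S.Qf b a := fun a b => by simpa using S.posSemidef_Qf.1.apply b a
  ext q c
  simp only [Problem.stackQ, Matrix.transpose_apply, Matrix.of_apply]
  by_cases h : q.1 = c.1
  · simp only [h, if_true, hQ c.2 q.2, hQf c.2 q.2]
  · rw [if_neg h, if_neg (Ne.symm h)]

theorem stackR_transpose : S.stackRᵀ = S.stackR := by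
  have hR : ∀ a b, S.R a b = S.R b a := fun a b => by simpa using S.posDef_R.1.apply b a
  ext q c
  simp only [Problem.stackR, Matrix.transpose_apply, Matrix.of_apply]
  by_cases h : q.1 = c.1
  · simp only [h, if_true, hR c.2 q.2]
  · rw [if_neg h, if_neg (Ne.symm h)]

theorem alpha_transpose : S.alphaᵀ = S.alpha := by
  rw [Problem.alpha, Matrix.transpose_add, Matrix.transpose_mul, Matrix.transpose_mul,
    stackQ_transpose, stackR_transpose, Matrix.transpose_transpose, Matrix.mul_assoc]

theorem stackQ_nonneg (X : Fin (N + 1) × Fin d → ℝ) : 0 ≤ X ⬝ᵥ S.stackQ *ᵥ X := by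
  rw [stackQ_quadratic]
  refine add_nonneg (Finset.sum_nonneg fun k _ => ?_) ?_
  · simpa using S.posSemidef_Q.dotProduct_mulVec_nonneg _
  · simpa using S.posSemidef_Qf.dotProduct_mulVec_nonneg _

theorem alpha_nonneg (u : Fin N × Fin m → ℝ) : 0 ≤ u ⬝ᵥ S.alpha *ᵥ u := by
  have h : u ⬝ᵥ S.alpha *ᵥ u
      = (S.stackB *ᵥ u) ⬝ᵥ S.stackQ *ᵥ (S.stackB *ᵥ u) + u ⬝ᵥ S.stackR *ᵥ u := by
    rw [Problem.alpha, Matrix.add_mulVec, dotProduct_add, ← Matrix.mulVec_mulVec,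
      ← Matrix.mulVec_mulVec, Matrix.dotProduct_mulVec u, Matrix.vecMul_transpose]
  rw [h, stackR_quadratic]
  refine add_nonneg (stackQ_nonneg S _) (Finset.sum_nonneg fun k _ => ?_)
  simpa using S.posDef_R.posSemidef.dotProduct_mulVec_nonneg _

/-- The cost in terms of the part `g` of the control that depends on the dropouts only and of the
part `K e` that is linear in the saturated noise. -/
theorem cost_expand {J : Type*} [Fintype J] (x : Fin d → ℝ) (g : Fin N × Fin m → ℝ)
    (K : Matrix (Fin N × Fin m) J ℝ) (e : J → ℝ) (w : ℕ → Fin d → ℝ) :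
    S.cost x (g + K *ᵥ e) w
      = g ⬝ᵥ S.alpha *ᵥ g + 2 * (S.stackQ *ᵥ (S.stackA *ᵥ x)) ⬝ᵥ (S.stackB *ᵥ g)
        + (S.stackA *ᵥ x) ⬝ᵥ S.stackQ *ᵥ (S.stackA *ᵥ x)
        + 2 * (e ⬝ᵥ (Kᵀ * S.stackBᵀ * S.stackQ * S.stackD) *ᵥ noiseStack N w)
        + noiseStack N w ⬝ᵥ (S.stackDᵀ * S.stackQ * S.stackD) *ᵥ noiseStack N w
        + e ⬝ᵥ (Kᵀ * S.alpha * K) *ᵥ e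
        + ((2 : ℝ) • (Kᵀ *ᵥ (S.alpha *ᵥ g + S.stackBᵀ *ᵥ (S.stackQ *ᵥ (S.stackA *ᵥ x))))) ⬝ᵥ e
        + ((2 : ℝ) • (S.stackDᵀ *ᵥ (S.stackQ *ᵥ (S.stackA *ᵥ x + S.stackB *ᵥ g))))
          ⬝ᵥ noiseStack N w := by
  rw [cost_eq, Problem.stackState]
  set a := S.stackA *ᵥ x
  set n := noiseStack N w
  have hQ : ∀ y z, y ⬝ᵥ S.stackQ *ᵥ z = z ⬝ᵥ S.stackQ *ᵥ y := fun y z => by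
    rw [Matrix.dotProduct_mulVec, ← Matrix.mulVec_transpose, stackQ_transpose, dotProduct_comm]
  have hR : ∀ y z, y ⬝ᵥ S.stackR *ᵥ z = z ⬝ᵥ S.stackR *ᵥ y := fun y z => by
    rw [Matrix.dotProduct_mulVec, ← Matrix.mulVec_transpose, stackR_transpose, dotProduct_comm]
  have hα : ∀ y z, y ⬝ᵥ S.alpha *ᵥ z
      = (S.stackB *ᵥ y) ⬝ᵥ S.stackQ *ᵥ (S.stackB *ᵥ z) + y ⬝ᵥ S.stackR *ᵥ z := fun y z => by
    rw [Problem.alpha, Matrix.add_mulVec, dotProduct_add, ← Matrix.mulVec_mulVec,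
      ← Matrix.mulVec_mulVec, dotProduct_transpose_mulVec_eq]
  rw [dotProduct_comm (S.stackQ *ᵥ a), dotProduct_comm ((2 : ℝ) • _) e,
    dotProduct_comm ((2 : ℝ) • _) n]
  simp only [← Matrix.mulVec_mulVec, dotProduct_transpose_mulVec_eq, dotProduct_smul, hα,
    Matrix.mulVec_add, dotProduct_add, add_dotProduct, smul_add, smul_eq_mul]
  rw [hQ (S.stackB *ᵥ g) a, hQ (S.stackB *ᵥ (K *ᵥ e)) a, hQ (S.stackD *ᵥ n) a,
    hQ (S.stackB *ᵥ (K *ᵥ e)) (S.stackB *ᵥ g), hQ (S.stackD *ᵥ n) (S.stackB *ᵥ g),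
    hQ (S.stackD *ᵥ n) (S.stackB *ᵥ (K *ᵥ e)), hR (K *ᵥ e) g]
  ring

end Stacked

/-! ### Expectations of functions of the dropouts and the noise -/

section Expectation

variable {Ω : Type*} [MeasurableSpace Ω] {P : Measure Ω} [IsProbabilityMeasure P] {d : ℕ} {p : ℝ}
  {ν : ℕ → Ω → ℝ} {w : ℕ → Ω → Fin d → ℝ}

/-- A function of the dropouts or of the noise from time `t` on. -/
def shift {β : Type*} (ν : ℕ → Ω → β) (t : ℕ) (ω : Ω) : ℕ → β := fun k => ν (t + k) ω

theorem measurable_shift {β : Type*} [MeasurableSpace β] {ν : ℕ → Ω → β}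
    (h : ∀ t, Measurable (ν t)) (t : ℕ) : Measurable (shift ν t) :=
  measurable_pi_lambda _ fun k => h (t + k)

namespace IsDisturbance

variable (hd : IsDisturbance P p ν w) (t : ℕ)
include hd

/-- The dropouts take values in the compact product `{0,1}^ℕ`, so continuity alone yields
boundedness, and hence integrability. -/
theorem exists_bound_dropout {f : (ℕ → ℝ) → ℝ} (hf : Continuous f) :
    ∃ C, ∀ ω, ‖f (shift ν t ω)‖ ≤ C := by
  have hK : IsCompact (Set.pi Set.univ fun _ : ℕ => ({0, 1} : Set ℝ)) :=
    isCompact_univ_pi fun _ => (Set.toFinite _).isCompact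
  obtain ⟨C, hC⟩ := hK.exists_bound_of_continuousOn hf.continuousOn
  exact ⟨C, fun ω => hC _ fun k _ => hd.ν_bernoulli (t + k) ω⟩

theorem integrable_dropout {f : (ℕ → ℝ) → ℝ} (hf : Continuous f) :
    Integrable (fun ω => f (shift ν t ω)) P := by
  obtain ⟨C, hC⟩ := hd.exists_bound_dropout t hf
  exact Integrable.of_bound
    (hf.measurable.comp (measurable_shift hd.ν_measurable t)).aestronglyMeasurable C
    (Filter.Eventually.of_forall hC)

theorem indepFun_shift {f : (ℕ → ℝ) → ℝ} (hf : Measurable f) {g : (ℕ → Fin d → ℝ) → ℝ}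
    (hg : Measurable g) : IndepFun (fun ω => f (shift ν t ω)) (fun ω => g (shift w t ω)) P := by
  have h1 : Measurable fun s : ℕ → ℝ => f fun k => s (t + k) := by fun_prop
  have h2 : Measurable fun s : ℕ → Fin d → ℝ => g fun k => s (t + k) := by fun_prop
  exact hd.indep.comp h1 h2

theorem integrable_mul {f : (ℕ → ℝ) → ℝ} (hf : Continuous f) {g : (ℕ → Fin d → ℝ) → ℝ}
    (hg : Measurable g) (hgi : Integrable (fun ω => g (shift w t ω)) P) :
    Integrable (fun ω => f (shift ν t ω) * g (shift w t ω)) P :=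
  (hd.indepFun_shift t hf.measurable hg).integrable_mul (hd.integrable_dropout t hf) hgi

theorem integral_mul {f : (ℕ → ℝ) → ℝ} (hf : Continuous f) {g : (ℕ → Fin d → ℝ) → ℝ}
    (hg : Measurable g) (hgi : Integrable (fun ω => g (shift w t ω)) P) :
    ∫ ω, f (shift ν t ω) * g (shift w t ω) ∂P
      = (∫ ω, f (shift ν t ω) ∂P) * ∫ ω, g (shift w t ω) ∂P :=
  (hd.indepFun_shift t hf.measurable hg).integral_fun_mul_eq_mul_integral
    (hd.integrable_dropout t hf).aestronglyMeasurable hgi.aestronglyMeasurable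

section Bilinear

variable {I J : Type*} [Fintype I] [Fintype J]

theorem integrable_bilin {M : (ℕ → ℝ) → Matrix I J ℝ} (hM : Continuous M)
    {a : (ℕ → Fin d → ℝ) → I → ℝ} {b : (ℕ → Fin d → ℝ) → J → ℝ}
    (ha : ∀ i, Measurable fun s => a s i) (hb : ∀ i, Measurable fun s => b s i)
    (hab : ∀ i j, Integrable (fun ω => b (shift w t ω) j * a (shift w t ω) i) P) :
    Integrable (fun ω => a (shift w t ω) ⬝ᵥ M (shift ν t ω) *ᵥ b (shift w t ω)) P := by
  simp only [dotProduct, Matrix.mulVec, Finset.mul_sum]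
  refine integrable_finsetSum _ fun i _ => integrable_finsetSum _ fun j _ => ?_
  refine (hd.integrable_mul t (hM.matrix_elem i j) ((hb j).mul (ha i)) (hab i j)).congr
    (Filter.Eventually.of_forall fun ω => ?_)
  simp only [Pi.mul_apply]; ring

theorem integral_bilin {M : (ℕ → ℝ) → Matrix I J ℝ} (hM : Continuous M)
    {a : (ℕ → Fin d → ℝ) → I → ℝ} {b : (ℕ → Fin d → ℝ) → J → ℝ}
    (ha : ∀ i, Measurable fun s => a s i) (hb : ∀ i, Measurable fun s => b s i)
    (hab : ∀ i j, Integrable (fun ω => b (shift w t ω) j * a (shift w t ω) i) P) :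
    ∫ ω, a (shift w t ω) ⬝ᵥ M (shift ν t ω) *ᵥ b (shift w t ω) ∂P
      = Matrix.trace (expect P (fun ω => M (shift ν t ω))
        * expect P fun ω => Matrix.vecMulVec (b (shift w t ω)) (a (shift w t ω))) := by
  have h1 : ∀ i j, Integrable (fun ω =>
      M (shift ν t ω) i j * (b (shift w t ω) j * a (shift w t ω) i)) P := fun i j =>
    hd.integrable_mul t (hM.matrix_elem i j) ((hb j).mul (ha i)) (hab i j)
  have h2 : ∀ ω, a (shift w t ω) ⬝ᵥ M (shift ν t ω) *ᵥ b (shift w t ω)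
      = ∑ i, ∑ j, M (shift ν t ω) i j * (b (shift w t ω) j * a (shift w t ω) i) := by
    intro ω
    simp only [dotProduct, Matrix.mulVec, Finset.mul_sum]
    refine Finset.sum_congr rfl fun i _ => Finset.sum_congr rfl fun j _ => ?_
    ring
  simp only [h2]
  rw [integral_finsetSum _ fun i _ => integrable_finsetSum _ fun j _ => h1 i j, Matrix.trace]
  refine Finset.sum_congr rfl fun i _ => ?_
  rw [integral_finsetSum _ fun j _ => h1 i j, Matrix.diag, Matrix.mul_apply]
  refine Finset.sum_congr rfl fun j _ => ?_
  exact hd.integral_mul t (hM.matrix_elem i j) ((hb j).mul (ha i)) (hab i j)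

theorem integrable_dot {h : (ℕ → ℝ) → I → ℝ} (hh : Continuous h)
    {a : (ℕ → Fin d → ℝ) → I → ℝ} (ha : ∀ i, Measurable fun s => a s i)
    (hai : ∀ i, Integrable (fun ω => a (shift w t ω) i) P) :
    Integrable (fun ω => h (shift ν t ω) ⬝ᵥ a (shift w t ω)) P := by
  simp only [dotProduct]
  exact integrable_finsetSum _ fun i _ =>
    hd.integrable_mul t ((continuous_apply i).comp hh) (ha i) (hai i)

theorem integral_dot_eq_zero {h : (ℕ → ℝ) → I → ℝ} (hh : Continuous h)
    {a : (ℕ → Fin d → ℝ) → I → ℝ} (ha : ∀ i, Measurable fun s => a s i)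
    (hai : ∀ i, Integrable (fun ω => a (shift w t ω) i) P)
    (ha0 : ∀ i, ∫ ω, a (shift w t ω) i ∂P = 0) :
    ∫ ω, h (shift ν t ω) ⬝ᵥ a (shift w t ω) ∂P = 0 := by
  have hh' : ∀ i, Continuous fun s => h s i := fun i => (continuous_apply i).comp hh
  simp only [dotProduct]
  rw [integral_finsetSum _ fun i _ => hd.integrable_mul t (hh' i) (ha i) (hai i)]
  refine Finset.sum_eq_zero fun i _ => ?_
  rw [hd.integral_mul t (hh' i) (ha i) (hai i), ha0, mul_zero]

theorem integral_dotProduct_mulVec {M : (ℕ → ℝ) → Matrix I J ℝ} (hM : Continuous M) (a : I → ℝ)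
    (b : J → ℝ) : ∫ ω, a ⬝ᵥ M (shift ν t ω) *ᵥ b ∂P
      = a ⬝ᵥ expect P (fun ω => M (shift ν t ω)) *ᵥ b := by
  have h1 : ∀ i j, Integrable (fun ω => M (shift ν t ω) i j) P := fun i j =>
    hd.integrable_dropout t (hM.matrix_elem i j)
  simp only [dotProduct, Matrix.mulVec, expect, Matrix.of_apply]
  rw [integral_finsetSum _ fun i _ =>
    (integrable_finsetSum _ fun j _ => (h1 i j).mul_const _).const_mul _]
  refine Finset.sum_congr rfl fun i _ => ?_
  rw [integral_const_mul, integral_finsetSum _ fun j _ => (h1 i j).mul_const _]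
  congr 1
  exact Finset.sum_congr rfl fun j _ => integral_mul_const _ _

theorem expect_mul {K : Type*} {M : (ℕ → ℝ) → Matrix K J ℝ} (hM : Continuous M)
    (C : Matrix J I ℝ) : expect P (fun ω => M (shift ν t ω)) * C
      = expect P fun ω => M (shift ν t ω) * C := by
  ext i j
  simp only [Matrix.mul_apply, expect, Matrix.of_apply]
  rw [integral_finsetSum _ fun k _ =>
    (hd.integrable_dropout t (hM.matrix_elem i k)).mul_const _]
  exact Finset.sum_congr rfl fun k _ => (integral_mul_const _ _).symm

theorem mul_expect {K : Type*} {M : (ℕ → ℝ) → Matrix J K ℝ} (hM : Continuous M)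
    (C : Matrix I J ℝ) : C * expect P (fun ω => M (shift ν t ω))
      = expect P fun ω => C * M (shift ν t ω) := by
  ext i j
  simp only [Matrix.mul_apply, expect, Matrix.of_apply]
  rw [integral_finsetSum _ fun k _ =>
    (hd.integrable_dropout t (hM.matrix_elem k j)).const_mul _]
  exact Finset.sum_congr rfl fun k _ => (integral_const_mul _ _).symm

end Bilinear

/-- The variables `h (w t)` and `-h (w t)` have the same law, so the integral equals its own
negative. No integrability is required, since the integral is zero by default otherwise. -/
theorem integral_odd {E : Type*} [NormedAddCommGroup E] [NormedSpace ℝ E] {h : (Fin d → ℝ) → ℝ}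
    (hm : Measurable h) (hodd : ∀ v, h (-v) = - h v) : ∫ ω, h (w t ω) ∂P = 0 := by
  have h1 := ((hd.w_symm t).comp hm).integral_eq
  simp only [Function.comp_def, hodd, integral_neg] at h1
  linarith

theorem integrable_norm_pow {k : ℕ} (hk : k ≤ 4) : Integrable (fun ω => ‖w t ω‖ ^ k) P := by
  refine ((integrable_const (1 : ℝ)).add (hd.w_fourth t)).mono'
    (((hd.w_measurable t).norm.pow_const k).aestronglyMeasurable)
    (Filter.Eventually.of_forall fun ω => ?_)
  rw [Real.norm_of_nonneg (by positivity), Pi.add_apply]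
  rcases le_total ‖w t ω‖ 1 with h | h
  · have := pow_le_one₀ (n := k) (norm_nonneg _) h
    have : 0 ≤ ‖w t ω‖ ^ 4 := by positivity
    linarith
  · have := pow_le_pow_right₀ h hk
    linarith

end IsDisturbance

end Expectation

/-! ### The applied control as dropout part plus noise part -/

section Gain

variable {d m N κ : ℕ}

/-- The blocks `𝒮_l ℭ_l` that multiply the columns of `Λ`. -/
def maskLam (m N κ : ℕ) (ν : ℕ → ℝ) : Matrix (Fin N × Fin m) (LamIdx m N) ℝ :=
  Matrix.of fun q s => ((ν s.1 • maskS m N κ ν) * selC m N s.1) q s.2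

/-- The matrix that maps `Ξ` to the part of the applied control that does not depend on the
noise. -/
def gain (m N κ : ℕ) (ν : ℕ → ℝ) : Matrix (Fin N × Fin m) ((Fin N × Fin m) ⊕ LamIdx m N) ℝ :=
  Matrix.fromCols (maskS m N κ ν) (maskLam m N κ ν)

theorem continuous_maskS (m N κ : ℕ) : Continuous (maskS m N κ) := by
  refine Continuous.matrix_diagonal (continuous_pi fun q => ?_)
  split_ifs <;> fun_prop

theorem continuous_maskLam (m N κ : ℕ) : Continuous (maskLam m N κ) := by
  refine continuous_matrix fun q s => ?_
  have h : Continuous fun ν : ℕ → ℝ => (ν s.1 • maskS m N κ ν) * selC m N s.1 :=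
    ((continuous_apply _).smul (continuous_maskS m N κ)).matrix_mul continuous_const
  exact h.matrix_elem q s.2

theorem continuous_gain (m N κ : ℕ) : Continuous (gain m N κ) := by
  refine continuous_matrix fun q s => ?_
  rcases s with s | s
  · exact (continuous_maskS m N κ).matrix_elem q s
  · exact (continuous_maskLam m N κ).matrix_elem q s

/-- The product of the selection matrix with its transpose projects onto the block rows below `l`,
where a causal column of `Λ` is supported. -/
theorem selC_mulVec_transpose (l : Fin (N - 1)) (v : Fin N × Fin m → ℝ)
    (hv : ∀ (k : Fin N) (a : Fin m), (k : ℕ) ≤ l → v (k, a) = 0) :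
    selC m N l *ᵥ ((selC m N l)ᵀ *ᵥ v) = v := by
  ext ⟨k, a⟩
  have h1 : ∀ c : Fin (N - 1 - (l : ℕ)) × Fin m, ((selC m N l)ᵀ *ᵥ v) c
      = v (⟨l + 1 + c.1, by have := c.1.2; omega⟩, c.2) := by
    intro c
    simp only [Matrix.mulVec, dotProduct, Matrix.transpose_apply, selC, Matrix.of_apply]
    rw [Finset.sum_eq_single (⟨l + 1 + c.1, by have := c.1.2; omega⟩, c.2)]
    · simp
    · rintro ⟨k', a'⟩ _ hne
      rw [if_neg, zero_mul]
      rintro ⟨h, h'⟩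
      refine hne (Prod.ext (Fin.ext h) h')
    · simp
  simp only [Matrix.mulVec, dotProduct] at h1 ⊢
  simp only [h1]
  by_cases hk : (k : ℕ) ≤ l
  · rw [hv k a hk]
    refine Finset.sum_eq_zero fun c _ => ?_
    simp only [selC, Matrix.of_apply]
    rw [if_neg, zero_mul]
    rintro ⟨h, -⟩
    omega
  · rw [Finset.sum_eq_single (⟨k - (l + 1), by have := k.2; omega⟩, a)]
    · have h2 : (l : ℕ) + 1 + (k - (l + 1)) = k := by omega
      simp [selC, h2]
    · rintro ⟨k', a'⟩ _ hne
      simp only [selC, Matrix.of_apply]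
      rw [if_neg, zero_mul]
      rintro ⟨h, h'⟩
      refine hne (Prod.ext (Fin.ext ?_) h'.symm)
      change (k' : ℕ) = k - (l + 1)
      omega
    · simp

/-- Strict causality lets the reduced columns in `Ξ` recover `Λ`. The first summand depends on the
dropouts only; the second is linear in the saturated noise. -/
theorem applied_eq (κ : ℕ) (z : Decision d m N) (hz : Causal z) (e : Fin (N - 1) × Fin d → ℝ)
    (ν : ℕ → ℝ) : applied κ z e ν
      = gain m N κ ν *ᵥ xiVec z + (maskS m N κ ν * z.2.1) *ᵥ e := by
  have h1 : maskLam m N κ ν *ᵥ (fun s => ((selC m N s.1)ᵀ *ᵥ fun q => z.2.2 q s.1) s.2)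
      = maskS m N κ ν *ᵥ (z.2.2 *ᵥ dropStack N ν) := by
    have h2 : maskLam m N κ ν *ᵥ (fun s => ((selC m N s.1)ᵀ *ᵥ fun q => z.2.2 q s.1) s.2)
        = ∑ l : Fin (N - 1), (ν l • maskS m N κ ν) *ᵥ
          (selC m N l *ᵥ ((selC m N l)ᵀ *ᵥ fun q => z.2.2 q l)) := by
      ext q
      rw [Matrix.mulVec, dotProduct, Fintype.sum_sigma, Finset.sum_apply]
      refine Finset.sum_congr rfl fun l _ => ?_
      rw [Matrix.mulVec_mulVec _ (ν l • maskS m N κ ν)]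
      rfl
    have h3 : z.2.2 *ᵥ dropStack N ν = ∑ l : Fin (N - 1), ν l • fun q => z.2.2 q l := by
      ext q
      simp [Matrix.mulVec, dotProduct, dropStack, mul_comm]
    rw [h2, h3, Matrix.mulVec_sum]
    refine Finset.sum_congr rfl fun l _ => ?_
    rw [selC_mulVec_transpose l _ fun k a h => hz.2 k a l h, Matrix.smul_mulVec, Matrix.mulVec_smul]
  rw [applied, computed, Matrix.mulVec_add, Matrix.mulVec_add, gain, xiVec,
    Matrix.fromCols_mulVec_sumElim, h1, Matrix.mulVec_mulVec, add_right_comm]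

end Gain

theorem integral_add_of_eq {Ω : Type*} [MeasurableSpace Ω] {P : Measure Ω} {f g : Ω → ℝ} {a b : ℝ}
    (hf : Integrable f P ∧ ∫ ω, f ω ∂P = a) (hg : Integrable g P ∧ ∫ ω, g ω ∂P = b) :
    Integrable (fun ω => f ω + g ω) P ∧ ∫ ω, f ω + g ω ∂P = a + b :=
  ⟨hf.1.add hg.1, by rw [integral_add hf.1 hg.1, hf.2, hg.2]⟩

/-! ### The closed form of the objective -/

section Objective

variable {Ω : Type*} [MeasurableSpace Ω] {P : Measure Ω} [IsProbabilityMeasure P]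
  {d m N κ : ℕ} {p : ℝ} {ν : ℕ → Ω → ℝ} {w : ℕ → Ω → Fin d → ℝ} (S : Problem d m N κ)

theorem sigmaS_eq (t : ℕ) : S.sigmaS P ν t = expect P fun ω =>
    (maskS m N κ (shift ν t ω))ᵀ * S.alpha * maskS m N κ (shift ν t ω) := rfl

/-- The four blocks form one expected Gram matrix. Thus `⟨Ξ, ℒ Ξ⟩` is the mean of the `α`-form at
the dropout part of the control, which gives both the closed form and its nonnegativity. -/
theorem matL_eq (hd : IsDisturbance P p ν w) (t : ℕ) : S.matL P ν t = expect P fun ω =>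
    (gain m N κ (shift ν t ω))ᵀ * S.alpha * gain m N κ (shift ν t ω) := by
  have hS := continuous_maskS m N κ
  have hSl : ∀ l : Fin (N - 1), Continuous fun ν : ℕ → ℝ => ν l • maskS m N κ ν := fun l =>
    (continuous_apply _).smul hS
  have hT := continuous_maskLam m N κ
  have h12 : S.sigmaSSl P ν t = expect P fun ω =>
      (maskS m N κ (shift ν t ω))ᵀ * S.alpha * maskLam m N κ (shift ν t ω) := by
    ext q s
    have h := hd.expect_mul t (M := fun ν => (maskS m N κ ν)ᵀ * S.alpha *
      (ν s.1 • maskS m N κ ν)) (by have := hSl s.1; fun_prop) (selC m N s.1)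
    refine (congrFun (congrFun h q) s.2).trans ?_
    simp only [Matrix.mul_assoc]
    rfl
  have h22 : S.sigmaSnl P ν t = expect P fun ω =>
      (maskLam m N κ (shift ν t ω))ᵀ * S.alpha * maskLam m N κ (shift ν t ω) := by
    ext s s'
    have hc : Continuous fun ν : ℕ → ℝ => (ν s.1 • maskS m N κ ν)ᵀ * S.alpha *
      (ν s'.1 • maskS m N κ ν) := by
      have h1 := hSl s.1
      have h2 := hSl s'.1
      fun_prop
    have h := hd.mul_expect t hc (selC m N s.1)ᵀ
    have h' := hd.expect_mul t (M := fun ν => (selC m N s.1)ᵀ * ((ν s.1 • maskS m N κ ν)ᵀ * S.alpha *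
      (ν s'.1 • maskS m N κ ν))) (continuous_const.matrix_mul hc) (selC m N s'.1)
    rw [← h] at h'
    refine (congrFun (congrFun h' s.2) s'.2).trans ?_
    change ∫ ω, _ ∂P = ∫ ω, _ ∂P
    congr 1
    ext ω
    have h3 : (selC m N s.1)ᵀ * ((shift ν t ω s.1 • maskS m N κ (shift ν t ω))ᵀ * S.alpha *
        (shift ν t ω s'.1 • maskS m N κ (shift ν t ω))) * selC m N s'.1
        = ((shift ν t ω s.1 • maskS m N κ (shift ν t ω)) * selC m N s.1)ᵀ * S.alpha *
          ((shift ν t ω s'.1 • maskS m N κ (shift ν t ω)) * selC m N s'.1) := by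
      rw [Matrix.transpose_mul]; simp only [Matrix.mul_assoc]
    exact congrFun (congrFun h3 s.2) s'.2
  have h21 : (S.sigmaSSl P ν t)ᵀ = expect P fun ω =>
      (maskLam m N κ (shift ν t ω))ᵀ * S.alpha * maskS m N κ (shift ν t ω) := by
    rw [h12]
    ext s q
    change ∫ ω, _ ∂P = ∫ ω, _ ∂P
    congr 1
    ext ω
    have h3 : (maskLam m N κ (shift ν t ω))ᵀ * S.alpha * maskS m N κ (shift ν t ω)
        = ((maskS m N κ (shift ν t ω))ᵀ * S.alpha * maskLam m N κ (shift ν t ω))ᵀ := by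
      rw [Matrix.transpose_mul, Matrix.transpose_mul, Matrix.transpose_transpose, alpha_transpose,
        Matrix.mul_assoc]
    exact (congrFun (congrFun h3 s) q).symm
  have hG : ∀ ω, (gain m N κ (shift ν t ω))ᵀ * S.alpha * gain m N κ (shift ν t ω)
      = Matrix.fromBlocks
        ((maskS m N κ (shift ν t ω))ᵀ * S.alpha * maskS m N κ (shift ν t ω))
        ((maskS m N κ (shift ν t ω))ᵀ * S.alpha * maskLam m N κ (shift ν t ω))
        ((maskLam m N κ (shift ν t ω))ᵀ * S.alpha * maskS m N κ (shift ν t ω))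
        ((maskLam m N κ (shift ν t ω))ᵀ * S.alpha * maskLam m N κ (shift ν t ω)) := by
    intro ω
    rw [gain, Matrix.transpose_fromCols, Matrix.fromRows_mul, Matrix.fromRows_mul_fromCols]
  simp only [hG]
  rw [Problem.matL, h21, h12, h22, sigmaS_eq]
  ext i j
  rcases i with i | i <;> rcases j with j | j <;> rfl

theorem matM_eq (hd : IsDisturbance P p ν w) (t : ℕ) : S.matM P ν t
    = (2 : ℝ) • (S.stackQ * S.stackB * expect P fun ω => gain m N κ (shift ν t ω))ᵀ := by
  have h2 : muSl P ν t m N κ = expect P fun ω => maskLam m N κ (shift ν t ω) := by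
    ext q s
    have h := hd.expect_mul t (M := fun ν => ν s.1 • maskS m N κ ν)
      ((continuous_apply _).smul (continuous_maskS m N κ)) (selC m N s.1)
    exact congrFun (congrFun h q) s.2
  have h3 : (expect P fun ω => gain m N κ (shift ν t ω))
      = Matrix.fromCols (muS P ν t m N κ) (expect P fun ω => maskLam m N κ (shift ν t ω)) := by
    ext i j
    rcases j with j | j <;> rfl
  rw [Problem.matM, h2, h3, Matrix.mul_fromCols]

theorem measurable_satStack (q : Fin (N - 1) × Fin d) :
    Measurable fun s : ℕ → Fin d → ℝ => S.satStack s q :=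
  (measurable_pi_apply q.2).comp ((S.sat_measurable q.1).comp (measurable_pi_apply _))

theorem measurable_noiseStack (q : Fin N × Fin d) :
    Measurable fun s : ℕ → Fin d → ℝ => noiseStack N s q :=
  (measurable_pi_apply q.2).comp (measurable_pi_apply _)

theorem abs_satStack_le (s : ℕ → Fin d → ℝ) (q : Fin (N - 1) × Fin d) :
    |S.satStack s q| ≤ S.satBound :=
  (norm_le_pi_norm (S.sat q.1 (s q.1)) q.2).trans (S.sat_le _ _)

namespace IsDisturbance

variable (hd : IsDisturbance P p ν w) (t : ℕ)
include hd

theorem integrable_noise (q : Fin N × Fin d) :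
    Integrable (fun ω => noiseStack N (shift w t ω) q) P := by
  refine (hd.integrable_norm_pow (t + q.1) (k := 1) (by norm_num)).mono'
    ((measurable_noiseStack q).comp (measurable_shift hd.w_measurable t)).aestronglyMeasurable
    (Filter.Eventually.of_forall fun ω => ?_)
  rw [pow_one]
  exact norm_le_pi_norm (w (t + q.1) ω) q.2

theorem integrable_sat (q : Fin (N - 1) × Fin d) :
    Integrable (fun ω => S.satStack (shift w t ω) q) P :=
  Integrable.of_bound
    ((measurable_satStack S q).comp (measurable_shift hd.w_measurable t)).aestronglyMeasurable
    S.satBound (Filter.Eventually.of_forall fun _ => abs_satStack_le S _ q)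

theorem integral_noise (q : Fin N × Fin d) : ∫ ω, noiseStack N (shift w t ω) q ∂P = 0 :=
  hd.integral_odd (E := ℝ) (t + q.1) (h := fun v => v q.2) (measurable_pi_apply _) fun _ => rfl

theorem integral_sat (q : Fin (N - 1) × Fin d) : ∫ ω, S.satStack (shift w t ω) q ∂P = 0 :=
  hd.integral_odd (E := ℝ) (t + q.1) (h := fun v => S.sat q.1 v q.2)
    ((measurable_pi_apply _).comp (S.sat_measurable _)) fun v => by rw [S.sat_odd]; rfl

theorem integrable_mul_sat {g : (ℕ → Fin d → ℝ) → ℝ} (hg : Integrable (fun ω => g (shift w t ω)) P)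
    (q : Fin (N - 1) × Fin d) :
    Integrable (fun ω => g (shift w t ω) * S.satStack (shift w t ω) q) P :=
  hg.mul_bdd (c := S.satBound)
    ((measurable_satStack S q).comp (measurable_shift hd.w_measurable t)).aestronglyMeasurable
    (Filter.Eventually.of_forall fun _ => abs_satStack_le S _ q)

theorem integrable_noise_mul (q q' : Fin N × Fin d) :
    Integrable (fun ω => noiseStack N (shift w t ω) q * noiseStack N (shift w t ω) q') P := by
  refine (((hd.integrable_norm_pow (t + q.1) (k := 2) (by norm_num)).add
    (hd.integrable_norm_pow (t + q'.1) (k := 2) (by norm_num)))).mono'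
    (((measurable_noiseStack q).mul (measurable_noiseStack q')).comp
      (measurable_shift hd.w_measurable t)).aestronglyMeasurable
    (Filter.Eventually.of_forall fun ω => ?_)
  have h1 : ‖noiseStack N (shift w t ω) q‖ ≤ ‖w (t + q.1) ω‖ := norm_le_pi_norm (w (t + q.1) ω) q.2
  have h2 : ‖noiseStack N (shift w t ω) q'‖ ≤ ‖w (t + q'.1) ω‖ :=
    norm_le_pi_norm (w (t + q'.1) ω) q'.2
  rw [norm_mul, Pi.add_apply]
  have h3 := mul_le_mul h1 h2 (norm_nonneg _) (norm_nonneg _)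
  nlinarith [sq_nonneg (‖w (t + q.1) ω‖ - ‖w (t + q'.1) ω‖), sq_nonneg ‖w (t + q.1) ω‖,
    sq_nonneg ‖w (t + q'.1) ω‖]

theorem expect_conj_alpha (Θ : Matrix (Fin N × Fin m) (Fin (N - 1) × Fin d) ℝ) :
    (expect P fun ω => (maskS m N κ (shift ν t ω) * Θ)ᵀ * S.alpha
      * (maskS m N κ (shift ν t ω) * Θ)) = Θᵀ * S.sigmaS P ν t * Θ := by
  have hS := continuous_maskS m N κ
  have hc : Continuous fun ν : ℕ → ℝ => (maskS m N κ ν)ᵀ * S.alpha * maskS m N κ ν := by fun_prop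
  rw [sigmaS_eq, hd.mul_expect t hc, hd.expect_mul t (continuous_const.matrix_mul hc)]
  simp only [Matrix.transpose_mul, Matrix.mul_assoc]

/-- The integrability of the cost and the closed form of its expectation. -/
theorem integrable_randomCost_and_objective_eq (x : Fin d → ℝ) (z : Decision d m N) (hz : Causal z) :
    Integrable (S.randomCost ν w t x z) P ∧
      S.ocpObjective P ν w t x z = S.qpObjective P ν w t x z := by
  have hS := continuous_maskS m N κ
  have hG := continuous_gain m N κ
  set Ξ := xiVec z with hΞ
  set a := S.stackA *ᵥ x with ha
  have hcost : ∀ ω, S.randomCost ν w t x z ω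
      = Ξ ⬝ᵥ ((gain m N κ (shift ν t ω))ᵀ * S.alpha * gain m N κ (shift ν t ω)) *ᵥ Ξ
        + 2 * ((S.stackQ *ᵥ a) ⬝ᵥ (S.stackB * gain m N κ (shift ν t ω)) *ᵥ Ξ)
        + a ⬝ᵥ S.stackQ *ᵥ a
        + 2 * (S.satStack (shift w t ω) ⬝ᵥ ((maskS m N κ (shift ν t ω) * z.2.1)ᵀ * S.stackBᵀ
          * S.stackQ * S.stackD) *ᵥ noiseStack N (shift w t ω))
        + noiseStack N (shift w t ω) ⬝ᵥ (S.stackDᵀ * S.stackQ * S.stackD) *ᵥ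
          noiseStack N (shift w t ω)
        + S.satStack (shift w t ω) ⬝ᵥ ((maskS m N κ (shift ν t ω) * z.2.1)ᵀ * S.alpha
          * (maskS m N κ (shift ν t ω) * z.2.1)) *ᵥ S.satStack (shift w t ω)
        + ((2 : ℝ) • ((maskS m N κ (shift ν t ω) * z.2.1)ᵀ *ᵥ (S.alpha *ᵥ
          (gain m N κ (shift ν t ω) *ᵥ Ξ) + S.stackBᵀ *ᵥ (S.stackQ *ᵥ a))))
          ⬝ᵥ S.satStack (shift w t ω)
        + ((2 : ℝ) • (S.stackDᵀ *ᵥ (S.stackQ *ᵥ (a + S.stackB *ᵥ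
          (gain m N κ (shift ν t ω) *ᵥ Ξ))))) ⬝ᵥ noiseStack N (shift w t ω) := by
    intro ω
    have h := cost_expand S x (gain m N κ (shift ν t ω) *ᵥ Ξ) (maskS m N κ (shift ν t ω) * z.2.1)
      (S.satStack (shift w t ω)) (shift w t ω)
    rw [← applied_eq κ z hz] at h
    refine h.trans ?_
    simp only [← Matrix.mulVec_mulVec, dotProduct_transpose_mulVec_eq]
    rw [ha]
  have hsat := fun q => measurable_satStack S q
  have hnoise := fun q => measurable_noiseStack (d := d) (N := N) q
  have hwe : ∀ (i : Fin (N - 1) × Fin d) (j : Fin N × Fin d), Integrable (fun ω =>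
      noiseStack N (shift w t ω) j * S.satStack (shift w t ω) i) P := fun i j =>
    hd.integrable_mul_sat S t (g := fun s => noiseStack N s j) (hd.integrable_noise t j) i
  have hee : ∀ i j : Fin (N - 1) × Fin d, Integrable (fun ω =>
      S.satStack (shift w t ω) j * S.satStack (shift w t ω) i) P := fun i j =>
    hd.integrable_mul_sat S t (g := fun s => S.satStack s j) (hd.integrable_sat S t j) i
  have hK : Continuous fun ν : ℕ → ℝ => maskS m N κ ν * z.2.1 := hS.matrix_mul continuous_const
  have c1 : Continuous fun ν : ℕ → ℝ => (gain m N κ ν)ᵀ * S.alpha * gain m N κ ν := by fun_prop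
  have c2 : Continuous fun ν : ℕ → ℝ => S.stackB * gain m N κ ν := by fun_prop
  have c4 : Continuous fun ν : ℕ → ℝ => (maskS m N κ ν * z.2.1)ᵀ * S.stackBᵀ
    * S.stackQ * S.stackD := by fun_prop
  have c6 : Continuous fun ν : ℕ → ℝ => (maskS m N κ ν * z.2.1)ᵀ * S.alpha
    * (maskS m N κ ν * z.2.1) := by fun_prop
  have c7 : Continuous fun ν : ℕ → ℝ => (2 : ℝ) • ((maskS m N κ ν * z.2.1)ᵀ *ᵥ (S.alpha *ᵥ
    (gain m N κ ν *ᵥ Ξ) + S.stackBᵀ *ᵥ (S.stackQ *ᵥ a))) := by fun_prop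
  have c8 : Continuous fun ν : ℕ → ℝ => (2 : ℝ) • (S.stackDᵀ *ᵥ (S.stackQ *ᵥ (a + S.stackB *ᵥ
    (gain m N κ ν *ᵥ Ξ)))) := by fun_prop
  have i1 := hd.integrable_dropout t (f := fun ν => Ξ ⬝ᵥ ((gain m N κ ν)ᵀ * S.alpha *
    gain m N κ ν) *ᵥ Ξ) (by fun_prop)
  have i2 := hd.integrable_dropout t (f := fun ν => 2 * ((S.stackQ *ᵥ a) ⬝ᵥ
    (S.stackB * gain m N κ ν) *ᵥ Ξ)) (by fun_prop)
  have i3 := integrable_const (μ := P) (a ⬝ᵥ S.stackQ *ᵥ a)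
  have i4 := (hd.integrable_bilin t c4 hsat hnoise hwe).const_mul 2
  have i5 := hd.integrable_bilin t (continuous_const (y := S.stackDᵀ * S.stackQ * S.stackD))
    hnoise hnoise fun i j => hd.integrable_noise_mul t j i
  have i6 := hd.integrable_bilin t c6 hsat hsat hee
  have i7 := hd.integrable_dot t c7 hsat (hd.integrable_sat S t)
  have i8 := hd.integrable_dot t c8 hnoise (hd.integrable_noise t)
  have e1 := hd.integral_dotProduct_mulVec t c1 Ξ Ξ
  have e2 := hd.integral_dotProduct_mulVec t c2 (S.stackQ *ᵥ a) Ξ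
  have e4 := hd.integral_bilin t c4 hsat hnoise hwe
  have e5 := hd.integral_bilin t (continuous_const (y := S.stackDᵀ * S.stackQ * S.stackD))
    hnoise hnoise fun i j => hd.integrable_noise_mul t j i
  have e6 := hd.integral_bilin t c6 hsat hsat hee
  -- The coefficients of the terms linear in the noise depend on the dropouts only, while the noise
  -- and its odd saturation have mean zero.
  have e7 := hd.integral_dot_eq_zero t c7 hsat (hd.integrable_sat S t) (hd.integral_sat S t)
  have e8 := hd.integral_dot_eq_zero t c8 hnoise (hd.integrable_noise t) (hd.integral_noise t)
  have hsum := integral_add_of_eq (integral_add_of_eq (integral_add_of_eq (integral_add_of_eq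
    (integral_add_of_eq (integral_add_of_eq (integral_add_of_eq ⟨i1, e1⟩
    ⟨i2, (integral_const_mul _ _).trans (congrArg _ e2)⟩) ⟨i3, rfl⟩)
    ⟨i4, (integral_const_mul _ _).trans (congrArg _ e4)⟩) ⟨i5, e5⟩) ⟨i6, e6⟩) ⟨i7, e7⟩) ⟨i8, e8⟩
  simp only [← hcost] at hsum
  refine ⟨hsum.1, ?_⟩
  rw [Problem.ocpObjective, hsum.2]
  have k2 : (S.matM P ν t *ᵥ a) ⬝ᵥ Ξ
      = 2 * ((S.stackQ *ᵥ a) ⬝ᵥ (expect P fun ω => S.stackB * gain m N κ (shift ν t ω)) *ᵥ Ξ) := by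
    rw [matM_eq S hd, Matrix.mul_assoc, hd.mul_expect t hG, Matrix.smul_mulVec, smul_dotProduct,
      dotProduct_comm _ Ξ, dotProduct_transpose_mulVec_eq, ← Matrix.mulVec_mulVec,
      dotProduct_comm _ a, ← dotProduct_transpose_mulVec_eq S.stackQ, stackQ_transpose, smul_eq_mul]
  have k4 : (expect P fun ω => (maskS m N κ (shift ν t ω) * z.2.1)ᵀ * S.stackBᵀ
      * S.stackQ * S.stackD)
      = z.2.1ᵀ * (muS P ν t m N κ)ᵀ * S.stackBᵀ * S.stackQ * S.stackD := by
    have hT : (muS P ν t m N κ)ᵀ = expect P fun ω => (maskS m N κ (shift ν t ω))ᵀ := rfl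
    rw [hT, hd.mul_expect t hS.matrix_transpose, Matrix.mul_assoc _ S.stackBᵀ,
      Matrix.mul_assoc _ _ S.stackD, hd.expect_mul t (continuous_const.matrix_mul hS.matrix_transpose)]
    simp only [Matrix.transpose_mul, Matrix.mul_assoc]
  have k5 : (expect P fun _ : Ω => S.stackDᵀ * S.stackQ * S.stackD)
      = S.stackDᵀ * S.stackQ * S.stackD := by
    ext i j
    simp [expect]
  rw [k4, k5, hd.expect_conj_alpha S t, ← k2, ← matL_eq S hd]
  simp only [integral_const, probReal_univ, one_smul, add_zero]
  rfl

end IsDisturbance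

end Objective

/-! ### Convexity and continuity of the quadratic program -/

section Program

/-- The gap between the two sides is `a * b * q (x - y)`. -/
theorem _root_.QuadraticForm.map_convexCombination_le {V : Type*} [AddCommGroup V] [Module ℝ V]
    (q : QuadraticForm ℝ V) (hq : ∀ z, 0 ≤ q z) (x y : V) {a b : ℝ} (ha : 0 ≤ a) (hb : 0 ≤ b)
    (hab : a + b = 1) : q (a • x + b • y) ≤ a * q x + b * q y := by
  have h1 := hq (x + (-1 : ℝ) • y)
  rw [QuadraticMap.map_add (⇑q), QuadraticMap.map_smul, QuadraticMap.polar_smul_right] at h1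
  rw [QuadraticMap.map_add (⇑q), QuadraticMap.map_smul, QuadraticMap.map_smul,
    QuadraticMap.polar_smul_right, QuadraticMap.polar_smul_left]
  simp only [smul_eq_mul] at h1 ⊢
  obtain rfl : b = 1 - a := by linarith
  nlinarith [mul_nonneg (mul_nonneg ha hb) h1]

variable {Ω : Type*} [MeasurableSpace Ω] (P : Measure Ω) [IsProbabilityMeasure P]
  {d m N κ : ℕ} {p : ℝ} (ν : ℕ → Ω → ℝ) (w : ℕ → Ω → Fin d → ℝ) (S : Problem d m N κ) (t : ℕ)

theorem xiVec_add (z z' : Decision d m N) : xiVec (z + z') = xiVec z + xiVec z' := by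
  ext i
  rcases i with i | i
  · rfl
  · simp [xiVec, Matrix.mulVec, dotProduct, mul_add, Finset.sum_add_distrib]

theorem xiVec_smul (c : ℝ) (z : Decision d m N) : xiVec (c • z) = c • xiVec z := by
  ext i
  rcases i with i | i
  · rfl
  · simp [xiVec, Matrix.mulVec, dotProduct, Finset.mul_sum, mul_left_comm]

/-- The quadratic part of the objective. -/
noncomputable def Problem.qpQuad : QuadraticForm ℝ (Decision d m N) :=
  LinearMap.BilinMap.toQuadraticMap <| LinearMap.mk₂ ℝ
    (fun z z' => xiVec z ⬝ᵥ S.matL P ν t *ᵥ xiVec z'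
      + Matrix.trace (z.2.1ᵀ * S.sigmaS P ν t * z'.2.1 * S.sigmaE P w t))
    (fun z₁ z₂ z' => by
      simp only [xiVec_add, Prod.snd_add, Prod.fst_add, add_dotProduct, Matrix.transpose_add,
        Matrix.add_mul, Matrix.trace_add]
      ring)
    (fun c z z' => by
      simp only [xiVec_smul, Prod.smul_snd, Prod.smul_fst, smul_dotProduct, Matrix.transpose_smul,
        Matrix.smul_mul, Matrix.trace_smul, smul_add])
    (fun z z₁ z₂ => by
      simp only [xiVec_add, Prod.snd_add, Prod.fst_add, dotProduct_add, Matrix.mulVec_add,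
        Matrix.mul_add, Matrix.add_mul, Matrix.trace_add]
      ring)
    (fun c z z' => by
      simp only [xiVec_smul, Prod.smul_snd, Prod.smul_fst, dotProduct_smul, Matrix.mulVec_smul,
        Matrix.smul_mul, Matrix.mul_smul, Matrix.trace_smul, smul_add])

theorem qpQuad_apply (z : Decision d m N) : S.qpQuad P ν w t z
    = xiVec z ⬝ᵥ S.matL P ν t *ᵥ xiVec z
      + Matrix.trace (z.2.1ᵀ * S.sigmaS P ν t * z.2.1 * S.sigmaE P w t) := rfl

/-- The linear part of the objective. -/
noncomputable def Problem.qpLin (x : Fin d → ℝ) : Decision d m N →ₗ[ℝ] ℝ where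
  toFun z := (S.matM P ν t *ᵥ (S.stackA *ᵥ x)) ⬝ᵥ xiVec z
    + 2 * Matrix.trace (z.2.1ᵀ * (muS P ν t m N κ)ᵀ * S.stackBᵀ * S.stackQ * S.stackD
        * S.sigmaWE P w t)
  map_add' z z' := by
    simp only [xiVec_add, Prod.snd_add, Prod.fst_add, dotProduct_add, Matrix.transpose_add,
      Matrix.add_mul, Matrix.trace_add]
    ring
  map_smul' c z := by
    simp only [xiVec_smul, Prod.smul_snd, Prod.smul_fst, dotProduct_smul, Matrix.transpose_smul,
      Matrix.smul_mul, Matrix.trace_smul, smul_eq_mul, RingHom.id_apply]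
    ring

theorem qpObjective_eq (x : Fin d → ℝ) (z : Decision d m N) : S.qpObjective P ν w t x z
    = S.qpQuad P ν w t z + S.qpLin P ν w t x z
      + ((S.stackA *ᵥ x) ⬝ᵥ S.stackQ *ᵥ (S.stackA *ᵥ x)
        + Matrix.trace (S.stackDᵀ * S.stackQ * S.stackD * sigmaW P w t N)) + S.reg * sparsity z := by
  rw [qpQuad_apply]
  simp only [Problem.qpObjective, Problem.qpLin, LinearMap.coe_mk, AddHom.coe_mk]
  ring

variable {P ν w}

/-- Both summands are expectations of the nonnegative form `α`, at the dropout part and at the noise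
part of the control. -/
theorem qpQuad_nonneg (hd : IsDisturbance P p ν w) (z : Decision d m N) :
    0 ≤ S.qpQuad P ν w t z := by
  have hS := continuous_maskS m N κ
  have hG := continuous_gain m N κ
  rw [qpQuad_apply, matL_eq S hd, ← hd.integral_dotProduct_mulVec t
    (M := fun ν => (gain m N κ ν)ᵀ * S.alpha * gain m N κ ν) (by fun_prop)]
  have h2 := hd.integral_bilin t (M := fun ν => (maskS m N κ ν * z.2.1)ᵀ * S.alpha
      * (maskS m N κ ν * z.2.1)) (by fun_prop)
      (fun q => measurable_satStack S q) (fun q => measurable_satStack S q)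
      fun i j => hd.integrable_mul_sat S t (g := fun s => S.satStack s j) (hd.integrable_sat S t j) i
  rw [hd.expect_conj_alpha S t] at h2
  refine add_nonneg (integral_nonneg fun ω => ?_) (le_trans (integral_nonneg fun ω => ?_) h2.le)
  · simp only [← Matrix.mulVec_mulVec, dotProduct_transpose_mulVec_eq]
    exact alpha_nonneg S _
  · simp only [Pi.zero_apply]
    rw [← Matrix.mulVec_mulVec, ← Matrix.mulVec_mulVec, dotProduct_transpose_mulVec_eq]
    exact alpha_nonneg S _

theorem isConvexQP_qp (hd : IsDisturbance P p ν w) {dO dS : ℕ} (D : OrthSchurDecomp S.A dO dS)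
    (r ε ζ : ℝ) (x : Fin d → ℝ) :
    IsConvexQP (S.qpFeasible D p r ε ζ x) (S.qpObjective P ν w t x) :=
  (isPolyhedron_patternFeasible S D p ζ _ _).isConvexQP (S.qpQuad P ν w t) (qpQuad_nonneg S t hd)
    (S.qpLin P ν w t x) _
    (fun k (q : Fin m × (Unit ⊕ (Fin (N - 1) × Fin d) ⊕ Fin (N - 1))) => matFLin (k, q.1) q.2)
    S.reg_nonneg fun z _ => by rw [qpObjective_eq, sparsity_eq]

theorem convexOn_qpObjective (hd : IsDisturbance P p ν w) (x : Fin d → ℝ) :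
    ConvexOn ℝ Set.univ (S.qpObjective P ν w t x) := by
  refine ⟨convex_univ, fun z _ z' _ a b ha hb hab => ?_⟩
  have h1 := (S.qpQuad P ν w t).map_convexCombination_le (qpQuad_nonneg S t hd) z z' ha hb hab
  have h2 := (convexOn_sparsity (d := d) (m := m) (N := N)).2 (Set.mem_univ z) (Set.mem_univ z')
    ha hb hab
  have h3 := mul_le_mul_of_nonneg_left h2 S.reg_nonneg
  simp only [qpObjective_eq, map_add, map_smul, smul_eq_mul] at *
  obtain rfl : b = 1 - a := by linarith
  linarith

theorem continuous_xiVec : Continuous (xiVec : Decision d m N → _) := by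
  refine continuous_pi fun i => ?_
  rcases i with i | i
  · exact (continuous_apply i).comp continuous_fst
  · simp only [xiVec, Sum.elim_inr]
    refine (continuous_apply i.2).comp (Continuous.matrix_mulVec continuous_const ?_)
    exact continuous_pi fun q => (continuous_snd.comp continuous_snd).matrix_elem q i.1

theorem continuous_sparsity : Continuous (sparsity : Decision d m N → ℝ) := by
  unfold sparsity
  refine continuous_finsetSum _ fun k _ => (continuous_pi fun q => ?_).norm
  exact (matFLin (d := d) (k, q.1) q.2).continuous_of_finiteDimensional

theorem continuous_qpObjective :
    Continuous fun y : (Fin d → ℝ) × Decision d m N => S.qpObjective P ν w t y.1 y.2 := by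
  have h1 := continuous_xiVec (d := d) (m := m) (N := N)
  have h2 := continuous_sparsity (d := d) (m := m) (N := N)
  unfold Problem.qpObjective
  fun_prop

end Program

/-! ### Measurable selection of minimizers -/

section Selection

/-- A Borel selection of minimizers of a jointly continuous convex function over a compact convex
set: the minimizer with the least value of a strictly convex function. -/
theorem exists_measurable_argmin {X E : Type*} [TopologicalSpace X] [SecondCountableTopology X]
    [MeasurableSpace X] [BorelSpace X] [TopologicalSpace E] [AddCommGroup E] [Module ℝ E]
    {K : Set E} (hK : IsCompact K) (hne : K.Nonempty) {J : X → E → ℝ}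
    (hJ : Continuous fun y : X × E => J y.1 y.2) (hJc : ∀ x, ConvexOn ℝ K (J x))
    {h : E → ℝ} (hh : Continuous h) (hconv : StrictConvexOn ℝ K h) :
    ∃ s : X → E, (∀ x, s x ∈ K ∧ ∀ z ∈ K, J x (s x) ≤ J x z) ∧
      ∀ g : E → ℝ, Continuous g → Measurable fun x => g (s x) := by
  have hJx : ∀ x, Continuous (J x) := fun x => hJ.comp (Continuous.prodMk_right x)
  let M : X → Set E := fun x => K ∩ {z | ∀ z' ∈ K, J x z ≤ J x z'}
  have hMc : ∀ x, IsCompact (M x) := by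
    intro x
    refine hK.inter_right ?_
    simp only [Set.ofPred_forall]
    exact isClosed_iInter fun z' => isClosed_iInter fun _ => isClosed_le (hJx x) continuous_const
  have hMne : ∀ x, (M x).Nonempty := by
    intro x
    obtain ⟨z, hz, hmin⟩ := hK.exists_isMinOn hne (hJx x).continuousOn
    exact ⟨z, hz, fun z' hz' => hmin hz'⟩
  have hMconv : ∀ x, Convex ℝ (M x) := by
    intro x z hz z' hz' a b ha hb hab
    refine ⟨hconv.1 hz.1 hz'.1 ha hb hab, fun y hy => ?_⟩
    refine ((hJc x).2 hz.1 hz'.1 ha hb hab).trans ?_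
    have h1 := mul_le_mul_of_nonneg_left (hz.2 y hy) ha
    have h2 := mul_le_mul_of_nonneg_left (hz'.2 y hy) hb
    simp only [smul_eq_mul]
    calc _ ≤ a * J x y + b * J x y := add_le_add h1 h2
      _ = J x y := by rw [← add_mul, hab, one_mul]
  have hs : ∀ x, ∃ z ∈ M x, IsMinOn h (M x) z := fun x =>
    (hMc x).exists_isMinOn (hMne x) hh.continuousOn
  choose s hsM hsmin using hs
  have huniq : ∀ x, ∀ z ∈ M x, h z ≤ h (s x) → z = s x := by
    intro x z hz hle
    refine ((hconv.subset Set.inter_subset_left (hMconv x)).eq_of_isMinOn ?_ (hsmin x) hz (hsM x))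
    exact fun y hy => hle.trans (hsmin x hy)
  -- The set is the projection of a closed set along the compact factor `K`, and such projections
  -- are closed maps.
  have hclosed : ∀ C : Set E, IsClosed C →
      IsClosed {y : X × ℝ | ∃ z ∈ M y.1, z ∈ C ∧ h z ≤ y.2} := by
    intro C hC
    have : CompactSpace K := isCompact_iff_compactSpace.mp hK
    have hcl : IsClosed {q : (X × ℝ) × K | (∀ z' ∈ K, J q.1.1 q.2 ≤ J q.1.1 z') ∧
        (q.2 : E) ∈ C ∧ h q.2 ≤ q.1.2} := by
      have h1 : IsClosed {q : (X × ℝ) × K | ∀ z' ∈ K, J q.1.1 q.2 ≤ J q.1.1 z'} := by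
        simp only [Set.ofPred_forall]
        refine isClosed_iInter fun z' => isClosed_iInter fun _ => isClosed_le ?_ ?_
        · exact hJ.comp (f := fun q : (X × ℝ) × K => (q.1.1, (q.2 : E))) (by fun_prop)
        · exact hJ.comp (f := fun q : (X × ℝ) × K => (q.1.1, z')) (by fun_prop)
      have h2 : IsClosed {q : (X × ℝ) × K | (q.2 : E) ∈ C} :=
        hC.preimage (f := fun q : (X × ℝ) × K => (q.2 : E)) (by fun_prop)
      have h3 : IsClosed {q : (X × ℝ) × K | h q.2 ≤ q.1.2} :=
        isClosed_le (f := fun q : (X × ℝ) × K => h q.2) (g := fun q => q.1.2)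
          (by fun_prop) (by fun_prop)
      exact h1.inter (h2.inter h3)
    convert! isClosedMap_fst_of_compactSpace _ hcl using 1
    ext y
    constructor
    · rintro ⟨z, hz, hzC, hzh⟩
      exact ⟨(y, ⟨z, hz.1⟩), ⟨hz.2, hzC, hzh⟩, rfl⟩
    · rintro ⟨⟨y', z⟩, ⟨h1, h2, h3⟩, rfl⟩
      exact ⟨z, ⟨z.2, h1⟩, h2, h3⟩
  -- With `C` the whole space, the sublevel sets of the optimal secondary value are closed.
  have hρ : Measurable fun x => h (s x) := by
    refine measurable_of_Iic fun a => ?_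
    have : (fun x => h (s x)) ⁻¹' Set.Iic a
        = (fun x => (x, a)) ⁻¹' {y : X × ℝ | ∃ z ∈ M y.1, z ∈ (Set.univ : Set E) ∧ h z ≤ y.2} := by
      ext x
      constructor
      · intro hx
        exact ⟨s x, hsM x, trivial, hx⟩
      · rintro ⟨z, hz, -, hza⟩
        exact (hsmin x hz).trans hza
    rw [this]
    exact ((hclosed _ isClosed_univ).preimage (by fun_prop)).measurableSet
  refine ⟨s, fun x => hsM x, fun g hg => measurable_of_isClosed fun C hC => ?_⟩
  -- A minimizer with secondary value at most `h (s x)` is `s x` itself, so membership of `s x` in a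
  -- closed set is a closed condition on the pair `(x, h (s x))`.
  have : (fun x => g (s x)) ⁻¹' C
      = (fun x => (x, h (s x))) ⁻¹' {y : X × ℝ | ∃ z ∈ M y.1, z ∈ g ⁻¹' C ∧ h z ≤ y.2} := by
    ext x
    constructor
    · intro hx
      exact ⟨s x, hsM x, hx, le_rfl⟩
    · rintro ⟨z, hz, hzC, hza⟩
      have := huniq x z hz hza
      rw [this] at hzC
      exact hzC
  rw [this]
  exact (measurable_id.prodMk hρ) (hclosed _ (hC.preimage hg)).measurableSet

theorem strictConvexOn_sum_sq {V ι : Type*} [AddCommGroup V] [Module ℝ V] [Fintype ι]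
    (l : ι → V →ₗ[ℝ] ℝ) (hl : ∀ z, (∀ i, l i z = 0) → z = 0) :
    StrictConvexOn ℝ Set.univ fun z => ∑ i, l i z ^ 2 := by
  refine ⟨convex_univ, fun z _ z' _ hne a b ha hb hab => ?_⟩
  have h1 : ∃ i, l i (z - z') ≠ 0 := by
    by_contra! h
    exact hne (sub_eq_zero.mp (hl _ h))
  obtain ⟨i, hi⟩ := h1
  simp only [map_add, map_smul, smul_eq_mul, Finset.mul_sum, ← Finset.sum_add_distrib]
  obtain rfl : b = 1 - a := by linarith
  have h2 : ∀ j, (a * l j z + (1 - a) * l j z') ^ 2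
      = a * l j z ^ 2 + (1 - a) * l j z' ^ 2 - a * (1 - a) * (l j (z - z')) ^ 2 := by
    intro j
    rw [map_sub]; ring
  refine Finset.sum_lt_sum (fun j _ => ?_) ⟨i, Finset.mem_univ i, ?_⟩
  · rw [h2]
    have := mul_nonneg (mul_pos ha hb).le (sq_nonneg (l j (z - z')))
    linarith
  · rw [h2]
    have := mul_pos (mul_pos ha hb) (by positivity : 0 < (l i (z - z')) ^ 2)
    linarith

end Selection

/-! ### Borel optimal policies -/

section Policy

variable {Ω : Type*} [MeasurableSpace Ω] {P : Measure Ω} [IsProbabilityMeasure P]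
  {d m N κ : ℕ} {p : ℝ} {ν : ℕ → Ω → ℝ} {w : ℕ → Ω → Fin d → ℝ} (S : Problem d m N κ)

/-- The sum of the squares of all entries of a decision. -/
def sumSq (z : Decision d m N) : ℝ :=
  ∑ i : (Fin N × Fin m) × (Unit ⊕ (Fin (N - 1) × Fin d) ⊕ Fin (N - 1)), matFLin i.1 i.2 z ^ 2

theorem strictConvexOn_sumSq : StrictConvexOn ℝ Set.univ (sumSq : Decision d m N → ℝ) := by
  refine strictConvexOn_sum_sq _ fun z h => ?_
  refine Prod.ext ?_ (Prod.ext ?_ ?_)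
  · ext q; exact h (q, Sum.inl ())
  · ext q c; exact h (q, Sum.inr (Sum.inl c))
  · ext q c; exact h (q, Sum.inr (Sum.inr c))

theorem continuous_sumSq : Continuous (sumSq : Decision d m N → ℝ) :=
  continuous_finsetSum _ fun i _ =>
    ((matFLin (d := d) i.1 i.2).continuous_of_finiteDimensional).pow 2

/-- The decisions that are feasible for a given pattern and whose part `Θ` vanishes if the
saturation functions do. -/
def Problem.patternCompact {dO dS : ℕ} (D : OrthSchurDecomp S.A dO dS) (p ζ : ℝ)
    (pos neg : Fin dO → Prop) : Set (Decision d m N) :=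
  {z | z ∈ S.patternFeasible D p ζ pos neg ∧ (S.satBound = 0 → ∀ i c, z.2.1 i c = 0)}

theorem isPolyhedron_patternCompact {dO dS : ℕ} (D : OrthSchurDecomp S.A dO dS) (p ζ : ℝ)
    (pos neg : Fin dO → Prop) : IsPolyhedron (S.patternCompact D p ζ pos neg) := by
  refine (isPolyhedron_patternFeasible S D p ζ pos neg).and (IsPolyhedron.imp _
    (IsPolyhedron.setOf_forall fun i => IsPolyhedron.setOf_forall fun c => ?_))
  exact IsPolyhedron.hyperplane (matFLin i (Sum.inr (Sum.inl c))) 0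

theorem isCompact_patternCompact {dO dS : ℕ} (D : OrthSchurDecomp S.A dO dS) (p ζ : ℝ)
    (pos neg : Fin dO → Prop) : IsCompact (S.patternCompact D p ζ pos neg) := by
  set U := S.Umax
  set φ := S.satBound with hφ
  -- The radii come from the row constraint. For `φ = 0` the quotient `U / φ` is zero, which fits
  -- because `Θ` is then required to vanish.
  have hbox : IsCompact ((Set.pi Set.univ fun _ : Fin N × Fin m => Set.Icc (-U) U) ×ˢ
      (Set.pi Set.univ fun _ : Fin N × Fin m => Set.pi Set.univ fun _ : Fin (N - 1) × Fin d =>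
        Set.Icc (-(U / φ)) (U / φ)) ×ˢ
      (Set.pi Set.univ fun _ : Fin N × Fin m => Set.pi Set.univ fun _ : Fin (N - 1) =>
        Set.Icc (-(2 * U)) (2 * U))) :=
    (isCompact_univ_pi fun _ => isCompact_Icc).prod
      ((isCompact_univ_pi fun _ => isCompact_univ_pi fun _ => isCompact_Icc).prod
        (isCompact_univ_pi fun _ => isCompact_univ_pi fun _ => isCompact_Icc))
  refine IsCompact.of_isClosed_subset (X := Decision d m N) hbox
    (isPolyhedron_patternCompact S D p ζ pos neg).isClosed fun z hz => ?_
  obtain ⟨⟨-, hrow, -⟩, hΘ⟩ := hz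
  have h0 := fun i => abs_nonneg (z.1 i + 1 / 2 * ∑ l, z.2.2 i l)
  have h1 := fun i => Finset.sum_nonneg fun l (_ : l ∈ Finset.univ) => abs_nonneg (z.2.2 i l)
  have h2 := fun i => Finset.sum_nonneg fun l (_ : l ∈ Finset.univ) => abs_nonneg (z.2.1 i l)
  have h3 : ∀ i, 0 ≤ (∑ c, |z.2.1 i c|) * φ := fun i => mul_nonneg (h2 i) S.satBound_nonneg
  refine ⟨fun i _ => abs_le.mp ?_, fun i _ c _ => abs_le.mp ?_, fun i _ l _ => abs_le.mp ?_⟩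
  · have h4 : |z.1 i| ≤ |z.1 i + 1 / 2 * ∑ l, z.2.2 i l| + 1 / 2 * ∑ l, |z.2.2 i l| := by
      have h5 : z.1 i = (z.1 i + 1 / 2 * ∑ l, z.2.2 i l) - 1 / 2 * ∑ l, z.2.2 i l := by ring
      have h6 : |1 / 2 * ∑ l, z.2.2 i l| ≤ 1 / 2 * ∑ l, |z.2.2 i l| := by
        rw [abs_mul, abs_of_pos (by norm_num : (0 : ℝ) < 1 / 2)]
        exact mul_le_mul_of_nonneg_left (Finset.abs_sum_le_sum_abs _ _) (by norm_num)
      calc |z.1 i| = |(z.1 i + 1 / 2 * ∑ l, z.2.2 i l) - 1 / 2 * ∑ l, z.2.2 i l| := by rw [← h5]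
        _ ≤ _ := abs_sub _ _
        _ ≤ _ := add_le_add le_rfl h6
    linarith [hrow i, h3 i]
  · rcases S.satBound_nonneg.eq_or_lt with h | h
    · rw [hΘ h.symm i c, abs_zero]
      exact div_nonneg S.Umax_pos.le S.satBound_nonneg
    · rw [le_div_iff₀ h]
      have h4 : |z.2.1 i c| ≤ ∑ c, |z.2.1 i c| :=
        Finset.single_le_sum (fun c _ => abs_nonneg (z.2.1 i c)) (Finset.mem_univ c)
      have h5 := mul_le_mul_of_nonneg_right h4 h.le
      linarith [hrow i, h0 i, h1 i]
  · have h4 : |z.2.2 i l| ≤ ∑ l, |z.2.2 i l| :=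
      Finset.single_le_sum (fun l _ => abs_nonneg (z.2.2 i l)) (Finset.mem_univ l)
    linarith [hrow i, h0 i, h3 i]

/-- Dropping `Θ` when the saturation functions vanish. -/
theorem exists_patternCompact_le {dO dS : ℕ} (D : OrthSchurDecomp S.A dO dS) (p ζ : ℝ)
    (pos neg : Fin dO → Prop) (P : Measure Ω) (ν : ℕ → Ω → ℝ) (w : ℕ → Ω → Fin d → ℝ) (t : ℕ)
    (x : Fin d → ℝ) {z : Decision d m N} (hz : z ∈ S.patternFeasible D p ζ pos neg) :
    ∃ z' ∈ S.patternCompact D p ζ pos neg,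
      S.ocpObjective P ν w t x z' ≤ S.ocpObjective P ν w t x z := by
  by_cases h : S.satBound = 0
  · refine ⟨(z.1, 0, z.2.2), ⟨⟨⟨by simp, hz.1.2⟩, fun i => ?_, hz.2.2⟩, fun _ _ _ => rfl⟩, ?_⟩
    · have := hz.2.1 i
      rw [h, mul_zero] at this ⊢
      exact this
    · have hsat : ∀ s, S.satStack s = 0 := by
        intro s
        ext q
        have := abs_satStack_le S s q
        rw [h] at this
        exact abs_nonpos_iff.mp this
      have hcost : ∀ ω, S.randomCost ν w t x (z.1, 0, z.2.2) ω = S.randomCost ν w t x z ω := by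
        intro ω
        simp only [Problem.randomCost, hsat, applied, computed, Matrix.mulVec_zero]
      simp only [Problem.ocpObjective, hcost]
      refine add_le_add le_rfl (mul_le_mul_of_nonneg_left ?_ S.reg_nonneg)
      refine Finset.sum_le_sum fun k _ => (pi_norm_le_iff_of_nonneg (norm_nonneg _)).mpr fun q => ?_
      obtain ⟨a, c⟩ := q
      refine le_trans ?_ (norm_le_pi_norm (fun q : Fin m × (Unit ⊕ (Fin (N - 1) × Fin d) ⊕ Fin (N - 1)) =>
        matF z (k, q.1) q.2) (a, c))
      rcases c with c | c | c
      · exact le_rfl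
      · simp [matF]
      · exact le_rfl
  · exact ⟨z, ⟨hz, fun h' => absurd h' h⟩, le_rfl⟩

theorem measurable_orthState {dO dS : ℕ} (D : OrthSchurDecomp S.A dO dS) (j : Fin dO) :
    Measurable fun x : Fin d → ℝ => D.orthState x j := by
  have : Continuous fun x : Fin d → ℝ => (D.T *ᵥ x) (Sum.inl j) := by fun_prop
  exact this.measurable

open Classical in
theorem exists_optimalPolicy (hd : IsDisturbance P p ν w) {dO dS : ℕ}
    (D : OrthSchurDecomp S.A dO dS) (r ε ζ : ℝ)
    (hne : ∀ x, (S.ocpFeasible D p r ε ζ x).Nonempty) :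
    ∃ π, S.IsOptimalPolicy P ν w D p r ε ζ π := by
  -- One selection for each pattern. Patterns with an empty feasible set get a constant map; `hne`
  -- shows that no state realizes them.
  have key : ∀ (n : ℕ) (b : Fin dO → Bool × Bool), ∃ s : (Fin d → ℝ) → Decision d m N,
      ((S.patternCompact D p ζ (fun j => (b j).1) (fun j => (b j).2)).Nonempty →
        ∀ x, s x ∈ S.patternCompact D p ζ (fun j => (b j).1) (fun j => (b j).2) ∧
          ∀ z ∈ S.patternCompact D p ζ (fun j => (b j).1) (fun j => (b j).2),
          S.qpObjective P ν w (n * κ) x (s x) ≤ S.qpObjective P ν w (n * κ) x z) ∧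
      ∀ g : Decision d m N → ℝ, Continuous g → Measurable fun x => g (s x) := by
    intro n b
    by_cases h : (S.patternCompact D p ζ (fun j => (b j).1) (fun j => (b j).2)).Nonempty
    · have hpoly := isPolyhedron_patternCompact S D p ζ (fun j => (b j).1) (fun j => (b j).2)
      obtain ⟨s, hs, hm⟩ := exists_measurable_argmin
        (isCompact_patternCompact S D p ζ (fun j => (b j).1) (fun j => (b j).2)) h
        (continuous_qpObjective (P := P) (ν := ν) (w := w) S (n * κ))
        (fun x => (convexOn_qpObjective S (n * κ) hd x).subset (Set.subset_univ _) hpoly.convex)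
        continuous_sumSq (strictConvexOn_sumSq.subset (Set.subset_univ _) hpoly.convex)
      exact ⟨s, fun _ => hs, hm⟩
    · exact ⟨fun _ => 0, fun h' => absurd h' h, fun g _ => measurable_const⟩
  choose s hs hm using key
  let pat : (Fin d → ℝ) → Fin dO → Bool × Bool := fun x j =>
    (if r + ε ≤ D.orthState x j then true else false,
      if D.orthState x j ≤ -r - ε then true else false)
  have hpat : Measurable pat := by
    refine measurable_pi_lambda _ fun j => Measurable.prodMk ?_ ?_
    · exact Measurable.ite (measurableSet_le measurable_const (measurable_orthState S D j))
        measurable_const measurable_const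
    · exact Measurable.ite (measurableSet_le (measurable_orthState S D j) measurable_const)
        measurable_const measurable_const
  have hg : ∀ n (g : Decision d m N → ℝ), Continuous g → Measurable fun x => g (s n (pat x) x) := by
    intro n g hg
    -- The patterns are finite in number, so measurability for each of them gives joint
    -- measurability.
    have h1 : Measurable fun y : (Fin dO → Bool × Bool) × (Fin d → ℝ) => g (s n y.1 y.2) :=
      measurable_from_prod_countable_right fun b => hm n b g hg
    exact h1.comp (hpat.prodMk measurable_id)
  have hset : ∀ x, S.patternFeasible D p ζ (fun j => (pat x j).1) (fun j => (pat x j).2)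
      = S.ocpFeasible D p r ε ζ x := by
    intro x
    rw [ocpFeasible_eq_qpFeasible, qpFeasible_eq_patternFeasible]
    simp [pat]
  refine ⟨fun n x => s n (pat x) x, fun n => ⟨⟨fun i => hg n (fun z => z.1 i) (by fun_prop),
    fun i j => hg n (fun z => z.2.1 i j) ?_, fun i j => hg n (fun z => z.2.2 i j) ?_⟩, fun x => ?_⟩⟩
  · exact (continuous_fst.comp continuous_snd).matrix_elem i j
  · exact (continuous_snd.comp continuous_snd).matrix_elem i j
  · have hne' : (S.patternCompact D p ζ (fun j => (pat x j).1) (fun j => (pat x j).2)).Nonempty := by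
      obtain ⟨z, hz⟩ := hne x
      rw [← hset] at hz
      obtain ⟨z', hz', -⟩ := exists_patternCompact_le S D p ζ _ _ P ν w (n * κ) x hz
      exact ⟨z', hz'⟩
    obtain ⟨h1, h2⟩ := hs n (pat x) hne' x
    refine ⟨by rw [← hset]; exact h1.1, fun z hz => ?_⟩
    rw [← hset] at hz
    obtain ⟨z', hz', hle⟩ := exists_patternCompact_le S D p ζ _ _ P ν w (n * κ) x hz
    refine le_trans ?_ hle
    rw [(hd.integrable_randomCost_and_objective_eq S (n * κ) x _ h1.1.1).2,
      (hd.integrable_randomCost_and_objective_eq S (n * κ) x _ hz'.1.1).2]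
    exact h2 z' hz'

end Policy

/-! ### Independence of past and future -/

section Independence

variable {Ω : Type*} [MeasurableSpace Ω] {P : Measure Ω} [IsProbabilityMeasure P]

/-- Regroups past and future of two independent processes. It suffices to check rectangles, where
all probabilities factor. -/
theorem indepFun_prodMk_prodMk {α β γ δ : Type*} [MeasurableSpace α] [MeasurableSpace β]
    [MeasurableSpace γ] [MeasurableSpace δ] {X₁ : Ω → α} {X₂ : Ω → β} {Y₁ : Ω → γ} {Y₂ : Ω → δ}
    (hX₁ : Measurable X₁) (hX₂ : Measurable X₂) (hY₁ : Measurable Y₁) (hY₂ : Measurable Y₂)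
    (hX : IndepFun X₁ X₂ P) (hY : IndepFun Y₁ Y₂ P)
    (h : IndepFun (fun ω => (X₁ ω, X₂ ω)) (fun ω => (Y₁ ω, Y₂ ω)) P) :
    IndepFun (fun ω => (X₁ ω, Y₁ ω)) (fun ω => (X₂ ω, Y₂ ω)) P := by
  rw [IndepFun_iff_Indep, ← generateFrom_prod, ← generateFrom_prod,
    MeasurableSpace.comap_generateFrom, MeasurableSpace.comap_generateFrom]
  refine IndepSets.indep' ?_ ?_ (isPiSystem_prod.comap _) (isPiSystem_prod.comap _) ?_
  · rintro _ ⟨_, ⟨A, hA, C, hC, rfl⟩, rfl⟩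
    exact (hX₁.prodMk hY₁) (MeasurableSet.prod hA hC)
  · rintro _ ⟨_, ⟨A, hA, C, hC, rfl⟩, rfl⟩
    exact (hX₂.prodMk hY₂) (MeasurableSet.prod hA hC)
  · rw [IndepSets_iff]
    rintro _ _ ⟨_, ⟨A, hA, C, hC, rfl⟩, rfl⟩ ⟨_, ⟨B, hB, D, hD, rfl⟩, rfl⟩
    have hXm : IndepFun X₁ Y₁ P := h.comp measurable_fst measurable_fst
    have hYm : IndepFun X₂ Y₂ P := h.comp measurable_snd measurable_snd
    have e1 := h.measure_inter_preimage_eq_mul (A ×ˢ B) (C ×ˢ D) (MeasurableSet.prod hA hB)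
      (MeasurableSet.prod hC hD)
    have e2 := hX.measure_inter_preimage_eq_mul A B hA hB
    have e3 := hY.measure_inter_preimage_eq_mul C D hC hD
    have e4 := hXm.measure_inter_preimage_eq_mul A C hA hC
    have e5 := hYm.measure_inter_preimage_eq_mul B D hB hD
    simp only [Set.mk_preimage_prod] at e1 ⊢
    rw [Set.inter_inter_inter_comm, e1, e2, e3, e4, e5]
    ring

/-- Tonelli for the product law: `X` can be frozen while `Y` is averaged. It replaces conditional
expectations in the drift argument. -/
theorem IndepFun.lintegral_eq {α β : Type*} [MeasurableSpace α] [MeasurableSpace β] {X : Ω → α}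
    {Y : Ω → β} (h : IndepFun X Y P) (hX : Measurable X) (hY : Measurable Y)
    {G : α × β → ENNReal} (hG : Measurable G) :
    ∫⁻ ω, G (X ω, Y ω) ∂P = ∫⁻ ω, ∫⁻ ω', G (X ω, Y ω') ∂P ∂P := by
  have : IsProbabilityMeasure (P.map Y) := Measure.isProbabilityMeasure_map hY.aemeasurable
  have : IsProbabilityMeasure (P.map X) := Measure.isProbabilityMeasure_map hX.aemeasurable
  rw [← lintegral_map hG (hX.prodMk hY),
    (indepFun_iff_map_prod_eq_prod_map_map hX.aemeasurable hY.aemeasurable).mp h,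
    lintegral_prod _ hG.aemeasurable, lintegral_map (hG.lintegral_prod_right') hX]
  refine lintegral_congr fun ω => ?_
  exact lintegral_map (f := fun y => G (X ω, y)) (hG.comp measurable_prodMk_left) hY

/-- The sequence `f`, set to zero from time `n` on. -/
def trunc {β : Type*} [Zero β] (f : ℕ → Ω → β) (n : ℕ) (ω : Ω) : ℕ → β :=
  fun s => if s < n then f s ω else 0

theorem measurable_trunc {β : Type*} [Zero β] [MeasurableSpace β] {f : ℕ → Ω → β}
    (hf : ∀ s, Measurable (f s)) (n : ℕ) : Measurable (trunc f n) := by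
  refine measurable_pi_lambda _ fun s => ?_
  by_cases h : s < n
  · simpa only [trunc, if_pos h] using hf s
  · simp only [trunc, if_neg h, measurable_const]

theorem indepFun_trunc_shift {β : Type*} [Zero β] [MeasurableSpace β] {f : ℕ → Ω → β}
    (hf : ∀ s, Measurable (f s)) (h : iIndepFun f P) (n : ℕ) :
    IndepFun (trunc f n) (shift f n) P := by
  rw [IndepFun_iff_Indep]
  have hdis : Disjoint {s : ℕ | s < n} {s : ℕ | n ≤ s} := by
    rw [Set.disjoint_left]
    intro s hs hs'
    exact (Nat.not_lt.mpr hs') hs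
  refine indep_of_indep_of_le_left (indep_of_indep_of_le_right
    (indep_iSup_of_disjoint (fun s => (hf s).comap_le) h.iIndep hdis) ?_) ?_
  · rw [← measurable_iff_comap_le]
    refine @measurable_pi_lambda _ _ _ (_) _ _ fun s => ?_
    refine Measurable.mono (comap_measurable (f (n + s))) ?_ le_rfl
    exact le_iSup₂ (f := fun i (_ : i ∈ {s : ℕ | n ≤ s}) => MeasurableSpace.comap (f i) _) (n + s)
      (Nat.le_add_right n s)
  · rw [← measurable_iff_comap_le]
    refine @measurable_pi_lambda _ _ _ (_) _ _ fun s => ?_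
    by_cases hs : s < n
    · simp only [trunc, if_pos hs]
      refine Measurable.mono (comap_measurable (f s)) ?_ le_rfl
      exact le_iSup₂ (f := fun i (_ : i ∈ {s : ℕ | s < n}) => MeasurableSpace.comap (f i) _) s hs
    · simp only [trunc, if_neg hs, measurable_const]

end Independence

/-! ### A drift criterion for bounded second moments -/

section Drift

variable {Ω : Type*} [mΩ : MeasurableSpace Ω] {P : Measure Ω} [IsProbabilityMeasure P]

/-- The number of steps since the last visit to the set where `V ≤ J`. -/
noncomputable def age {E : Type*} (V : E → ℝ) (J : ℝ) (X : ℕ → Ω → E) : ℕ → Ω → ℕ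
  | 0, _ => 0
  | n + 1, ω => if V (X (n + 1) ω) ≤ J then 0 else age V J X n ω + 1

/-- Second moments stay bounded for a process that outside a sublevel set of `V` has a
supermartingale property for the fourth powers of `V + δ k`, where `k` counts the steps since the
last visit. -/
theorem exists_lintegral_sq_le_of_drift {E W : Type*} [MeasurableSpace E] [MeasurableSpace W]
    {𝓕 : ℕ → MeasurableSpace Ω} (h𝓕 : ∀ n, 𝓕 n ≤ mΩ) (hmono : ∀ n, 𝓕 n ≤ 𝓕 (n + 1))
    {X : ℕ → Ω → E} (hX : ∀ n, Measurable[𝓕 n] (X n)) {ξ : ℕ → Ω → W}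
    (hξ : ∀ n, Measurable (ξ n))
    (hind : ∀ n, Indep (𝓕 n) (MeasurableSpace.comap (ξ n) inferInstance) P) {V : E → ℝ}
    (hV : Measurable V) (hV0 : ∀ x, 0 ≤ V x) {Φ : ℕ → E × W → ℝ} (hΦ : ∀ n, Measurable (Φ n))
    (hstep : ∀ n ω, V (X (n + 1) ω) = Φ n (X n ω, ξ n ω)) {J δ : ℝ} (hδ : 0 < δ)
    (hinit : ∀ ω, V (X 0 ω) ≤ J)
    (hdrift : ∀ n (k : ℕ) x, J < V x →
      ∫⁻ ω, ENNReal.ofReal ((Φ n (x, ξ n ω) + δ * (k + 1)) ^ 4) ∂P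
        ≤ ENNReal.ofReal ((V x + δ * k) ^ 4))
    {M : ENNReal} (hM : M ≠ ⊤)
    (hjump : ∀ n x, V x ≤ J → ∫⁻ ω, ENNReal.ofReal ((Φ n (x, ξ n ω) + δ) ^ 4) ∂P ≤ M) :
    ∃ C : ENNReal, C ≠ ⊤ ∧ ∀ n, ∫⁻ ω, ENNReal.ofReal (V (X n ω) ^ 2) ∂P ≤ C := by
  have hXm : ∀ n, Measurable (X n) := fun n => (hX n).mono (h𝓕 n) le_rfl
  have hage : ∀ n, Measurable[𝓕 n] (age V J X n) := by
    intro n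
    induction n with
    | zero => exact measurable_const
    | succ n ih =>
      have h1 : Measurable[𝓕 (n + 1)] (age V J X n) := ih.mono (hmono n) le_rfl
      have h2 : MeasurableSet[𝓕 (n + 1)] {ω | V (X (n + 1) ω) ≤ J} :=
        (hV.comp (hX (n + 1))) measurableSet_Iic
      exact Measurable.ite h2 measurable_const (Measurable.add_const h1 1)
  have hagem : ∀ n, Measurable (age V J X n) := fun n => (hage n).mono (h𝓕 n) le_rfl
  have hage0 : ∀ n ω, age V J X n ω = 0 → V (X n ω) ≤ J := by
    intro n ω h
    cases n with
    | zero => exact hinit ω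
    | succ n =>
      by_contra h'
      simp [age, h'] at h
  have hageS : ∀ n ω k, age V J X n ω = k + 1 → J < V (X n ω) := by
    intro n ω k h
    cases n with
    | zero => simp [age] at h
    | succ n =>
      by_contra h'
      simp [age, not_lt.mp h'] at h
  -- The fourth moment of `V + δ k` on the event that the age is `k`. Age `k + 1` at time `n + 1`
  -- forces age `k` at time `n`, so these quantities propagate along diagonals.
  let H : ℕ → ℕ → ENNReal := fun n k =>
    ∫⁻ ω, (if age V J X n ω = k then ENNReal.ofReal ((V (X n ω) + δ * k) ^ 4) else 0) ∂P
  have hH : ∀ n k, H (n + 1) (k + 1) ≤ ∫⁻ ω, (if age V J X n ω = k then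
      ∫⁻ ω', ENNReal.ofReal ((Φ n (X n ω, ξ n ω') + δ * (k + 1)) ^ 4) ∂P else 0) ∂P := by
    intro n k
    have hindep : IndepFun (fun ω => (X n ω, age V J X n ω)) (ξ n) P := by
      rw [IndepFun_iff_Indep]
      exact indep_of_indep_of_le_left (hind n)
        (measurable_iff_comap_le.mp (Measurable.prodMk (hX n) (hage n)))
    let G : (E × ℕ) × W → ENNReal := fun q =>
      if q.1.2 = k then ENNReal.ofReal ((Φ n (q.1.1, q.2) + δ * (k + 1)) ^ 4) else 0
    have hG : Measurable G := by
      refine Measurable.ite ?_ ?_ measurable_const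
      · exact (measurable_snd.comp measurable_fst) (measurableSet_singleton k)
      · exact ENNReal.measurable_ofReal.comp ((((hΦ n).comp
          ((measurable_fst.comp measurable_fst).prodMk measurable_snd)).add_const _).pow_const 4)
    calc H (n + 1) (k + 1) ≤ ∫⁻ ω, G ((X n ω, age V J X n ω), ξ n ω) ∂P := by
          refine lintegral_mono fun ω => ?_
          by_cases h : age V J X (n + 1) ω = k + 1
          · have h1 : age V J X n ω = k := by
              have h2 := hageS _ _ _ h
              simp only [age, if_neg (not_le.mpr h2)] at h
              omega
            simp only [G, if_pos h, if_pos h1, hstep]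
            push_cast
            exact le_rfl
          · simp only [if_neg h, zero_le]
      _ = ∫⁻ ω, ∫⁻ ω', G ((X n ω, age V J X n ω), ξ n ω') ∂P ∂P :=
          IndepFun.lintegral_eq hindep ((hXm n).prodMk (hagem n)) (hξ n) hG
      _ = _ := by
          refine lintegral_congr fun ω => ?_
          by_cases h : age V J X n ω = k
          · simp only [G, if_pos h]
          · simp only [G, if_neg h, lintegral_zero]
  -- An excursion starts from the sublevel set, where `hjump` bounds the first step, and `hdrift`
  -- prevents growth afterwards. At time zero the age is zero.
  have hHM : ∀ n k, H n (k + 1) ≤ M := by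
    intro n
    induction n with
    | zero => intro k; simp [H, age]
    | succ n ih =>
      intro k
      refine (hH n k).trans ?_
      cases k with
      | zero =>
        calc _ ≤ ∫⁻ _, M ∂P := by
              refine lintegral_mono fun ω => ?_
              by_cases h : age V J X n ω = 0
              · simpa only [if_pos h, Nat.cast_zero, zero_add, mul_one] using
                  hjump n _ (hage0 n ω h)
              · simp only [if_neg h, zero_le]
          _ = M := by simp
      | succ k =>
        refine le_trans (lintegral_mono fun ω => ?_) (ih k)
        by_cases h : age V J X n ω = k + 1
        · simp only [if_pos h]
          exact hdrift n (k + 1) _ (hageS n ω k h)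
        · simp only [if_neg h, le_refl]
  -- With `b = δ (k + 1)` the inequality `v * b ≤ (v + b) ^ 2` gives `v ^ 2 ≤ (v + b) ^ 4 / b ^ 2`:
  -- the fourth moment buys the summable weight `b⁻²`.
  let c : ℕ → ℝ := fun k => 1 / (δ * (k + 1)) ^ 2
  have hc0 : ∀ k, 0 ≤ c k := fun k => by positivity
  have hc : Summable c := by
    have h1 := (summable_nat_add_iff 1).mpr
      (Real.summable_one_div_nat_pow.mpr (by norm_num : 1 < 2))
    refine (h1.mul_left (1 / δ ^ 2)).congr fun k => ?_
    simp only [c]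
    push_cast
    field_simp
  refine ⟨ENNReal.ofReal (J ^ 2) + ∑' k, M * ENNReal.ofReal (c k), ?_, fun n => ?_⟩
  · rw [ENNReal.tsum_mul_left]
    exact ENNReal.add_ne_top.mpr
      ⟨ENNReal.ofReal_ne_top, ENNReal.mul_ne_top hM hc.tsum_ofReal_ne_top⟩
  · let T : ℕ → Ω → ENNReal := fun k ω => (if age V J X n ω = k + 1 then
      ENNReal.ofReal ((V (X n ω) + δ * (k + 1 : ℕ)) ^ 4) else 0) * ENNReal.ofReal (c k)
    have hT : ∀ k, Measurable (T k) := by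
      intro k
      refine Measurable.mul_const (Measurable.ite ?_ ?_ measurable_const) _
      · exact (hagem n) (measurableSet_singleton (k + 1))
      · exact ENNReal.measurable_ofReal.comp
          (((hV.comp (hXm n)).add_const _).pow_const 4)
    have hpt : ∀ ω, ENNReal.ofReal (V (X n ω) ^ 2) ≤ ENNReal.ofReal (J ^ 2) + ∑' k, T k ω := by
      intro ω
      rcases h : age V J X n ω with _ | k
      · refine le_add_right (ENNReal.ofReal_le_ofReal ?_)
        exact pow_le_pow_left₀ (hV0 _) (hage0 n ω h) 2
      · refine le_add_left (le_trans ?_ (ENNReal.le_tsum k))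
        simp only [T, if_pos h]
        rw [← ENNReal.ofReal_mul (by positivity)]
        refine ENNReal.ofReal_le_ofReal ?_
        simp only [c]
        push_cast
        have hv := hV0 (X n ω)
        set v := V (X n ω)
        have hk : 0 < δ * ((k : ℝ) + 1) := by positivity
        set b := δ * ((k : ℝ) + 1)
        rw [mul_one_div, le_div_iff₀ (by positivity)]
        have : v * b ≤ (v + b) ^ 2 := by nlinarith
        calc v ^ 2 * b ^ 2 = (v * b) ^ 2 := by ring
          _ ≤ ((v + b) ^ 2) ^ 2 := pow_le_pow_left₀ (by positivity) this 2
          _ = (v + b) ^ 4 := by ring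
    calc _ ≤ ∫⁻ ω, ENNReal.ofReal (J ^ 2) + ∑' k, T k ω ∂P := lintegral_mono hpt
      _ = ENNReal.ofReal (J ^ 2) + ∑' k, ∫⁻ ω, T k ω ∂P := by
          rw [lintegral_add_left measurable_const, lintegral_tsum fun k => (hT k).aemeasurable]
          simp
      _ ≤ _ := by
          refine add_le_add le_rfl (ENNReal.tsum_le_tsum fun k => ?_)
          rw [lintegral_mul_const' _ _ ENNReal.ofReal_ne_top]
          exact mul_le_mul' (hHM n k) le_rfl

/-- The quadratic estimate `hUsq` linearizes to a mean decrease of about `a` in `U`, of which `a /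
4` is spent on the growth of the age term. Expanding the fourth power around `τ`, the linear term
dominates once `s` is large. -/
theorem lintegral_fourth_le_of_drift {s a C M τ : ℝ} {U g Y : Ω → ℝ} (hg : Integrable g P)
    (hY : Integrable (fun ω => Y ω ^ 4) P) (ha : 0 < a) (hgm : ∫ ω, g ω ∂P ≤ -a * s + C)
    (hYm : ∫ ω, Y ω ^ 4 ∂P ≤ M) (hY1 : ∀ ω, 1 ≤ Y ω) (hU : ∀ ω, |U ω - s| + a / 4 ≤ Y ω)
    (hUsq : ∀ ω, U ω ^ 2 ≤ s ^ 2 + 2 * g ω + Y ω ^ 2) (hs : 1 ≤ s)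
    (hs1 : 2 * (2 * C + M) ≤ a * s) (hs2 : 11 * M ≤ 2 * a * s) (hτ : s ≤ τ) :
    ∫⁻ ω, ENNReal.ofReal ((U ω - s + a / 4 + τ) ^ 4) ∂P ≤ ENNReal.ofReal (τ ^ 4) := by
  have hs0 : 0 < s := by linarith
  have hτ1 : 1 ≤ τ := hs.trans hτ
  -- An integrable majorant of the fourth power; the factor `11 = 6 + 4 + 1` collects its quadratic,
  -- cubic and quartic terms.
  let h : Ω → ℝ := fun ω =>
    (τ ^ 4 + τ ^ 3 * a) + (4 * τ ^ 3 / s) * g ω + (2 * τ ^ 3 / s + 11 * τ ^ 2) * Y ω ^ 4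
  have hi : Integrable h P := ((integrable_const _).add (hg.const_mul _)).add (hY.const_mul _)
  have hint : ∫ ω, h ω ∂P = (τ ^ 4 + τ ^ 3 * a) + (4 * τ ^ 3 / s) * ∫ ω, g ω ∂P
      + (2 * τ ^ 3 / s + 11 * τ ^ 2) * ∫ ω, Y ω ^ 4 ∂P := by
    have e1 : ∫ ω, h ω ∂P = ∫ ω, ((τ ^ 4 + τ ^ 3 * a) + (4 * τ ^ 3 / s) * g ω) ∂P
        + ∫ ω, (2 * τ ^ 3 / s + 11 * τ ^ 2) * Y ω ^ 4 ∂P :=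
      integral_add ((integrable_const _).add (hg.const_mul _)) (hY.const_mul _)
    rw [e1, integral_add (integrable_const _) (hg.const_mul _), integral_const_mul,
      integral_const_mul]
    simp
  have hle : ∀ ω, (U ω - s + a / 4 + τ) ^ 4 ≤ h ω := by
    intro ω
    set e := U ω - s + a / 4 with he
    set y := Y ω
    have hy1 : 1 ≤ y := hY1 ω
    have hey : |e| ≤ y := by
      refine le_trans (abs_add_le _ _) ?_
      rw [abs_of_pos (by positivity : 0 < a / 4)]
      exact hU ω
    have hy2 : y ^ 2 ≤ y ^ 4 := pow_le_pow_right₀ hy1 (by norm_num)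
    have hy3 : y ^ 3 ≤ y ^ 4 := pow_le_pow_right₀ hy1 (by norm_num)
    have he2 : e ^ 2 ≤ y ^ 4 := by
      rw [← sq_abs]; exact (pow_le_pow_left₀ (abs_nonneg _) hey 2).trans hy2
    have he3 : e ^ 3 ≤ y ^ 4 := by
      refine le_trans (le_abs_self _) ?_
      rw [abs_pow]; exact (pow_le_pow_left₀ (abs_nonneg _) hey 3).trans hy3
    have he4 : e ^ 4 ≤ y ^ 4 := by
      have : e ^ 4 = |e| ^ 4 := by rw [← abs_pow, abs_of_nonneg (by positivity)]
      rw [this]; exact pow_le_pow_left₀ (abs_nonneg _) hey 4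
    -- From `U² - s² ≥ 2 s (U - s)`.
    have hD : e ≤ (2 * g ω + y ^ 4) / (2 * s) + a / 4 := by
      have h1 : U ω - s ≤ (2 * g ω + y ^ 4) / (2 * s) := by
        rw [le_div_iff₀ (by positivity)]
        nlinarith [hUsq ω, sq_nonneg (U ω - s)]
      linarith
    have h0 : 0 ≤ y ^ 4 := by positivity
    have hτ2 : τ ≤ τ ^ 2 := by nlinarith
    have hτ3 : 1 ≤ τ ^ 2 := by nlinarith
    calc (e + τ) ^ 4 = τ ^ 4 + 4 * τ ^ 3 * e + 6 * τ ^ 2 * e ^ 2 + 4 * τ * e ^ 3 + e ^ 4 := by ring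
      _ ≤ τ ^ 4 + 4 * τ ^ 3 * ((2 * g ω + y ^ 4) / (2 * s) + a / 4) + 6 * τ ^ 2 * y ^ 4
          + 4 * τ ^ 2 * y ^ 4 + τ ^ 2 * y ^ 4 := by
        refine add_le_add (add_le_add (add_le_add (add_le_add le_rfl ?_) ?_) ?_) ?_
        · exact mul_le_mul_of_nonneg_left hD (by positivity)
        · exact mul_le_mul_of_nonneg_left he2 (by positivity)
        · calc 4 * τ * e ^ 3 ≤ 4 * τ * y ^ 4 := mul_le_mul_of_nonneg_left he3 (by positivity)
            _ ≤ 4 * τ ^ 2 * y ^ 4 := mul_le_mul_of_nonneg_right (by linarith) h0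
        · calc e ^ 4 ≤ 1 * y ^ 4 := by linarith
            _ ≤ _ := mul_le_mul_of_nonneg_right hτ3 h0
      _ = h ω := by
        simp only [h]
        field_simp
        ring
  have h4 : ∀ ω, 0 ≤ h ω := fun ω => le_trans (by positivity) (hle ω)
  calc _ ≤ ∫⁻ ω, ENNReal.ofReal (h ω) ∂P :=
        lintegral_mono fun ω => ENNReal.ofReal_le_ofReal (hle ω)
    _ = ENNReal.ofReal (∫ ω, h ω ∂P) :=
        (ofReal_integral_eq_lintegral_ofReal hi (Filter.Eventually.of_forall h4)).symm
    _ ≤ _ := by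
        refine ENNReal.ofReal_le_ofReal ?_
        rw [hint]
        have h5 : (4 * τ ^ 3 / s) * ∫ ω, g ω ∂P ≤ (4 * τ ^ 3 / s) * (-a * s + C) :=
          mul_le_mul_of_nonneg_left hgm (by positivity)
        have h6 : (2 * τ ^ 3 / s + 11 * τ ^ 2) * ∫ ω, Y ω ^ 4 ∂P
            ≤ (2 * τ ^ 3 / s + 11 * τ ^ 2) * M := mul_le_mul_of_nonneg_left hYm (by positivity)
        have h7 : (4 * τ ^ 3 / s) * (-a * s + C) + (2 * τ ^ 3 / s + 11 * τ ^ 2) * M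
            = τ ^ 3 * (-4 * a) + τ ^ 3 * (2 * (2 * C + M) / s) + 11 * M * τ ^ 2 := by
          field_simp
          ring
        have h8 : 2 * (2 * C + M) / s ≤ a := by
          rw [div_le_iff₀ hs0]; exact hs1
        have h9 : τ ^ 3 * (2 * (2 * C + M) / s) ≤ τ ^ 3 * a :=
          mul_le_mul_of_nonneg_left h8 (by positivity)
        have h10 : 11 * M * τ ^ 2 ≤ 2 * a * τ * τ ^ 2 := by
          refine mul_le_mul_of_nonneg_right (hs2.trans ?_) (by positivity)
          exact mul_le_mul_of_nonneg_left hτ (by positivity)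
        -- The coefficients of `a τ ^ 3` balance: `1 - 4 + 1 + 2 = 0`.
        nlinarith [h5, h6, h7, h9, h10]

end Drift

/-! ### Causality and measurability of the closed loop -/

section Loop

variable {d m N κ : ℕ} (S : Problem d m N κ)

theorem block_apply {m N : ℕ} (u : Fin N × Fin m → ℝ) {k : ℕ} (hk : k < N) (a : Fin m) :
    block u k a = u (⟨k, hk⟩, a) := by
  rw [block, dif_pos hk]

/-- Dropouts are compared up to `k` inclusive because the mask uses `ν k`; the noise enters only
strictly before `k`. -/
theorem block_applied_congr {z : Decision d m N} (hz : Causal z) {e e' : Fin (N - 1) × Fin d → ℝ}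
    {ν ν' : ℕ → ℝ} {k : ℕ} (hν : ∀ l ≤ k, ν l = ν' l)
    (he : ∀ c, (c.1 : ℕ) < k → e c = e' c) :
    block (applied κ z e ν) k = block (applied κ z e' ν') k := by
  ext a
  by_cases hk : k < N
  · rw [block_apply _ hk, block_apply _ hk, applied_apply, applied_apply, computed_apply,
      computed_apply]
    have h1 : ∀ c, z.2.1 (⟨k, hk⟩, a) c * e c = z.2.1 (⟨k, hk⟩, a) c * e' c := by
      intro c
      by_cases hc : (c.1 : ℕ) < k
      · rw [he c hc]
      · rw [hz.1 ⟨k, hk⟩ a c.1 c.2 (not_lt.mp hc), zero_mul, zero_mul]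
    have h2 : ∀ l : Fin (N - 1), z.2.2 (⟨k, hk⟩, a) l * ν l = z.2.2 (⟨k, hk⟩, a) l * ν' l := by
      intro l
      by_cases hl : (l : ℕ) < k
      · rw [hν l hl.le]
      · rw [hz.2 ⟨k, hk⟩ a l (not_lt.mp hl), zero_mul, zero_mul]
    simp only [h1, h2, hν k le_rfl]
  · simp only [block, dif_neg hk]

theorem norm_satStack_le (s : ℕ → Fin d → ℝ) : ‖S.satStack s‖ ≤ S.satBound :=
  (pi_norm_le_iff_of_nonneg S.satBound_nonneg).mpr fun q => abs_satStack_le S s q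

theorem norm_loopControl_le {Ω : Type*} {ν : ℕ → Ω → ℝ} {w : ℕ → Ω → Fin d → ℝ}
    (hν : ∀ t ω, ν t ω = 0 ∨ ν t ω = 1) {π : ℕ → (Fin d → ℝ) → Decision d m N}
    (hπ : ∀ n x, S.ControlAdmissible (π n x)) (t : ℕ) (y : Fin d → ℝ) (ω : Ω) :
    ‖S.loopControl ν w π t y ω‖ ≤ S.Umax :=
  hπ _ _ _ _ (norm_satStack_le S _) (fun _ => hν _ ω) _
    ((Nat.mod_lt _ S.one_le_κ).trans_le S.κ_le_N)

/-- The two probability spaces may differ, so the loop can be compared with a copy driven by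
truncated sequences. -/
theorem loop_congr {Ω Ω' : Type*} {ν : ℕ → Ω → ℝ} {w : ℕ → Ω → Fin d → ℝ} {ν' : ℕ → Ω' → ℝ}
    {w' : ℕ → Ω' → Fin d → ℝ} {π : ℕ → (Fin d → ℝ) → Decision d m N}
    (hπ : ∀ n x, Causal (π n x)) (x₀ : Fin d → ℝ) {ω : Ω} {ω' : Ω'} {t : ℕ}
    (h : ∀ s < t, ν s ω = ν' s ω' ∧ w s ω = w' s ω') :
    S.loop ν w π x₀ ω t = S.loop ν' w' π x₀ ω' t := by
  induction t with
  | zero => rfl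
  | succ t ih =>
    have h1 := ih fun s hs => h s (hs.trans (Nat.lt_succ_self t))
    have hdm := Nat.div_add_mod' t κ
    have h2 : ∀ y, S.loopControl ν w π t y ω = S.loopControl ν' w' π t y ω' := by
      intro y
      refine block_applied_congr (hπ _ _) (fun l hl => (h _ (by omega)).1) fun c hc => ?_
      simp only [Problem.satStack]
      rw [(h (t / κ * κ + c.1) (by omega)).2]
    simp only [Problem.loop, h1, h2, (h t (Nat.lt_succ_self t)).2]

theorem measurable_mulVec {α I J : Type*} [MeasurableSpace α] [Fintype I] [Fintype J]
    (M : Matrix I J ℝ) {f : α → J → ℝ} (hf : Measurable f) : Measurable fun x => M *ᵥ f x :=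
  (Continuous.matrix_mulVec continuous_const continuous_id).measurable.comp hf

theorem measurable_block_applied {α : Type*} [MeasurableSpace α] {z : α → Decision d m N}
    (hz1 : ∀ i, Measurable fun x => (z x).1 i) (hz2 : ∀ i j, Measurable fun x => (z x).2.1 i j)
    (hz3 : ∀ i j, Measurable fun x => (z x).2.2 i j) {b : α → ℕ → Fin d → ℝ} (hb : Measurable b)
    {ν : α → ℕ → ℝ} (hν : Measurable ν) (k : ℕ) :
    Measurable fun x => block (applied κ (z x) (S.satStack (b x)) (ν x)) k := by
  refine measurable_pi_lambda _ fun a => ?_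
  by_cases hk : k < N
  · simp only [block_apply _ hk, applied_apply, computed_apply]
    have hνl : ∀ l, Measurable fun x => ν x l := fun l => (measurable_pi_apply l).comp hν
    refine Measurable.mul ?_ (((hz1 _).add ?_).add ?_)
    · split_ifs
      · exact hνl _
      · exact measurable_const
    · exact Finset.measurable_sum _ fun c _ => (hz2 _ c).mul ((measurable_satStack S c).comp hb)
    · exact Finset.measurable_sum _ fun l _ => (hz3 _ l).mul (hνl l)
  · simp only [block, dif_neg hk]
    exact measurable_const

theorem measurable_loopControl {Ω : Type*} [MeasurableSpace Ω] {ν : ℕ → Ω → ℝ}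
    {w : ℕ → Ω → Fin d → ℝ} (hν : ∀ t, Measurable (ν t)) (hw : ∀ t, Measurable (w t))
    {π : ℕ → (Fin d → ℝ) → Decision d m N} (hπ : ∀ n, MeasurableRule (π n)) (t : ℕ)
    {y : Ω → Fin d → ℝ} (hy : Measurable y) :
    Measurable fun ω => S.loopControl ν w π t (y ω) ω :=
  measurable_block_applied S (fun i => ((hπ _).1 i).comp hy) (fun i j => ((hπ _).2.1 i j).comp hy)
    (fun i j => ((hπ _).2.2 i j).comp hy) (measurable_shift hw _) (measurable_shift hν _) _

theorem measurable_loop {Ω : Type*} [MeasurableSpace Ω] {ν : ℕ → Ω → ℝ}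
    {w : ℕ → Ω → Fin d → ℝ} (hν : ∀ t, Measurable (ν t)) (hw : ∀ t, Measurable (w t))
    {π : ℕ → (Fin d → ℝ) → Decision d m N} (hπ : ∀ n, MeasurableRule (π n)) (x₀ : Fin d → ℝ)
    (t : ℕ) : Measurable fun ω => S.loop ν w π x₀ ω t := by
  induction t with
  | zero => exact measurable_const
  | succ t ih =>
    have h1 : Measurable fun ω => S.A *ᵥ (S.loop ν w π x₀ ω t).1
        + S.B *ᵥ S.loopControl ν w π t (S.loop ν w π x₀ ω t).2 ω + w t ω :=
      ((measurable_mulVec _ ih.fst).add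
        (measurable_mulVec _ (measurable_loopControl S hν hw hπ t ih.snd))).add (hw t)
    refine h1.prodMk ?_
    by_cases hd : κ ∣ t + 1
    · simpa only [if_pos hd] using h1
    · simpa only [if_neg hd] using ih.snd

theorem loop_snd_of_dvd {Ω : Type*} (ν : ℕ → Ω → ℝ) (w : ℕ → Ω → Fin d → ℝ)
    (π : ℕ → (Fin d → ℝ) → Decision d m N) (x₀ : Fin d → ℝ) (ω : Ω) (n : ℕ) :
    (S.loop ν w π x₀ ω (n * κ)).2 = (S.loop ν w π x₀ ω (n * κ)).1 := by
  rcases h : n * κ with _ | t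
  · rfl
  · simp only [Problem.loop]
    rw [if_pos (h ▸ Dvd.intro_left n rfl)]

theorem loop_snd_add {Ω : Type*} (ν : ℕ → Ω → ℝ) (w : ℕ → Ω → Fin d → ℝ)
    (π : ℕ → (Fin d → ℝ) → Decision d m N) (x₀ : Fin d → ℝ) (ω : Ω) (n i : ℕ) (hi : i < κ) :
    (S.loop ν w π x₀ ω (n * κ + i)).2 = (S.loop ν w π x₀ ω (n * κ)).1 := by
  induction i with
  | zero => exact loop_snd_of_dvd S ν w π x₀ ω n
  | succ i ih =>
    rw [← ih (Nat.lt_of_succ_lt hi), ← add_assoc]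
    simp only [Problem.loop]
    rw [if_neg]
    rw [add_assoc, Nat.dvd_add_right (Dvd.intro_left n rfl)]
    exact fun h => absurd (Nat.le_of_dvd (Nat.succ_pos i) h) (not_le.mpr hi)

theorem loop_fst_add {Ω : Type*} (ν : ℕ → Ω → ℝ) (w : ℕ → Ω → Fin d → ℝ)
    (π : ℕ → (Fin d → ℝ) → Decision d m N) (x₀ : Fin d → ℝ) (ω : Ω) (n i : ℕ) (hi : i ≤ κ) :
    (S.loop ν w π x₀ ω (n * κ + i)).1 = S.predicted (S.loop ν w π x₀ ω (n * κ)).1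
      (applied κ (π n (S.loop ν w π x₀ ω (n * κ)).1) (S.satStack (shift w (n * κ) ω))
        (shift ν (n * κ) ω)) (shift w (n * κ) ω) i := by
  induction i with
  | zero => rfl
  | succ i ih =>
    have hi' : i < κ := hi
    have h1 : (n * κ + i) / κ = n := by
      rw [Nat.mul_comm, Nat.mul_add_div S.one_le_κ, Nat.div_eq_of_lt hi', Nat.add_zero]
    have h2 : (n * κ + i) % κ = i := by
      rw [Nat.mul_comm, Nat.mul_add_mod, Nat.mod_eq_of_lt hi']
    rw [← add_assoc, Problem.predicted, ← ih hi'.le]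
    simp only [Problem.loop, Problem.loopControl, loop_snd_add S ν w π x₀ ω n i hi', h1, h2]
    rfl

end Loop

/-! ### The filtration of past disturbances -/

section Filtration

variable {Ω : Type*} [mΩ : MeasurableSpace Ω] {P : Measure Ω} [IsProbabilityMeasure P]
  {d m N κ : ℕ} {p : ℝ} {ν : ℕ → Ω → ℝ} {w : ℕ → Ω → Fin d → ℝ} (S : Problem d m N κ)

/-- The information carried by the dropouts and the noise before time `t`. -/
abbrev pastInfo (ν : ℕ → Ω → ℝ) (w : ℕ → Ω → Fin d → ℝ) (t : ℕ) : MeasurableSpace Ω :=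
  MeasurableSpace.comap (fun ω => (trunc ν t ω, trunc w t ω)) inferInstance

theorem pastInfo_mono (ν : ℕ → Ω → ℝ) (w : ℕ → Ω → Fin d → ℝ) {t t' : ℕ} (h : t ≤ t') :
    pastInfo ν w t ≤ pastInfo ν w t' := by
  let g : (ℕ → ℝ) × (ℕ → Fin d → ℝ) → (ℕ → ℝ) × (ℕ → Fin d → ℝ) := fun q =>
    (trunc (fun s (q : ℕ → ℝ) => q s) t q.1, trunc (fun s (q : ℕ → Fin d → ℝ) => q s) t q.2)
  have hg : Measurable g :=
    ((measurable_trunc (fun s => measurable_pi_apply s) t).comp measurable_fst).prodMk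
      ((measurable_trunc (fun s => measurable_pi_apply s) t).comp measurable_snd)
  have h1 : (fun ω => (trunc ν t ω, trunc w t ω))
      = g ∘ fun ω => (trunc ν t' ω, trunc w t' ω) := by
    ext1 ω
    refine Prod.ext ?_ ?_ <;>
    · funext s
      simp only [g, Function.comp_apply, trunc]
      by_cases hs : s < t
      · rw [if_pos hs, if_pos hs, if_pos (hs.trans_le h)]
      · rw [if_neg hs, if_neg hs]
  rw [pastInfo, pastInfo, ← measurable_iff_comap_le, h1]
  exact hg.comp (comap_measurable _)

theorem IsDisturbance.pastInfo_le (hd : IsDisturbance P p ν w) (t : ℕ) : pastInfo ν w t ≤ mΩ :=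
  ((measurable_trunc hd.ν_measurable t).prodMk (measurable_trunc hd.w_measurable t)).comap_le

theorem IsDisturbance.indep_pastInfo (hd : IsDisturbance P p ν w) (t : ℕ) :
    Indep (pastInfo ν w t)
      (MeasurableSpace.comap (fun ω => (shift ν t ω, shift w t ω)) inferInstance) P := by
  have h0 : IndepFun (fun ω => (trunc ν t ω, shift ν t ω)) (fun ω => (trunc w t ω, shift w t ω))
      P := by
    have h1 : Measurable fun s : ℕ → ℝ => (trunc (fun s (q : ℕ → ℝ) => q s) t s,
        shift (fun s (q : ℕ → ℝ) => q s) t s) :=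
      (measurable_trunc (fun s => measurable_pi_apply s) t).prodMk
        (measurable_shift (fun s => measurable_pi_apply s) t)
    have h2 : Measurable fun s : ℕ → Fin d → ℝ => (trunc (fun s (q : ℕ → Fin d → ℝ) => q s) t s,
        shift (fun s (q : ℕ → Fin d → ℝ) => q s) t s) :=
      (measurable_trunc (fun s => measurable_pi_apply s) t).prodMk
        (measurable_shift (fun s => measurable_pi_apply s) t)
    exact hd.indep.comp h1 h2
  exact (IndepFun_iff_Indep _ _ _).mp (indepFun_prodMk_prodMk
    (measurable_trunc hd.ν_measurable t) (measurable_shift hd.ν_measurable t)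
    (measurable_trunc hd.w_measurable t) (measurable_shift hd.w_measurable t)
    (indepFun_trunc_shift hd.ν_measurable hd.ν_indep t)
    (indepFun_trunc_shift hd.w_measurable hd.w_indep t) h0)

/-- The loop is run on the canonical space of disturbance sequences. By causality it takes the same
value at the truncated sequences, so it factors through the past. -/
theorem measurable_pastInfo_loop {π : ℕ → (Fin d → ℝ) → Decision d m N}
    (hπ : ∀ n, MeasurableRule (π n)) (hc : ∀ n x, Causal (π n x)) (x₀ : Fin d → ℝ) (t : ℕ) :
    Measurable[pastInfo ν w t] fun ω => (S.loop ν w π x₀ ω t).1 := by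
  let ν' : ℕ → (ℕ → ℝ) × (ℕ → Fin d → ℝ) → ℝ := fun s q => q.1 s
  let w' : ℕ → (ℕ → ℝ) × (ℕ → Fin d → ℝ) → Fin d → ℝ := fun s q => q.2 s
  have h1 : Measurable fun q => (S.loop ν' w' π x₀ q t).1 :=
    (measurable_loop S (fun s => (measurable_pi_apply s).comp measurable_fst)
      (fun s => (measurable_pi_apply s).comp measurable_snd) hπ x₀ t).fst
  have h2 : (fun ω => (S.loop ν w π x₀ ω t).1)
      = (fun q => (S.loop ν' w' π x₀ q t).1) ∘ fun ω => (trunc ν t ω, trunc w t ω) := by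
    ext1 ω
    simp only [Function.comp_apply]
    rw [loop_congr S hc x₀ (ω := ω) (ω' := (trunc ν t ω, trunc w t ω)) (ν' := ν') (w' := w')]
    intro s hs
    simp only [ν', w', trunc, if_pos hs, and_self]
  rw [h2]
  exact h1.comp (comap_measurable _)

end Filtration

/-! ### The Euclidean norm on functions -/

section EuclideanNorm

variable {ι : Type*} [Fintype ι]

/-- The Euclidean norm. -/
noncomputable def l2 (v : ι → ℝ) : ℝ := ‖WithLp.toLp 2 v‖

theorem l2_nonneg (v : ι → ℝ) : 0 ≤ l2 v := norm_nonneg _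

theorem l2_add_le (v v' : ι → ℝ) : l2 (v + v') ≤ l2 v + l2 v' := by
  rw [l2, WithLp.toLp_add]; exact norm_add_le _ _

theorem l2_sum_le {α : Type*} (s : Finset α) (f : α → ι → ℝ) :
    l2 (∑ i ∈ s, f i) ≤ ∑ i ∈ s, l2 (f i) := by
  rw [l2, WithLp.toLp_sum]; exact norm_sum_le _ _

theorem l2_sq (v : ι → ℝ) : l2 v ^ 2 = v ⬝ᵥ v := by
  rw [l2, EuclideanSpace.norm_sq_eq]
  simp [dotProduct, sq]

theorem l2_add_sq (v v' : ι → ℝ) : l2 (v + v') ^ 2 = l2 v ^ 2 + 2 * (v ⬝ᵥ v') + l2 v' ^ 2 := by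
  simp only [l2_sq, add_dotProduct, dotProduct_add, dotProduct_comm v' v]
  ring

theorem abs_l2_add_sub_le (v v' : ι → ℝ) : |l2 (v + v') - l2 v| ≤ l2 v' := by
  have := abs_norm_sub_norm_le (WithLp.toLp 2 (v + v')) (WithLp.toLp 2 v)
  rwa [← WithLp.toLp_sub, add_sub_cancel_left] at this

theorem l2_mulVec_of_orthogonal [DecidableEq ι] {A : Matrix ι ι ℝ}
    (hA : A ∈ Matrix.orthogonalGroup ι ℝ) (v : ι → ℝ) : l2 (A *ᵥ v) = l2 v := by
  rw [← sq_eq_sq₀ (l2_nonneg _) (l2_nonneg _), l2_sq, l2_sq, Matrix.dotProduct_mulVec,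
    ← Matrix.mulVec_transpose, Matrix.mulVec_mulVec]
  have : Aᵀ * A = 1 := by
    have := (Matrix.mem_orthogonalGroup_iff' ι ℝ).mp hA
    simpa [Matrix.star_eq_conjTranspose] using this
  rw [this, Matrix.one_mulVec]

theorem l2_le_sum_abs (v : ι → ℝ) : l2 v ≤ ∑ i, |v i| := by
  refine abs_le_of_sq_le_sq' ?_ (Finset.sum_nonneg fun i _ => abs_nonneg _) |>.2
  rw [l2_sq, dotProduct]
  calc ∑ i, v i * v i = ∑ i, |v i| ^ 2 := Finset.sum_congr rfl fun i _ => by rw [sq_abs, sq]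
    _ ≤ _ := Finset.sum_sq_le_sq_sum_of_nonneg fun i _ => abs_nonneg (v i)

theorem continuous_l2 : Continuous (l2 : (ι → ℝ) → ℝ) :=
  continuous_norm.comp (PiLp.continuous_toLp 2 _)

theorem exists_l2_le_mul_norm {E : Type*} [NormedAddCommGroup E] [NormedSpace ℝ E]
    [FiniteDimensional ℝ E] (L : E →ₗ[ℝ] ι → ℝ) : ∃ c, 0 ≤ c ∧ ∀ v, l2 (L v) ≤ c * ‖v‖ := by
  let L' : E →L[ℝ] EuclideanSpace ℝ ι :=
    LinearMap.toContinuousLinearMap ((WithLp.linearEquiv 2 ℝ (ι → ℝ)).symm.toLinearMap.comp L)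
  exact ⟨‖L'‖, norm_nonneg _, fun v => L'.le_opNorm v⟩

end EuclideanNorm

/-! ### The orthogonal part of the state and its drift -/

section OrthogonalPart

variable {d m N κ : ℕ} (S : Problem d m N κ) {dO dS : ℕ} (D : OrthSchurDecomp S.A dO dS)

/-- The map `x ↦ x^o` as a linear map. -/
def OrthSchurDecomp.orthLin {d dO dS : ℕ} {A : Matrix (Fin d) (Fin d) ℝ}
    (D : OrthSchurDecomp A dO dS) : (Fin d → ℝ) →ₗ[ℝ] Fin dO → ℝ where
  toFun := D.orthState
  map_add' x y := by
    ext j; simp [OrthSchurDecomp.orthState, Matrix.mulVec_add]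
  map_smul' c x := by
    ext j; simp [OrthSchurDecomp.orthState, Matrix.mulVec_smul]

theorem orthLin_mulVec (x : Fin d → ℝ) : D.orthLin (S.A *ᵥ x) = D.Ao *ᵥ D.orthLin x := by
  ext j
  change (D.T *ᵥ (S.A *ᵥ x)) (Sum.inl j) = _
  rw [Matrix.mulVec_mulVec, D.mul_eq, ← Matrix.mulVec_mulVec, Matrix.fromBlocks_mulVec]
  simp only [Matrix.zero_mulVec, add_zero, Sum.elim_inl]
  rfl

theorem orthLin_pow_mulVec (k : ℕ) (x : Fin d → ℝ) :
    D.orthLin (S.A ^ k *ᵥ x) = D.Ao ^ k *ᵥ D.orthLin x := by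
  induction k with
  | zero => simp
  | succ k ih => rw [pow_succ', ← Matrix.mulVec_mulVec, orthLin_mulVec, ih, Matrix.mulVec_mulVec,
      ← pow_succ']

theorem orthLin_mulVec_control (u : Fin m → ℝ) : D.orthLin (S.B *ᵥ u) = D.Bo S.B *ᵥ u := by
  ext j
  change (D.T *ᵥ (S.B *ᵥ u)) (Sum.inl j) = _
  rw [Matrix.mulVec_mulVec]
  rfl

/-- The effect of controls and noise on the orthogonal part of the state after `k` steps. -/
def orthInput (u : Fin N × Fin m → ℝ) (b : ℕ → Fin d → ℝ) (k : ℕ) : Fin dO → ℝ :=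
  ∑ l ∈ Finset.range k, D.Ao ^ (k - 1 - l) *ᵥ D.orthLin (S.B *ᵥ block u l + b l)

theorem orthLin_predicted (x : Fin d → ℝ) (u : Fin N × Fin m → ℝ) (b : ℕ → Fin d → ℝ) (k : ℕ) :
    D.orthLin (S.predicted x u b k) = D.Ao ^ k *ᵥ D.orthLin x + orthInput S D u b k := by
  rw [predicted_eq, map_add, map_sum, orthLin_pow_mulVec, orthInput]
  congr 1
  exact Finset.sum_congr rfl fun l _ => orthLin_pow_mulVec S D _ _

theorem l2_pow_mulVec (k : ℕ) (v : Fin dO → ℝ) : l2 (D.Ao ^ k *ᵥ v) = l2 v :=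
  l2_mulVec_of_orthogonal (pow_mem D.orthogonal k) v

theorem l2_orthInput_le (u : Fin N × Fin m → ℝ) (b : ℕ → Fin d → ℝ) (k : ℕ) :
    l2 (orthInput S D u b k)
      ≤ ∑ l ∈ Finset.range k, l2 (D.orthLin (S.B *ᵥ block u l + b l)) := by
  refine (l2_sum_le _ _).trans (le_of_eq (Finset.sum_congr rfl fun l _ => ?_))
  exact l2_pow_mulVec S D _ _

theorem exists_l2_input_le {ι : Type*} [Fintype ι] (L : (Fin d → ℝ) →ₗ[ℝ] ι → ℝ) :
    ∃ c, 0 ≤ c ∧ ∀ (u : Fin m → ℝ) (b : Fin d → ℝ), ‖u‖ ≤ S.Umax →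
      l2 (L (S.B *ᵥ u + b)) ≤ c + c * ‖b‖ := by
  obtain ⟨c, hc, h1⟩ := exists_l2_le_mul_norm L
  obtain ⟨c', hc', h2⟩ := exists_l2_le_mul_norm (L.comp S.B.mulVecLin)
  have hU := S.Umax_pos.le
  refine ⟨c + c' * S.Umax, by positivity, fun u b hu => ?_⟩
  rw [map_add]
  have h3 := h2 u
  have h4 := mul_le_mul_of_nonneg_left hu hc'
  have h5 : 0 ≤ c' * S.Umax * ‖b‖ := by positivity
  calc _ ≤ l2 (L (S.B *ᵥ u)) + l2 (L b) := l2_add_le _ _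
    _ ≤ c' * S.Umax + c * ‖b‖ := add_le_add (h3.trans h4) (h1 b)
    _ ≤ _ := by nlinarith

theorem reachMatrix_mulVec {n m : ℕ} (A : Matrix (Fin n) (Fin n) ℝ) (B : Matrix (Fin n) (Fin m) ℝ)
    (κ : ℕ) (f : Fin κ × Fin m → ℝ) : reachMatrix A B κ *ᵥ f
      = ∑ k : Fin κ, A ^ (κ - 1 - (k : ℕ)) *ᵥ (B *ᵥ fun a => f (k, a)) := by
  ext i
  rw [Finset.sum_apply, Matrix.mulVec, dotProduct, Fintype.sum_prod_type]
  refine Finset.sum_congr rfl fun k _ => ?_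
  rw [Matrix.mulVec_mulVec]
  rfl

/-- The row constraint bounds `η + p Λ 𝟙` by `Umax`, because `|p - 1/2| ≤ 1/2` for a probability
`p`. -/
theorem exists_norm_drift_le (p : ℝ) (hp : 0 ≤ p) (hp1 : p ≤ 1) : ∃ b, 0 ≤ b ∧
    ∀ z : Decision d m N, Causal z → S.ControlAdmissible z → ∀ j, |S.drift D p z j| ≤ b := by
  let L : (Fin κ × Fin m → ℝ) →ₗ[ℝ] Fin dO → ℝ :=
    ((D.Ao ^ κ)ᵀ).mulVecLin.comp (reachMatrix D.Ao (D.Bo S.B) κ).mulVecLin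
  obtain ⟨c, hc, h⟩ := exists_l2_le_mul_norm L
  refine ⟨c * S.Umax, mul_nonneg hc S.Umax_pos.le, fun z hz hadm j => ?_⟩
  have h1 : |S.drift D p z j| ≤ l2 (S.drift D p z) := by
    have := PiLp.norm_apply_le (WithLp.toLp 2 (S.drift D p z)) j
    exact this
  refine h1.trans ((h _).trans (mul_le_mul_of_nonneg_left ?_ hc))
  refine (pi_norm_le_iff_of_nonneg S.Umax_pos.le).mpr fun q => ?_
  set i : Fin N × Fin m := (Fin.castLE S.κ_le_N q.1, q.2)
  have h2 := (controlAdmissible_iff S z hz).mp hadm i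
  have h3 : 0 ≤ (∑ c, |z.2.1 i c|) * S.satBound :=
    mul_nonneg (Finset.sum_nonneg fun _ _ => abs_nonneg _) S.satBound_nonneg
  have h4 : (z.1 + p • (z.2.2 *ᵥ fun _ => (1 : ℝ))) i
      = (z.1 i + 1 / 2 * ∑ l, z.2.2 i l) + (p - 1 / 2) * ∑ l, z.2.2 i l := by
    simp only [Pi.add_apply, Pi.smul_apply, smul_eq_mul, Matrix.mulVec, dotProduct, mul_one]
    ring
  have h5 : |(p - 1 / 2) * ∑ l, z.2.2 i l| ≤ 1 / 2 * ∑ l, |z.2.2 i l| := by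
    rw [abs_mul]
    refine mul_le_mul ?_ (Finset.abs_sum_le_sum_abs _ _) (abs_nonneg _) (by norm_num)
    rw [abs_le]; constructor <;> linarith
  rw [h4, Real.norm_eq_abs]
  linarith [abs_add_le (z.1 i + 1 / 2 * ∑ l, z.2.2 i l) ((p - 1 / 2) * ∑ l, z.2.2 i l)]

/-- Coordinates beyond `r + ε` contribute at most `-ζ` times their modulus by (D). The others are
bounded, and the constant also pays for including them in the `ℓ¹` norm, which dominates the
Euclidean one. -/
theorem dotProduct_drift_le {p r ε ζ b : ℝ} (hrε : 0 ≤ r + ε) (hζ : 0 ≤ ζ) {x : Fin d → ℝ}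
    {z : Decision d m N} (hz : S.DriftConstraints D p r ε ζ x z)
    (hb : ∀ j, |S.drift D p z j| ≤ b) :
    D.orthState x ⬝ᵥ S.drift D p z ≤ -ζ * l2 (D.orthState x) + dO * ((r + ε) * (ζ + b)) := by
  have h1 : ∀ j, D.orthState x j * S.drift D p z j
      ≤ -ζ * |D.orthState x j| + (r + ε) * (ζ + b) := by
    intro j
    have hbj := hb j
    have hb0 : 0 ≤ b := (abs_nonneg _).trans hbj
    have hK : 0 ≤ (r + ε) * (ζ + b) := by positivity
    set y := D.orthState x j
    set v := S.drift D p z j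
    by_cases h1 : r + ε ≤ y
    · have h2 := (hz j).1 h1
      rw [abs_of_nonneg (hrε.trans h1)]
      nlinarith [mul_le_mul_of_nonneg_left h2 (hrε.trans h1)]
    by_cases h2 : y ≤ -r - ε
    · have h3 := (hz j).2 h2
      have h4 : y ≤ 0 := by linarith
      rw [abs_of_nonpos h4]
      nlinarith [mul_le_mul_of_nonneg_left h3 (neg_nonneg.mpr h4)]
    · have h3 : |y| ≤ r + ε := by rw [abs_le]; constructor <;> linarith
      have h4 : y * v ≤ |y| * |v| := by rw [← abs_mul]; exact le_abs_self _
      have h5 : |y| * |v| ≤ (r + ε) * b := mul_le_mul h3 hbj (abs_nonneg _) hrε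
      have h6 : ζ * |y| ≤ ζ * (r + ε) := mul_le_mul_of_nonneg_left h3 hζ
      linarith
  have h2 := mul_le_mul_of_nonneg_left (l2_le_sum_abs (D.orthState x)) hζ
  calc _ ≤ ∑ j : Fin dO, (-ζ * |D.orthState x j| + (r + ε) * (ζ + b)) :=
        Finset.sum_le_sum fun j _ => h1 j
    _ = -(ζ * ∑ j, |D.orthState x j|) + dO * ((r + ε) * (ζ + b)) := by
        rw [Finset.sum_add_distrib, ← Finset.mul_sum]; simp
    _ ≤ _ := by linarith

end OrthogonalPart

/-! ### Fourth moments and mean input over one window -/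

section Mean

variable {Ω : Type*} [MeasurableSpace Ω] {P : Measure Ω} [IsProbabilityMeasure P]
  {d m N κ : ℕ} {p : ℝ} {ν : ℕ → Ω → ℝ} {w : ℕ → Ω → Fin d → ℝ} (S : Problem d m N κ)
  {dO dS : ℕ} (D : OrthSchurDecomp S.A dO dS)

namespace IsDisturbance

variable (hd : IsDisturbance P p ν w)
include hd

/-- Convexity of the fourth power reduces the claim to the fourth moment of a single noise vector,
and identical distribution makes the bound uniform in time. -/
theorem exists_bound_window (κ : ℕ) (c₀ c : ℝ) : ∃ M, ∀ t,
    Integrable (fun ω => (∑ l ∈ Finset.range κ, (c₀ + c * ‖w (t + l) ω‖)) ^ 4) P ∧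
      ∫ ω, (∑ l ∈ Finset.range κ, (c₀ + c * ‖w (t + l) ω‖)) ^ 4 ∂P ≤ M := by
  let h : ℕ → Ω → ℝ := fun t ω =>
    ∑ l ∈ Finset.range κ, (κ : ℝ) ^ 3 * (8 * (c₀ ^ 4 + c ^ 4 * ‖w (t + l) ω‖ ^ 4))
  have hi : ∀ t l, Integrable
      (fun ω => (κ : ℝ) ^ 3 * (8 * (c₀ ^ 4 + c ^ 4 * ‖w (t + l) ω‖ ^ 4))) P := fun t l =>
    (((integrable_const _).add ((hd.w_fourth (t + l)).const_mul _)).const_mul _).const_mul _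
  have hw4 : ∀ s, ∫ ω, ‖w s ω‖ ^ 4 ∂P = ∫ ω, ‖w 0 ω‖ ^ 4 ∂P := fun s =>
    ((hd.w_ident s).comp (u := fun v => ‖v‖ ^ 4) (by fun_prop)).integral_eq
  have hpt : ∀ t ω, (∑ l ∈ Finset.range κ, (c₀ + c * ‖w (t + l) ω‖)) ^ 4 ≤ h t ω := by
    intro t ω
    have h2 : ∀ a b : ℝ, (a + b) ^ 4 ≤ 8 * (a ^ 4 + b ^ 4) := by
      intro a b
      nlinarith [sq_nonneg (a - b), sq_nonneg (a + b), sq_nonneg (a ^ 2 - b ^ 2),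
        mul_nonneg (sq_nonneg (a - b)) (sq_nonneg (a + b)),
        mul_nonneg (sq_nonneg (a - b)) (sq_nonneg (a - b))]
    have h3 : ∀ f : ℕ → ℝ, (∑ l ∈ Finset.range κ, f l) ^ 4
        ≤ (κ : ℝ) ^ 3 * ∑ l ∈ Finset.range κ, f l ^ 4 := by
      intro f
      have e1 : (∑ l ∈ Finset.range κ, f l) ^ 2 ≤ κ * ∑ l ∈ Finset.range κ, f l ^ 2 := by
        simpa using sq_sum_le_card_mul_sum_sq (s := Finset.range κ) (f := f)
      have e2 : (∑ l ∈ Finset.range κ, f l ^ 2) ^ 2 ≤ κ * ∑ l ∈ Finset.range κ, (f l ^ 2) ^ 2 := by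
        simpa using sq_sum_le_card_mul_sum_sq (s := Finset.range κ) (f := fun l => f l ^ 2)
      calc _ = ((∑ l ∈ Finset.range κ, f l) ^ 2) ^ 2 := by ring
        _ ≤ (κ * ∑ l ∈ Finset.range κ, f l ^ 2) ^ 2 := pow_le_pow_left₀ (sq_nonneg _) e1 2
        _ = κ ^ 2 * (∑ l ∈ Finset.range κ, f l ^ 2) ^ 2 := by ring
        _ ≤ κ ^ 2 * (κ * ∑ l ∈ Finset.range κ, (f l ^ 2) ^ 2) :=
          mul_le_mul_of_nonneg_left e2 (sq_nonneg _)
        _ = κ ^ 3 * ∑ l ∈ Finset.range κ, (f l ^ 2) ^ 2 := by ring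
        _ = _ := by simp only [← pow_mul]
    refine (h3 _).trans ?_
    simp only [h, ← Finset.mul_sum]
    refine mul_le_mul_of_nonneg_left ?_ (by positivity)
    rw [Finset.mul_sum]
    refine Finset.sum_le_sum fun l _ => ?_
    rw [← mul_pow]
    exact h2 _ _
  have hhi : ∀ t, Integrable (h t) P := fun t => integrable_finsetSum _ fun l _ => hi t l
  refine ⟨∑ l ∈ Finset.range κ,
    (κ : ℝ) ^ 3 * (8 * (c₀ ^ 4 + c ^ 4 * ∫ ω, ‖w 0 ω‖ ^ 4 ∂P)), fun t => ?_⟩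
  have hInt : Integrable (fun ω => (∑ l ∈ Finset.range κ, (c₀ + c * ‖w (t + l) ω‖)) ^ 4) P := by
    refine (hhi t).mono' ?_ (Filter.Eventually.of_forall fun ω => ?_)
    · refine (Measurable.pow_const ?_ 4).aestronglyMeasurable
      exact Finset.measurable_sum _ fun l _ => ((hd.w_measurable _).norm.const_mul _).const_add _
    · rw [Real.norm_of_nonneg (by positivity)]
      exact hpt t ω
  refine ⟨hInt, (integral_mono hInt (hhi t) (hpt t)).trans (le_of_eq ?_)⟩
  rw [integral_finsetSum _ fun l _ => hi t l]
  refine Finset.sum_congr rfl fun l _ => ?_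
  rw [integral_const_mul, integral_const_mul,
    integral_add (integrable_const _) ((hd.w_fourth _).const_mul _), integral_const_mul, hw4]
  simp

theorem integrable_block {z : Decision d m N} (hz : S.ControlAdmissible z) (t k : ℕ) :
    Integrable (fun ω => block (applied κ z (S.satStack (shift w t ω)) (shift ν t ω)) k) P := by
  have hm := measurable_block_applied S (z := fun _ : Ω => z) (fun _ => measurable_const)
    (fun _ _ => measurable_const) (fun _ _ => measurable_const)
    (measurable_shift hd.w_measurable t) (measurable_shift hd.ν_measurable t) k
  refine Integrable.of_bound hm.aestronglyMeasurable S.Umax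
    (Filter.Eventually.of_forall fun ω => ?_)
  by_cases hk : k < N
  · exact hz _ _ (norm_satStack_le S _) (fun _ => hd.ν_bernoulli _ _) k hk
  · refine (pi_norm_le_iff_of_nonneg S.Umax_pos.le).mpr fun a => ?_
    simpa only [block, dif_neg hk, norm_zero] using S.Umax_pos.le

/-- Within the first `κ` blocks the mask contributes the factor `ν_k`. The saturated noise averages
out, and each product `ν_k ν_l` that occurs has mean `p²`. -/
theorem integral_block {z : Decision d m N} (hz : Causal z) (hadm : S.ControlAdmissible z)
    (t : ℕ) (k : Fin κ) :
    ∫ ω, block (applied κ z (S.satStack (shift w t ω)) (shift ν t ω)) k ∂P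
      = p • fun a => (z.1 + p • (z.2.2 *ᵥ fun _ => (1 : ℝ))) (Fin.castLE S.κ_le_N k, a) := by
  have hk : (k : ℕ) < N := k.2.trans_le S.κ_le_N
  ext a
  rw [eval_integral fun b => (hd.integrable_block S hadm t k).eval b]
  set q : Fin N × Fin m := (⟨k, hk⟩, a)
  have hν1 : ∀ s, Integrable (fun ω => ν s ω) P := fun s =>
    hd.integrable_dropout s (f := fun f => f 0) (by fun_prop)
  have hsat : ∀ c, Integrable (fun ω => shift ν t ω k * S.satStack (shift w t ω) c) P ∧
      ∫ ω, shift ν t ω k * S.satStack (shift w t ω) c ∂P = 0 := by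
    intro c
    have hc : Continuous fun f : ℕ → ℝ => f k := by fun_prop
    have hm := measurable_satStack S c
    have hi := hd.integrable_sat S t c
    refine ⟨hd.integrable_mul t hc hm hi, ?_⟩
    rw [hd.integral_mul t hc hm hi, hd.integral_sat S t c, mul_zero]
  have hdrop : ∀ l : Fin (N - 1), Integrable (fun ω => z.2.2 q l * (shift ν t ω k * shift ν t ω l)) P ∧
      ∫ ω, z.2.2 q l * (shift ν t ω k * shift ν t ω l) ∂P = z.2.2 q l * (p * p) := by
    intro l
    refine ⟨(hd.integrable_dropout t (f := fun f => f k * f l) (by fun_prop)).const_mul _, ?_⟩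
    -- Strict causality leaves only `l < k`, where the two dropouts are independent; the diagonal,
    -- where `ν_k ^ 2` would have mean `p`, has coefficient zero.
    by_cases hl : (l : ℕ) < k
    · rw [integral_const_mul]
      congr 1
      have hind : IndepFun (ν (t + k)) (ν (t + l)) P := hd.ν_indep.indepFun (by omega)
      have := hind.integral_fun_mul_eq_mul_integral (hν1 _).aestronglyMeasurable
        (hν1 _).aestronglyMeasurable
      rw [hd.ν_mean, hd.ν_mean] at this
      exact this
    · rw [show z.2.2 q l = 0 from hz.2 ⟨k, hk⟩ a l (not_lt.mp hl)]
      simp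
  have hexp : ∀ ω, block (applied κ z (S.satStack (shift w t ω)) (shift ν t ω)) k a
      = z.1 q * shift ν t ω k
        + ∑ c, z.2.1 q c * (shift ν t ω k * S.satStack (shift w t ω) c)
        + ∑ l : Fin (N - 1), z.2.2 q l * (shift ν t ω k * shift ν t ω l) := by
    intro ω
    rw [block_apply _ hk, applied_apply, computed_apply, if_pos k.2]
    simp only [mul_add, Finset.mul_sum]
    congr 1
    · congr 1
      · exact mul_comm _ _
      · exact Finset.sum_congr rfl fun c _ => mul_left_comm _ _ _
    · exact Finset.sum_congr rfl fun c _ => mul_left_comm _ _ _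
  simp only [hexp]
  have i1 : Integrable (fun ω => z.1 q * shift ν t ω k) P := (hν1 _).const_mul _
  have i2 : Integrable (fun ω => ∑ c, z.2.1 q c * (shift ν t ω k * S.satStack (shift w t ω) c)) P :=
    integrable_finsetSum _ fun c _ => (hsat c).1.const_mul _
  have i3 : Integrable (fun ω =>
      ∑ l : Fin (N - 1), z.2.2 q l * (shift ν t ω k * shift ν t ω l)) P :=
    integrable_finsetSum _ fun l _ => (hdrop l).1
  have e1 : ∫ ω, z.1 q * shift ν t ω k ∂P = z.1 q * p := by
    rw [integral_const_mul]
    exact congrArg _ (hd.ν_mean _)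
  have e2 : ∫ ω, ∑ c, z.2.1 q c * (shift ν t ω k * S.satStack (shift w t ω) c) ∂P = 0 := by
    rw [integral_finsetSum _ fun c _ => (hsat c).1.const_mul _]
    refine Finset.sum_eq_zero fun c _ => ?_
    rw [integral_const_mul, (hsat c).2, mul_zero]
  have e3 : ∫ ω, ∑ l : Fin (N - 1), z.2.2 q l * (shift ν t ω k * shift ν t ω l) ∂P
      = ∑ l, z.2.2 q l * (p * p) := by
    rw [integral_finsetSum _ fun l _ => (hdrop l).1]
    exact Finset.sum_congr rfl fun l _ => (hdrop l).2
  have i12 := i1.add i2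
  have e4 := integral_add i12 i3
  have e5 := integral_add i1 i2
  simp only [Pi.add_apply] at e4
  rw [e4, e5, e1, e2, e3]
  simp only [Pi.smul_apply, Pi.add_apply, smul_eq_mul, Matrix.mulVec, dotProduct, mul_one]
  rw [← Finset.sum_mul]
  change _ = p * (z.1 q + p * ∑ l, z.2.2 q l)
  ring

theorem integrable_noise_vector (t : ℕ) : Integrable (w t) P :=
  (hd.integrable_norm_pow t (k := 1) (by norm_num)).mono' (hd.w_measurable t).aestronglyMeasurable
    (Filter.Eventually.of_forall fun ω => by rw [pow_one])

/-- Transposing `Ao ^ κ` turns the mean input, which is `p` times a reachability sum, into the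
vector constrained by (D). -/
theorem integral_dot_orthInput {z : Decision d m N} (hz : Causal z) (hadm : S.ControlAdmissible z)
    (t : ℕ) (y : Fin dO → ℝ) :
    Integrable (fun ω => (D.Ao ^ κ *ᵥ y) ⬝ᵥ
      orthInput S D (applied κ z (S.satStack (shift w t ω)) (shift ν t ω)) (shift w t ω) κ) P ∧
    ∫ ω, (D.Ao ^ κ *ᵥ y) ⬝ᵥ
      orthInput S D (applied κ z (S.satStack (shift w t ω)) (shift ν t ω)) (shift w t ω) κ ∂P
      = p * (y ⬝ᵥ S.drift D p z) := by
  set y' := D.Ao ^ κ *ᵥ y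
  let φ : ℕ → (Fin d → ℝ) →L[ℝ] ℝ := fun l => LinearMap.toContinuousLinearMap
    ((dotProductBilin ℝ ℝ y').comp ((D.Ao ^ (κ - 1 - l)).mulVecLin.comp D.orthLin))
  have hφ : ∀ l v, φ l v = y' ⬝ᵥ D.Ao ^ (κ - 1 - l) *ᵥ D.orthLin v := fun l v => rfl
  have hexp : ∀ ω, y' ⬝ᵥ
      orthInput S D (applied κ z (S.satStack (shift w t ω)) (shift ν t ω)) (shift w t ω) κ
      = ∑ l ∈ Finset.range κ, φ l (S.B *ᵥ block (applied κ z (S.satStack (shift w t ω))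
          (shift ν t ω)) l + w (t + l) ω) := by
    intro ω
    rw [orthInput, dotProduct_sum]
    rfl
  let LB : (Fin m → ℝ) →L[ℝ] Fin d → ℝ := LinearMap.toContinuousLinearMap S.B.mulVecLin
  have hi : ∀ l, Integrable (fun ω => S.B *ᵥ block (applied κ z (S.satStack (shift w t ω))
      (shift ν t ω)) l + w (t + l) ω) P := fun l =>
    (LB.integrable_comp (hd.integrable_block S hadm t l)).add (hd.integrable_noise_vector (t + l))
  simp only [hexp]
  refine ⟨integrable_finsetSum _ fun l _ => (φ l).integrable_comp (hi l), ?_⟩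
  rw [integral_finsetSum _ fun l _ => (φ l).integrable_comp (hi l), Problem.drift,
    dotProduct_transpose_mulVec_eq, reachMatrix_mulVec, Finset.sum_range, dotProduct_sum,
    Finset.mul_sum]
  refine Finset.sum_congr rfl fun l _ => ?_
  rw [(φ l).integral_comp_comm (hi l)]
  have e1 : ∫ ω, S.B *ᵥ block (applied κ z (S.satStack (shift w t ω)) (shift ν t ω)) l
      + w (t + l) ω ∂P = S.B *ᵥ (p • fun a =>
        (z.1 + p • (z.2.2 *ᵥ fun _ => (1 : ℝ))) (Fin.castLE S.κ_le_N l, a)) := by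
    have e2 := integral_add (LB.integrable_comp (hd.integrable_block S hadm t l))
      (hd.integrable_noise_vector (t + l))
    rw [hd.w_mean, add_zero, LB.integral_comp_comm (hd.integrable_block S hadm t l),
      hd.integral_block S hz hadm t l] at e2
    exact e2
  rw [e1, hφ, orthLin_mulVec_control, Matrix.mulVec_smul, Matrix.mulVec_smul, dotProduct_smul,
    smul_eq_mul]

end IsDisturbance

end Mean

/-! ### Second moments bounded uniformly in time -/

section SecondMoments

variable {Ω : Type*} [MeasurableSpace Ω] {P : Measure Ω} [IsProbabilityMeasure P]

/-- Second moments that are bounded uniformly in time. -/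
def SecondMomentBounded (P : Measure Ω) (f : ℕ → Ω → ℝ) : Prop :=
  ∃ C : ℝ, ∀ t, Integrable (fun ω => f t ω ^ 2) P ∧ ∫ ω, f t ω ^ 2 ∂P ≤ C

namespace SecondMomentBounded

variable {f g : ℕ → Ω → ℝ}

theorem mono (hg : SecondMomentBounded P g) (hf : ∀ t, Measurable (f t))
    (h0 : ∀ t ω, 0 ≤ f t ω) (hle : ∀ t ω, f t ω ≤ g t ω) : SecondMomentBounded P f := by
  obtain ⟨C, hC⟩ := hg
  refine ⟨C, fun t => ?_⟩
  have hsq : ∀ ω, f t ω ^ 2 ≤ g t ω ^ 2 := fun ω => pow_le_pow_left₀ (h0 t ω) (hle t ω) 2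
  have hi : Integrable (fun ω => f t ω ^ 2) P :=
    (hC t).1.mono' ((hf t).pow_const 2).aestronglyMeasurable
      (Filter.Eventually.of_forall fun ω => by
        rw [Real.norm_of_nonneg (sq_nonneg _)]; exact hsq ω)
  exact ⟨hi, (integral_mono hi (hC t).1 hsq).trans (hC t).2⟩

theorem add (hf : SecondMomentBounded P f) (hg : SecondMomentBounded P g)
    (hfm : ∀ t, Measurable (f t)) (hgm : ∀ t, Measurable (g t)) :
    SecondMomentBounded P fun t ω => f t ω + g t ω := by
  obtain ⟨C, hC⟩ := hf
  obtain ⟨C', hC'⟩ := hg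
  refine ⟨2 * C + 2 * C', fun t => ?_⟩
  have hsq : ∀ ω, (f t ω + g t ω) ^ 2 ≤ 2 * f t ω ^ 2 + 2 * g t ω ^ 2 := fun ω => by
    nlinarith [sq_nonneg (f t ω - g t ω)]
  have hdom := ((hC t).1.const_mul 2).add ((hC' t).1.const_mul 2)
  have hi : Integrable (fun ω => (f t ω + g t ω) ^ 2) P :=
    hdom.mono' (((hfm t).add (hgm t)).pow_const 2).aestronglyMeasurable
      (Filter.Eventually.of_forall fun ω => by
        rw [Real.norm_of_nonneg (sq_nonneg _)]; exact hsq ω)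
  refine ⟨hi, (integral_mono hi hdom hsq).trans ?_⟩
  have e := integral_add ((hC t).1.const_mul 2) ((hC' t).1.const_mul 2)
  rw [integral_const_mul, integral_const_mul] at e
  refine e.le.trans ?_
  linarith [(hC t).2, (hC' t).2]

theorem const_mul (hf : SecondMomentBounded P f) (c : ℝ) :
    SecondMomentBounded P fun t ω => c * f t ω := by
  obtain ⟨C, hC⟩ := hf
  refine ⟨c ^ 2 * C, fun t => ?_⟩
  simp only [mul_pow]
  refine ⟨(hC t).1.const_mul _, ?_⟩
  rw [integral_const_mul]
  exact mul_le_mul_of_nonneg_left (hC t).2 (sq_nonneg c)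

theorem const (c : ℝ) : SecondMomentBounded P fun _ (_ : Ω) => c :=
  ⟨c ^ 2, fun _ => ⟨integrable_const _, by simp⟩⟩

/-- Weighted Cauchy–Schwarz: `(∑ c f)² ≤ (∑ c) (∑ c f²)`, with the weights bounded by their total
sum. -/
theorem convolution (hf : SecondMomentBounded P f) (hfm : ∀ t, Measurable (f t)) {c : ℕ → ℝ}
    (hc0 : ∀ k, 0 ≤ c k) (hc : Summable c) :
    SecondMomentBounded P fun t ω => ∑ l ∈ Finset.range t, c (t - 1 - l) * f l ω := by
  obtain ⟨C, hC⟩ := hf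
  have hK : ∀ t, ∑ l ∈ Finset.range t, c (t - 1 - l) ≤ ∑' k, c k := by
    intro t
    rw [Finset.sum_range_reflect]
    exact hc.sum_le_tsum _ fun k _ => hc0 k
  set K := ∑' k, c k
  have hK0 : 0 ≤ K := tsum_nonneg hc0
  have hC0 : 0 ≤ C := (integral_nonneg fun ω => sq_nonneg (f 0 ω)).trans (hC 0).2
  refine ⟨K * (K * C), fun t => ?_⟩
  have hsq : ∀ ω, (∑ l ∈ Finset.range t, c (t - 1 - l) * f l ω) ^ 2
      ≤ K * ∑ l ∈ Finset.range t, c (t - 1 - l) * f l ω ^ 2 := by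
    intro ω
    have h1 : (∑ l ∈ Finset.range t, c (t - 1 - l) * f l ω) ^ 2
        ≤ (∑ l ∈ Finset.range t, c (t - 1 - l)) *
          ∑ l ∈ Finset.range t, c (t - 1 - l) * f l ω ^ 2 :=
      Finset.sum_sq_le_sum_mul_sum_of_sq_le_mul _ (fun l _ => hc0 _)
        (fun l _ => mul_nonneg (hc0 _) (sq_nonneg _)) fun l _ => (by ring : _ = _).le
    exact h1.trans (mul_le_mul_of_nonneg_right (hK t)
      (Finset.sum_nonneg fun l _ => mul_nonneg (hc0 _) (sq_nonneg _)))
  have hsum : Integrable (fun ω => ∑ l ∈ Finset.range t, c (t - 1 - l) * f l ω ^ 2) P :=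
    integrable_finsetSum _ fun l _ => (hC l).1.const_mul _
  have hi : Integrable (fun ω => (∑ l ∈ Finset.range t, c (t - 1 - l) * f l ω) ^ 2) P := by
    refine (hsum.const_mul K).mono' ?_ (Filter.Eventually.of_forall fun ω => ?_)
    · exact (Measurable.pow_const (Finset.measurable_sum _ fun l _ =>
        (hfm l).const_mul _) 2).aestronglyMeasurable
    · rw [Real.norm_of_nonneg (sq_nonneg _)]; exact hsq ω
  refine ⟨hi, (integral_mono hi (hsum.const_mul K) hsq).trans ?_⟩
  rw [integral_const_mul, integral_finsetSum _ fun l _ => (hC l).1.const_mul _]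
  refine mul_le_mul_of_nonneg_left ?_ hK0
  calc _ ≤ ∑ l ∈ Finset.range t, c (t - 1 - l) * C := by
        refine Finset.sum_le_sum fun l _ => ?_
        rw [integral_const_mul]
        exact mul_le_mul_of_nonneg_left (hC l).2 (hc0 _)
    _ = (∑ l ∈ Finset.range t, c (t - 1 - l)) * C := by rw [Finset.sum_mul]
    _ ≤ _ := mul_le_mul_of_nonneg_right (hK t) hC0

theorem of_lintegral (hfm : ∀ t, Measurable (f t)) {C : ENNReal} (hC : C ≠ ⊤)
    (h : ∀ t, ∫⁻ ω, ENNReal.ofReal (f t ω ^ 2) ∂P ≤ C) : SecondMomentBounded P f := by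
  refine ⟨C.toReal, fun t => ?_⟩
  have h0 : 0 ≤ᵐ[P] fun ω => f t ω ^ 2 := Filter.Eventually.of_forall fun ω => sq_nonneg _
  have hm : AEStronglyMeasurable (fun ω => f t ω ^ 2) P :=
    ((hfm t).pow_const 2).aestronglyMeasurable
  refine ⟨⟨hm, (hasFiniteIntegral_iff_ofReal h0).mpr ((h t).trans_lt hC.lt_top)⟩, ?_⟩
  rw [integral_eq_lintegral_of_nonneg_ae h0 hm]
  exact ENNReal.toReal_mono hC (h t)

end SecondMomentBounded

theorem IsDisturbance.secondMomentBounded_window {d : ℕ} {p : ℝ} {ν : ℕ → Ω → ℝ}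
    {w : ℕ → Ω → Fin d → ℝ} (hd : IsDisturbance P p ν w) (κ : ℕ) (c₀ c : ℝ) :
    SecondMomentBounded P fun t ω => ∑ l ∈ Finset.range κ, (c₀ + c * ‖w (t + l) ω‖) := by
  obtain ⟨M, hM⟩ := hd.exists_bound_window κ c₀ c
  refine ⟨1 + M, fun t => ?_⟩
  have hdom := (integrable_const (1 : ℝ)).add (hM t).1
  have hsq : ∀ ω, (∑ l ∈ Finset.range κ, (c₀ + c * ‖w (t + l) ω‖)) ^ 2
      ≤ 1 + (∑ l ∈ Finset.range κ, (c₀ + c * ‖w (t + l) ω‖)) ^ 4 := fun ω => by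
    nlinarith [sq_nonneg ((∑ l ∈ Finset.range κ, (c₀ + c * ‖w (t + l) ω‖)) ^ 2 - 1)]
  have hi : Integrable (fun ω => (∑ l ∈ Finset.range κ, (c₀ + c * ‖w (t + l) ω‖)) ^ 2) P := by
    refine hdom.mono' ?_ (Filter.Eventually.of_forall fun ω => ?_)
    · refine (Measurable.pow_const ?_ 2).aestronglyMeasurable
      exact Finset.measurable_sum _ fun l _ => ((hd.w_measurable _).norm.const_mul _).const_add _
    · rw [Real.norm_of_nonneg (sq_nonneg _)]; exact hsq ω
  refine ⟨hi, (integral_mono hi hdom hsq).trans ?_⟩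
  refine (integral_add (integrable_const (1 : ℝ)) (hM t).1).le.trans ?_
  simpa using (hM t).2

end SecondMoments

/-! ### Mean-square boundedness of the closed loop -/

section ClosedLoop

variable {Ω : Type*} [mΩ : MeasurableSpace Ω] {P : Measure Ω} [IsProbabilityMeasure P]
  {d m N κ : ℕ} {p : ℝ} {ν : ℕ → Ω → ℝ} {w : ℕ → Ω → Fin d → ℝ} (S : Problem d m N κ)
  {dO dS : ℕ} (D : OrthSchurDecomp S.A dO dS)

theorem measurable_linearMap {ι : Type*} [Fintype ι] (L : (Fin d → ℝ) →ₗ[ℝ] ι → ℝ) :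
    Measurable L := (L.continuous_of_finiteDimensional).measurable

theorem measurable_predicted {α : Type*} [MeasurableSpace α] {x : α → Fin d → ℝ}
    (hx : Measurable x) {u : α → Fin N × Fin m → ℝ} (hu : ∀ k, Measurable fun a => block (u a) k)
    {b : α → ℕ → Fin d → ℝ} (hb : Measurable b) (k : ℕ) :
    Measurable fun a => S.predicted (x a) (u a) (b a) k := by
  induction k with
  | zero => exact hx
  | succ k ih =>
    exact ((measurable_mulVec _ ih).add (measurable_mulVec _ (hu k))).add
      ((measurable_pi_apply k).comp hb)

/-- Applies the drift criterion at recalculation times, with `V` the norm of the orthogonal part.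
Feasibility supplies the negative mean through (D), and the control bound dominates the increments
by the noise. -/
theorem exists_lintegral_orth_le (hd : IsDisturbance P p ν w) {r ε ζ : ℝ} (hr : 0 < r)
    (hε : 0 < ε) (hζ : 0 < ζ) {π : ℕ → (Fin d → ℝ) → Decision d m N}
    (hπ : ∀ n, MeasurableRule (π n)) (hfeas : ∀ n x, π n x ∈ S.ocpFeasible D p r ε ζ x)
    (x₀ : Fin d → ℝ) : ∃ C : ENNReal, C ≠ ⊤ ∧ ∀ n,
      ∫⁻ ω, ENNReal.ofReal (l2 (D.orthLin (S.loop ν w π x₀ ω (n * κ)).1) ^ 2) ∂P ≤ C := by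
  obtain ⟨c, hc, hin⟩ := exists_l2_input_le S D.orthLin
  obtain ⟨b, hb0, hb⟩ := exists_norm_drift_le S D p hd.p_pos.le hd.p_le_one
  set a : ℝ := p * ζ with ha_def
  have ha : 0 < a := mul_pos hd.p_pos hζ
  set C₁ : ℝ := p * (dO * ((r + ε) * (ζ + b)))
  -- The extra `1 + a / 4` lets `Y` dominate the input norm, absorb the age increment and stay above
  -- one.
  set c₀ : ℝ := 1 + a / 4 + c with hc₀
  obtain ⟨M, hM⟩ := hd.exists_bound_window κ c₀ c
  let Y : ℕ → Ω → ℝ := fun t ω => ∑ l ∈ Finset.range κ, (c₀ + c * ‖w (t + l) ω‖)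
  have hYge : ∀ t ω, 1 + a / 4 + ∑ l ∈ Finset.range κ, (c + c * ‖w (t + l) ω‖) ≤ Y t ω := by
    intro t ω
    have hκ : (1 : ℝ) ≤ κ := by exact_mod_cast S.one_le_κ
    have e : Y t ω = κ * (1 + a / 4) + ∑ l ∈ Finset.range κ, (c + c * ‖w (t + l) ω‖) := by
      simp only [Y, hc₀, add_assoc, Finset.sum_add_distrib, Finset.sum_const, Finset.card_range,
        nsmul_eq_mul]
      ring
    rw [e]
    nlinarith
  have hsum0 : ∀ t ω, 0 ≤ ∑ l ∈ Finset.range κ, (c + c * ‖w (t + l) ω‖) := fun t ω =>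
    Finset.sum_nonneg fun l _ => by positivity
  have hY1 : ∀ t ω, 1 ≤ Y t ω := fun t ω => by linarith [hYge t ω, hsum0 t ω]
  -- The threshold makes the three lower bounds on `s` in the fourth-power lemma hold outside the
  -- ball, and puts the initial state inside it.
  set J : ℝ := max (max 1 (2 * (2 * C₁ + M) / a)) (max (11 * M / (2 * a))
    (l2 (D.orthLin x₀))) with hJ
  have hJ1 : 1 ≤ J := (le_max_left _ _).trans (le_max_left _ _)
  have hJ2 : 2 * (2 * C₁ + M) / a ≤ J := (le_max_right _ _).trans (le_max_left _ _)
  have hJ3 : 11 * M / (2 * a) ≤ J := (le_max_left _ _).trans (le_max_right _ _)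
  have hJ4 : l2 (D.orthLin x₀) ≤ J := (le_max_right _ _).trans (le_max_right _ _)
  let u : ℕ → (Fin d → ℝ) × ((ℕ → ℝ) × (ℕ → Fin d → ℝ)) → Fin N × Fin m → ℝ := fun n q =>
    applied κ (π n q.1) (S.satStack q.2.2) q.2.1
  let Φ : ℕ → (Fin d → ℝ) × ((ℕ → ℝ) × (ℕ → Fin d → ℝ)) → ℝ := fun n q =>
    l2 (D.orthLin (S.predicted q.1 (u n q) q.2.2 κ))
  let ξ : ℕ → Ω → (ℕ → ℝ) × (ℕ → Fin d → ℝ) := fun n ω =>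
    (shift ν (n * κ) ω, shift w (n * κ) ω)
  have hV : Measurable fun x : Fin d → ℝ => l2 (D.orthLin x) :=
    continuous_l2.measurable.comp (measurable_linearMap _)
  have hΦm : ∀ n, Measurable (Φ n) := fun n =>
    hV.comp (measurable_predicted S measurable_fst (fun k =>
      measurable_block_applied S (fun i => ((hπ n).1 i).comp measurable_fst)
        (fun i j => ((hπ n).2.1 i j).comp measurable_fst)
        (fun i j => ((hπ n).2.2 i j).comp measurable_fst)
        (measurable_snd.comp measurable_snd) (measurable_fst.comp measurable_snd) k)
      (measurable_snd.comp measurable_snd) κ)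
  have hΦ : ∀ n x ω, Φ n (x, ξ n ω) = l2 (D.Ao ^ κ *ᵥ D.orthLin x
      + orthInput S D (u n (x, ξ n ω)) (shift w (n * κ) ω) κ) := by
    intro n x ω
    simp only [Φ, orthLin_predicted, ξ]
  have hη : ∀ n x ω, l2 (orthInput S D (u n (x, ξ n ω)) (shift w (n * κ) ω) κ) + a / 4 + 1
      ≤ Y (n * κ) ω := by
    intro n x ω
    refine le_trans ?_ (hYge _ _)
    have h1 := (l2_orthInput_le S D (u n (x, ξ n ω)) (shift w (n * κ) ω) κ).trans
      (Finset.sum_le_sum fun l hl => hin _ (shift w (n * κ) ω l) ((hfeas n x).2.1 _ _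
        (norm_satStack_le S (shift w (n * κ) ω)) (fun k => hd.ν_bernoulli (n * κ + k) ω) l
        ((Finset.mem_range.mp hl).trans_le S.κ_le_N)))
    have h2 : ∑ l ∈ Finset.range κ, (c + c * ‖shift w (n * κ) ω l‖)
        = ∑ l ∈ Finset.range κ, (c + c * ‖w (n * κ + l) ω‖) := rfl
    rw [h2] at h1
    linarith
  have hU : ∀ n x ω, |Φ n (x, ξ n ω) - l2 (D.orthLin x)| + a / 4 ≤ Y (n * κ) ω := by
    intro n x ω
    have h1 := abs_l2_add_sub_le (D.Ao ^ κ *ᵥ D.orthLin x)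
      (orthInput S D (u n (x, ξ n ω)) (shift w (n * κ) ω) κ)
    rw [l2_pow_mulVec] at h1
    rw [hΦ]
    linarith [hη n x ω]
  refine exists_lintegral_sq_le_of_drift (P := P) (𝓕 := fun n => pastInfo ν w (n * κ))
    (X := fun n ω => (S.loop ν w π x₀ ω (n * κ)).1) (ξ := ξ) (Φ := Φ)
    (V := fun x => l2 (D.orthLin x)) (J := J) (δ := a / 4)
    (M := ENNReal.ofReal ((J + 1) ^ 4 * M)) (fun n => hd.pastInfo_le _)
    (fun n => pastInfo_mono ν w (Nat.mul_le_mul_right κ (Nat.le_succ n)))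
    (fun n => measurable_pastInfo_loop S hπ (fun n x => (hfeas n x).1) x₀ _)
    (fun n => (measurable_shift hd.ν_measurable _).prodMk (measurable_shift hd.w_measurable _))
    (fun n => hd.indep_pastInfo _) hV (fun x => l2_nonneg _) hΦm ?_ (by positivity) ?_ ?_
    ENNReal.ofReal_ne_top ?_
  · intro n ω
    have := loop_fst_add S ν w π x₀ ω n κ le_rfl
    simp only [Nat.succ_mul]
    rw [this]
  · intro ω
    simpa [Problem.loop] using hJ4
  · intro n k x hx
    have hg := hd.integral_dot_orthInput S D (hfeas n x).1 (hfeas n x).2.1 (n * κ) (D.orthLin x)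
    have hs : 0 < l2 (D.orthLin x) := by linarith
    have key := lintegral_fourth_le_of_drift (P := P) (s := l2 (D.orthLin x)) (a := a) (C := C₁)
      (M := M) (τ := l2 (D.orthLin x) + a / 4 * k) (U := fun ω => Φ n (x, ξ n ω))
      (Y := Y (n * κ)) hg.1 (hM _).1 ha ?_ (hM _).2 (hY1 _) (hU n x) ?_ (by linarith) ?_ ?_ ?_
    · refine le_trans (le_of_eq (lintegral_congr fun ω => ?_)) key
      congr 2
      ring
    · rw [hg.2]
      have h1 := dotProduct_drift_le S D (by positivity) hζ.le (hfeas n x).2.2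
        (hb _ (hfeas n x).1 (hfeas n x).2.1)
      have h2 := mul_le_mul_of_nonneg_left h1 hd.p_pos.le
      refine h2.trans (le_of_eq ?_)
      simp only [a, C₁]
      change p * (-ζ * l2 (D.orthLin x) + _) = _
      ring
    · intro ω
      rw [hΦ, l2_add_sq, l2_pow_mulVec]
      refine add_le_add le_rfl (pow_le_pow_left₀ (l2_nonneg _) ?_ 2)
      linarith [hη n x ω]
    · rw [div_le_iff₀ ha] at hJ2
      nlinarith
    · rw [div_le_iff₀ (by positivity)] at hJ3
      nlinarith
    · have : 0 ≤ a / 4 * (k : ℝ) := by positivity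
      linarith
  · intro n x hx
    have hJ0 : 0 ≤ J := by linarith
    -- From `V x ≤ J` and `1 ≤ Y` follows `Φ + a / 4 ≤ J + Y ≤ (J + 1) * Y`.
    have h1 : ∀ ω, (Φ n (x, ξ n ω) + a / 4) ^ 4 ≤ (J + 1) ^ 4 * Y (n * κ) ω ^ 4 := by
      intro ω
      rw [← mul_pow]
      refine pow_le_pow_left₀ (add_nonneg (l2_nonneg _) (by positivity)) ?_ 4
      have h2 := hU n x ω
      have h3 := le_abs_self (Φ n (x, ξ n ω) - l2 (D.orthLin x))
      have h4 := hY1 (n * κ) ω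
      nlinarith
    calc _ ≤ ∫⁻ ω, ENNReal.ofReal ((J + 1) ^ 4 * Y (n * κ) ω ^ 4) ∂P :=
          lintegral_mono fun ω => ENNReal.ofReal_le_ofReal (h1 ω)
      _ = ENNReal.ofReal (∫ ω, (J + 1) ^ 4 * Y (n * κ) ω ^ 4 ∂P) :=
          (ofReal_integral_eq_lintegral_ofReal ((hM _).1.const_mul _)
            (Filter.Eventually.of_forall fun ω => by positivity)).symm
      _ ≤ _ := by
          rw [integral_const_mul]
          exact ENNReal.ofReal_le_ofReal (mul_le_mul_of_nonneg_left (hM _).2 (by positivity))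

/-- The Schur stable part of the state as a linear map. -/
def OrthSchurDecomp.schurLin {d dO dS : ℕ} {A : Matrix (Fin d) (Fin d) ℝ}
    (D : OrthSchurDecomp A dO dS) : (Fin d → ℝ) →ₗ[ℝ] Fin dS → ℝ where
  toFun x j := (D.T *ᵥ x) (Sum.inr j)
  map_add' x y := by
    ext j; simp [Matrix.mulVec_add]
  map_smul' c x := by
    ext j; simp [Matrix.mulVec_smul]

theorem schurLin_mulVec (x : Fin d → ℝ) : D.schurLin (S.A *ᵥ x) = D.As *ᵥ D.schurLin x := by
  ext j
  change (D.T *ᵥ (S.A *ᵥ x)) (Sum.inr j) = _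
  rw [Matrix.mulVec_mulVec, D.mul_eq, ← Matrix.mulVec_mulVec, Matrix.fromBlocks_mulVec]
  simp only [Matrix.zero_mulVec, zero_add, Sum.elim_inr]
  rfl

/-- A crude entrywise bound suffices, since the entries of the powers of `As` are summable. -/
theorem l2_mulVec_le {I : Type*} [Fintype I] (A : Matrix I I ℝ) (v : I → ℝ) :
    l2 (A *ᵥ v) ≤ (∑ i, ∑ j, |A i j|) * l2 v := by
  refine (l2_le_sum_abs _).trans ?_
  rw [Finset.sum_mul]
  refine Finset.sum_le_sum fun i _ => ?_
  rw [Finset.sum_mul]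
  refine (Finset.abs_sum_le_sum_abs _ _).trans (Finset.sum_le_sum fun j _ => ?_)
  rw [abs_mul]
  exact mul_le_mul_of_nonneg_left (PiLp.norm_apply_le (WithLp.toLp 2 v) j) (abs_nonneg _)

theorem exists_l2_le_orth_add_schur :
    ∃ c, 0 ≤ c ∧ ∀ x, l2 x ≤ c * (l2 (D.orthLin x) + l2 (D.schurLin x)) := by
  obtain ⟨c, hc, h⟩ := exists_l2_le_mul_norm D.Tinv.mulVecLin
  refine ⟨c, hc, fun x => ?_⟩
  have h1 := h (D.T *ᵥ x)
  rw [Matrix.mulVecLin_apply, Matrix.mulVec_mulVec, D.inv_mul, Matrix.one_mulVec] at h1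
  refine h1.trans (mul_le_mul_of_nonneg_left ?_ hc)
  have h2 := l2_nonneg (D.orthLin x)
  have h3 := l2_nonneg (D.schurLin x)
  refine (pi_norm_le_iff_of_nonneg (add_nonneg h2 h3)).mpr fun j => ?_
  rcases j with j | j
  · have : ‖(D.T *ᵥ x) (Sum.inl j)‖ ≤ l2 (D.orthLin x) :=
      PiLp.norm_apply_le (WithLp.toLp 2 (D.orthLin x)) j
    linarith
  · have : ‖(D.T *ᵥ x) (Sum.inr j)‖ ≤ l2 (D.schurLin x) :=
      PiLp.norm_apply_le (WithLp.toLp 2 (D.schurLin x)) j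
    linarith

theorem meanSquareBounded_loop (hd : IsDisturbance P p ν w) {r ε ζ : ℝ} (hr : 0 < r)
    (hε : 0 < ε) (hζ : 0 < ζ) {π : ℕ → (Fin d → ℝ) → Decision d m N}
    (hπ : ∀ n, MeasurableRule (π n)) (hfeas : ∀ n x, π n x ∈ S.ocpFeasible D p r ε ζ x)
    (x₀ : Fin d → ℝ) : MeanSquareBounded P fun t ω => (S.loop ν w π x₀ ω t).1 := by
  set X : ℕ → Ω → Fin d → ℝ := fun t ω => (S.loop ν w π x₀ ω t).1 with hX
  have hXm : ∀ t, Measurable (X t) := fun t =>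
    (measurable_loop S hd.ν_measurable hd.w_measurable hπ x₀ t).fst
  have hl2m : ∀ {ι : Type} [Fintype ι] (L : (Fin d → ℝ) →ₗ[ℝ] ι → ℝ) (t : ℕ),
      Measurable fun ω => l2 (L (X t ω)) := fun L t =>
    continuous_l2.measurable.comp ((measurable_linearMap L).comp (hXm t))
  let g : ℕ → Ω → Fin d → ℝ := fun t ω =>
    S.B *ᵥ S.loopControl ν w π t (S.loop ν w π x₀ ω t).2 ω + w t ω
  have hstep : ∀ t ω, X (t + 1) ω = S.A *ᵥ X t ω + g t ω := fun t ω => add_assoc _ _ _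
  have hctrl : ∀ t y ω, ‖S.loopControl ν w π t y ω‖ ≤ S.Umax :=
    norm_loopControl_le S hd.ν_bernoulli fun n x => (hfeas n x).2.1
  have horth : SecondMomentBounded P fun t ω => l2 (D.orthLin (X t ω)) := by
    obtain ⟨c, hc, hin⟩ := exists_l2_input_le S D.orthLin
    obtain ⟨C, hC, hC'⟩ := exists_lintegral_orth_le S D hd hr hε hζ hπ hfeas x₀
    have h1 : SecondMomentBounded P fun t ω => l2 (D.orthLin (X (t / κ * κ) ω)) :=
      SecondMomentBounded.of_lintegral (fun t => hl2m D.orthLin _) hC fun t => hC' (t / κ)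
    have h2 : SecondMomentBounded P fun t ω =>
        ∑ l ∈ Finset.range κ, (c + c * ‖w (t / κ * κ + l) ω‖) := by
      obtain ⟨C, hC⟩ := hd.secondMomentBounded_window κ c c
      exact ⟨C, fun t => hC (t / κ * κ)⟩
    refine (h1.add h2 (fun t => hl2m D.orthLin _) fun t => ?_).mono (fun t => hl2m D.orthLin t)
      (fun t ω => l2_nonneg _) fun t ω => ?_
    · exact Finset.measurable_sum _ fun l _ => ((hd.w_measurable _).norm.const_mul _).const_add _
    -- As `Ao` is an isometry, the norm grows by at most the inputs since the latest recalculation;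
    -- their sum is then enlarged to a full window.
    · have h3 : ∀ n i, l2 (D.orthLin (X (n + i) ω)) ≤ l2 (D.orthLin (X n ω))
          + ∑ l ∈ Finset.range i, (c + c * ‖w (n + l) ω‖) := by
        intro n i
        induction i with
        | zero => simp
        | succ i ih =>
          rw [← add_assoc, hstep, map_add, orthLin_mulVec, Finset.sum_range_succ, ← add_assoc]
          refine (l2_add_le _ _).trans (add_le_add ?_ (hin _ _ (hctrl _ _ _)))
          rw [l2_mulVec_of_orthogonal D.orthogonal]
          exact ih
      have h4 := h3 (t / κ * κ) (t % κ)
      rw [Nat.div_add_mod'] at h4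
      refine h4.trans (add_le_add le_rfl (Finset.sum_le_sum_of_subset_of_nonneg ?_ ?_))
      · exact Finset.range_mono (Nat.mod_lt _ S.one_le_κ).le
      · intro l _ _; positivity
  have hschur : SecondMomentBounded P fun t ω => l2 (D.schurLin (X t ω)) := by
    obtain ⟨c, hc, hin⟩ := exists_l2_input_le S D.schurLin
    -- A summable kernel: it bounds the free response and turns the forced response into a
    -- convolution with inputs bounded in mean square.
    let e : ℕ → ℝ := fun k => ∑ i, ∑ j, |(D.As ^ k) i j|
    have he0 : ∀ k, 0 ≤ e k := fun k =>
      Finset.sum_nonneg fun i _ => Finset.sum_nonneg fun j _ => abs_nonneg _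
    have he : Summable e := summable_sum fun i _ => summable_sum fun j _ => D.schur.summable_pow i j
    have h1 : SecondMomentBounded P fun t ω => c + c * ‖w t ω‖ := by
      simpa using hd.secondMomentBounded_window 1 c c
    have h1m : ∀ t, Measurable fun ω => c + c * ‖w t ω‖ := fun t =>
      ((hd.w_measurable t).norm.const_mul _).const_add _
    have h2 := h1.convolution h1m he0 he
    refine ((SecondMomentBounded.const ((∑' k, e k) * l2 (D.schurLin x₀))).add h2
      (fun t => measurable_const) fun t => ?_).mono (fun t => hl2m D.schurLin t)
      (fun t ω => l2_nonneg _) fun t ω => ?_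
    · exact Finset.measurable_sum _ fun l _ => (h1m l).const_mul _
    · have h3 : D.schurLin (X t ω) = D.As ^ t *ᵥ D.schurLin x₀
          + ∑ l ∈ Finset.range t, D.As ^ (t - 1 - l) *ᵥ D.schurLin (g l ω) := by
        induction t with
        | zero => simp [X, Problem.loop]
        | succ t ih =>
          rw [hstep, map_add, schurLin_mulVec, ih, Nat.add_sub_cancel, sum_pow_mulVec_succ,
            Matrix.mulVec_add, pow_succ', Matrix.mulVec_mulVec, add_assoc]
      rw [h3]
      refine (l2_add_le _ _).trans (add_le_add ?_ ((l2_sum_le _ _).trans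
        (Finset.sum_le_sum fun l _ => ?_)))
      · refine (l2_mulVec_le _ _).trans (mul_le_mul_of_nonneg_right ?_ (l2_nonneg _))
        exact he.le_tsum t fun k _ => he0 k
      · exact (l2_mulVec_le _ _).trans
          (mul_le_mul_of_nonneg_left (hin _ _ (hctrl _ _ _)) (he0 _))
  obtain ⟨c, hc, hcx⟩ := exists_l2_le_orth_add_schur S D
  obtain ⟨C, hC⟩ := ((horth.add hschur (fun t => hl2m D.orthLin t)
    (fun t => hl2m D.schurLin t)).const_mul c).mono (f := fun t ω => l2 (X t ω))
    (fun t => continuous_l2.measurable.comp (hXm t)) (fun t ω => l2_nonneg _)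
    fun t ω => hcx (X t ω)
  refine ⟨C, fun t => ?_⟩
  simpa only [l2_sq] using hC t

end ClosedLoop

end NetMPC

theorem mainTheorem4 {d m N κ : ℕ} (S : Problem d m N κ)
    (hA : LyapunovStable S.A) (hAB : Stabilizable S.A S.B)
    {Ω : Type*} [MeasurableSpace Ω] (P : Measure Ω) [IsProbabilityMeasure P] (p : ℝ)
    (ν : ℕ → Ω → ℝ) (w : ℕ → Ω → Fin d → ℝ) (hd : IsDisturbance P p ν w) :
    -- the decomposition exists, and its orthogonal part is reachable in finitely many steps
    (∃ dO dS : ℕ, Nonempty (OrthSchurDecomp S.A dO dS)) ∧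
    (∀ (dO dS : ℕ) (D : OrthSchurDecomp S.A dO dS),
      ∃ k : ℕ, 0 < k ∧ (reachMatrix D.Ao (D.Bo S.B) k).rank = dO) ∧
    ∀ (dO dS : ℕ) (D : OrthSchurDecomp S.A dO dS),
      (reachMatrix D.Ao (D.Bo S.B) κ).rank = dO →
      ∀ r ε ζ : ℝ, 0 < r → 0 < ε → 0 < ζ →
        ζ * (√(dO : ℝ) * sigmaMax (rowPinv (reachMatrix D.Ao (D.Bo S.B) κ))) < S.Umax →
        -- (i) at the times `t = n κ`: convexity, feasibility, and the quadratic program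
        (∀ (n : ℕ) (x : Fin d → ℝ),
          S.ocpFeasible D p r ε ζ x = S.qpFeasible D p r ε ζ x ∧
          (∀ z ∈ S.ocpFeasible D p r ε ζ x,
            Integrable (S.randomCost ν w (n * κ) x z) P ∧
            S.ocpObjective P ν w (n * κ) x z = S.qpObjective P ν w (n * κ) x z) ∧
          Convex ℝ (S.ocpFeasible D p r ε ζ x) ∧
          ConvexOn ℝ (S.ocpFeasible D p r ε ζ x) (S.ocpObjective P ν w (n * κ) x) ∧
          (S.ocpFeasible D p r ε ζ x).Nonempty ∧
          IsConvexQP (S.qpFeasible D p r ε ζ x) (S.qpObjective P ν w (n * κ) x)) ∧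
        -- (ii) optimal policies exist, and each of them makes the closed loop mean-square bounded
        (∃ π, S.IsOptimalPolicy P ν w D p r ε ζ π) ∧
        ∀ π, S.IsOptimalPolicy P ν w D p r ε ζ π → ∀ x₀ : Fin d → ℝ,
          (∀ t ω, ‖S.loopControl ν w π t (S.loop ν w π x₀ ω t).2 ω‖ ≤ S.Umax) ∧
          MeanSquareBounded P (fun t ω => (S.loop ν w π x₀ ω t).1) := by
  refine ⟨exists_orthSchurDecomp S.A hA, fun dO dS D => D.exists_reach S.B hAB, ?_⟩
  intro dO dS D hrank r ε ζ hr hε hζ hU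
  have hne := ocpFeasible_nonempty S D hrank hr hε hζ hU p
  refine ⟨fun n x => ?_, exists_optimalPolicy S hd D r ε ζ hne, fun π hπ x₀ => ⟨fun t ω => ?_, ?_⟩⟩
  · have hconv : Convex ℝ (S.ocpFeasible D p r ε ζ x) := by
      rw [ocpFeasible_eq_qpFeasible, qpFeasible_eq_patternFeasible]
      exact (isPolyhedron_patternFeasible S D p ζ _ _).convex
    have hobj : ∀ z ∈ S.ocpFeasible D p r ε ζ x,
        Integrable (S.randomCost ν w (n * κ) x z) P ∧
          S.ocpObjective P ν w (n * κ) x z = S.qpObjective P ν w (n * κ) x z := fun z hz =>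
      hd.integrable_randomCost_and_objective_eq S (n * κ) x z hz.1
    exact ⟨ocpFeasible_eq_qpFeasible S D p r ε ζ x, hobj, hconv,
      ((convexOn_qpObjective S (n * κ) hd x).subset (Set.subset_univ _) hconv).congr
        fun z hz => (hobj z hz).2.symm,
      hne x, isConvexQP_qp S (n * κ) hd D r ε ζ x⟩
  · exact norm_loopControl_le S hd.ν_bernoulli (fun n x => ((hπ n).2 x).1.2.1) t _ ω
  · exact meanSquareBounded_loop S D hd hr hε hζ (fun n => (hπ n).1) (fun n x => ((hπ n).2 x).1) x₀
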